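/- Let $\mathrm{KT}^4=S^1\times(H_3(\mathbb Z)\backslash H_3(\mathbb R))$ be the Kodaira–Thurston manifold, i.e. the quotient of $\mathbb R^4$ with coordinates $(t,x,y,z)$ by the transformations $(t,x,y,z)\mapsto(t+t_0,\,x+x_0,\,y+y_0,\,z+z_0+x_0y)$ with $t_0,x_0,y_0,z_0\in\mathbb Z$. For $a\in\mathbb R$ and $b\in\mathbb R\setminus\{0\}$ let $J_{a,b}$ be the almost complex structure on $\mathrm{KT}^4$ which in the frame $\partial_t,\ \partial_x,\ \partial_y+x\partial_z,\ \partial_z$ is given by the matrix $$J_{a,b}=\begin{pmatrix}0&-1&0&0\\1&0&0&0\\0&0&a&b\\0&0&c&-a\end{pmatrix},\qquad c=-\frac{a^2+1}{b},$$ and let the standard orthonormal metric be the Hermitian metric for which $\phi_1=dt+i\,dx$ and $\phi_2=(1-ai)\,dy-ib\,(dz-x\,dy)$ form a unitary basis of the $(1,0)$-forms. Let $\bar\partial$ and $\partial$ be the components of $d$ that map $(p,q)$-forms to $(p,q+1)$-forms and to $(p+1,q)$-forms respectively, let $\bar\partial^*=-{*}\,\partial\,{*}$ with the Hodge star $*$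 of this metric, and let $h^{0,1}$ be the complex dimension of the kernel $\mathcal H^{0,1}$ of $\Delta_{\bar\partial}=\bar\partial\bar\partial^*+\bar\partial^*\bar\partial$ on smooth $(0,1)$-forms on $\mathrm{KT}^4$. Let $p\neq0$ be an integer and $q\ge1$ an integer with $\gcd(p,q)=1$, and suppose that $d=\dfrac{b}{8\pi}=\dfrac pq$. Then, for every $a\in\mathbb R$, the space $\mathcal H^{0,1}$ is finite-dimensional and $h^{0,1}$ is equal to the (finite) number of pairs of integers $(m,l)$ with $$(l-d)^2+m^2=d^2.$$ Moreover, write $p^2=2^{\alpha_0}p_1^{\alpha_1}\cdots p_s^{\alpha_s}q_1^{\beta_1}\cdots q_t^{\beta_t}$ with distinct primes $p_i\equiv3\pmod 4$ and $q_j\equiv1\pmod 4$. Then $$h^{0,1}=\begin{cases}4(\beta_1+1)\cdots(\beta_t+1)&\text{if }q=1,\\2(\beta_1+1)\cdots(\beta_t+1)&\text{if }q=2,\\(\beta_1+1)\cdots(\beta_t+1)&\text{if }q\in\{3,4,5\}.\end{cases}$$ -/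

import Mathlib

open scoped ContDiff

noncomputable section

namespace KT

/-! ### The Kodaira-Thurston manifold through its universal covering

`KT⁴ = S¹ × (H₃(ℤ) \ H₃(ℝ))` is the quotient of `ℝ⁴`, with coordinates `(t, x, y, z)` numbered
`0, 1, 2, 3`, by the free and properly discontinuous action of the group `ℤ × H₃(ℤ)`.  A smooth
form on `KT⁴` is a smooth form on `ℝ⁴` that every deck transformation pulls back to itself. -/

/-- The universal covering `ℝ⁴` of `KT⁴`, with coordinates `(t, x, y, z)`. -/
abbrev Cover : Type := Fin 4 → ℝ

/-- The element of the Heisenberg group with coordinates `x, y, z`. -/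
def heis {R : Type*} [CommRing R] (x y z : R) : Matrix (Fin 3) (Fin 3) R :=
  !![1, x, z; 0, 1, y; 0, 0, 1]

/-- The deck transformation of `ℝ⁴ → KT⁴` given by `(t₀, x₀, y₀, z₀) ∈ ℤ⁴`. -/
def deck (n : Fin 4 → ℤ) (v : Cover) : Cover :=
  ![v 0 + n 0, v 1 + n 1, v 2 + n 2, v 3 + n 3 + n 1 * v 2]

/-- Deck transformations are translations in `t` and left multiplications by `H₃(ℤ)`. -/
theorem heis_deck (n : Fin 4 → ℤ) (v : Cover) :
    heis (deck n v 1) (deck n v 2) (deck n v 3) =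
      heis (n 1 : ℝ) (n 2) (n 3) * heis (v 1) (v 2) (v 3) := by
  ext i j
  fin_cases i <;> fin_cases j <;>
    simp [heis, deck, Matrix.mul_apply, Fin.sum_univ_three]
  ring

/-- Complex valued alternating `k`-forms on a tangent space of `ℝ⁴`. -/
abbrev Alt (k : ℕ) : Type := Cover [⋀^Fin k]→L[ℝ] ℂ

/-- Complex valued differential `k`-forms on `ℝ⁴`. -/
abbrev Form (k : ℕ) : Type := Cover → Alt k

/-- The form descends to `KT⁴`: every deck transformation pulls it back to itself. -/
def Descends {k : ℕ} (α : Form k) : Prop :=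
  ∀ (n : Fin 4 → ℤ) (v : Cover),
    (α (deck n v)).compContinuousLinearMap (fderiv ℝ (deck n) v) = α v

/-! ### The almost complex structure and the metric -/

/-- The global frame `∂/∂t, ∂/∂x, ∂/∂y + x ∂/∂z, ∂/∂z`. -/
def frame (v : Cover) : Fin 4 → Cover :=
  ![![1, 0, 0, 0], ![0, 1, 0, 0], ![0, 0, 1, v 1], ![0, 0, 0, 1]]

/-- The dual coframe `dt, dx, dy, dz - x dy`. -/
def coframe (v : Cover) : Fin 4 → Cover →L[ℝ] ℝ :=
  ![ContinuousLinearMap.proj 0, ContinuousLinearMap.proj 1, ContinuousLinearMap.proj 2,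
    ContinuousLinearMap.proj 3 - v 1 • ContinuousLinearMap.proj 2]

/-- The matrix of `J_{a,b}` in the frame. -/
def JMatrix (a b : ℝ) : Matrix (Fin 4) (Fin 4) ℝ :=
  !![0, -1, 0, 0;
     1, 0, 0, 0;
     0, 0, a, b;
     0, 0, -(a ^ 2 + 1) / b, -a]

/-- The almost complex structure `J_{a,b}` at the point `v`. -/
def J (a b : ℝ) (v : Cover) : Cover →L[ℝ] Cover :=
  ∑ i, ∑ j, JMatrix a b i j • (coframe v j).smulRight (frame v i)

/-- The `(1,0)`-form `φ₁ = dt + i dx`. -/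
def phi1 (v : Cover) : Cover →L[ℝ] ℂ :=
  Complex.ofRealCLM.comp (coframe v 0) + Complex.I • Complex.ofRealCLM.comp (coframe v 1)

/-- The `(1,0)`-form `φ₂ = (1 - a i) dy - i b (dz - x dy)`. -/
def phi2 (a b : ℝ) (v : Cover) : Cover →L[ℝ] ℂ :=
  (1 - (a : ℂ) * Complex.I) • Complex.ofRealCLM.comp (coframe v 2) -
    (Complex.I * (b : ℂ)) • Complex.ofRealCLM.comp (coframe v 3)

/-- The complex conjugate of a complex valued linear form. -/
def conjForm (φ : Cover →L[ℝ] ℂ) : Cover →L[ℝ] ℂ :=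
  (Complex.conjCLE : ℂ →L[ℝ] ℂ).comp φ

/-- The standard orthonormal metric: the Riemannian metric of the Hermitian metric for which
`φ₁, φ₂` is a unitary basis of the `(1,0)`-forms. -/
def metric (a b : ℝ) (v u w : Cover) : ℝ :=
  (phi1 v u * conjForm (phi1 v) w + phi2 a b v u * conjForm (phi2 a b v) w).re

/-- The frame `e₀ = ∂/∂t`, `e₁ = J e₀ = ∂/∂x`, `e₂ = ∂/∂y + x ∂/∂z - (a/b) ∂/∂z`,
`e₃ = J e₂ = -(1/b) ∂/∂z`, which is orthonormal for the metric (`metric_unitaryFrame`). -/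
def unitaryFrame (a b : ℝ) (v : Cover) : Fin 4 → Cover :=
  ![frame v 0, frame v 1, frame v 2 - (a / b) • frame v 3, -(1 / b) • frame v 3]

theorem phi1_J (a b : ℝ) (v u : Cover) : phi1 v (J a b v u) = Complex.I * phi1 v u := by
  simp [phi1, J, JMatrix, frame, coframe, Fin.sum_univ_four]
  linear_combination (-(u 1 : ℂ)) * Complex.I_sq

theorem phi2_J {a b : ℝ} (hb : b ≠ 0) (v u : Cover) :
    phi2 a b v (J a b v u) = Complex.I * phi2 a b v u := by
  have hb' : (b : ℂ) ≠ 0 := by exact_mod_cast hb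
  simp [phi2, J, JMatrix, frame, coframe, Fin.sum_univ_four]
  field_simp
  ring_nf
  simp only [Complex.I_sq]
  ring

theorem J_unitaryFrame {a b : ℝ} (hb : b ≠ 0) (v : Cover) :
    J a b v (unitaryFrame a b v 0) = unitaryFrame a b v 1 ∧
      J a b v (unitaryFrame a b v 2) = unitaryFrame a b v 3 := by
  constructor <;> ext i <;> fin_cases i <;>
    simp [unitaryFrame, J, JMatrix, frame, coframe, Fin.sum_univ_four] <;> field_simp <;> ring

theorem metric_unitaryFrame {a b : ℝ} (hb : b ≠ 0) (v : Cover) (i j : Fin 4) :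
    metric a b v (unitaryFrame a b v i) (unitaryFrame a b v j) = if i = j then 1 else 0 := by
  fin_cases i <;> fin_cases j <;>
    simp [metric, unitaryFrame, phi1, phi2, conjForm, frame, coframe] <;> field_simp <;> simp

/-! ### Linear algebra: wedge products, Hodge star, bidegree -/

/-- The wedge product `θ₀ ∧ ⋯ ∧ θ_{k-1}` of one-forms, `v ↦ det (θ i (v j))`. -/
def wedge {k : ℕ} (θ : Fin k → Cover →L[ℝ] ℂ) : Alt k :=
  ((ContinuousMultilinearMap.mkPiAlgebra ℝ (Fin k) ℂ).compContinuousLinearMap θ).alternatization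

/-- The volume form `(i/2)² φ₁ ∧ φ̄₁ ∧ φ₂ ∧ φ̄₂` of the metric, for the orientation given by
`J_{a,b}`; it is `ω²/2` for the fundamental form `ω = (i/2)(φ₁ ∧ φ̄₁ + φ₂ ∧ φ̄₂)`. -/
def vol (a b : ℝ) (v : Cover) : Alt 4 :=
  (Complex.I / 2) ^ 2 •
    wedge ![phi1 v, conjForm (phi1 v), phi2 a b v, conjForm (phi2 a b v)]

/-- Insertion of `w 0, …, w (k-1)` into the first `k` arguments of a form. -/
def contract {l : ℕ} : (k : ℕ) → (Fin k → Cover) → Alt (l + k) → Alt l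
  | 0, _, α => α
  | k + 1, w, α => contract k (fun i => w i.succ) (α.curryLeft (w 0))

/-- The complex linear Hodge star `Λᵏ → Λˡ` for an orthonormal basis `e` with volume form `μ`:
`*α = (1/k!) ∑ α(e_{i₁}, …, e_{i_k}) μ(e_{i₁}, …, e_{i_k}, ⋯)`, the sum being over all
multi-indices.  It is characterised by `α ∧ *β̄ = ⟨α, β⟩ μ`. -/
def star {k l : ℕ} (μ : Alt (l + k)) (e : Fin (l + k) → Cover) (α : Alt k) : Alt l :=
  ((k.factorial : ℂ))⁻¹ • ∑ i : Fin k → Fin (l + k), α (e ∘ i) • contract k (e ∘ i) μ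

/-- The rotation `exp (θ j) = cos θ + (sin θ) j` given by a complex structure `j`. -/
def rot (j : Cover →L[ℝ] Cover) (θ : ℝ) : Cover →L[ℝ] Cover :=
  Real.cos θ • ContinuousLinearMap.id ℝ Cover + Real.sin θ • j

/-- A form of degree `k = p + q` has type `(p,q)` for the complex structure `j`.  The rotation
`exp (θ j)` multiplies `(1,0)`-forms by `exp (i θ)` and `(0,1)`-forms by `exp (- i θ)`, so in degree
`p + q` the forms of type `(p,q)` are those that it multiplies by `exp (i (p - q) θ)`. -/
def IsType (j : Cover →L[ℝ] Cover) (p q : ℕ) {k : ℕ} (α : Alt k) : Prop :=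
  ∀ θ : ℝ, α.compContinuousLinearMap (rot j θ) =
    Complex.exp (Complex.I * ((p : ℂ) - q) * θ) • α

/-- The `(p,q)`-component of a form of degree `k = p + q`: the average, over the `k + 1` angles
`θ = π r / (k + 1)`, of `exp (- i (p - q) θ)` times the pull-back by `exp (θ j)`.  This is the
projection to the forms of type `(p,q)` along the other types, see `typeProj_of_isType`. -/
def typeProj (j : Cover →L[ℝ] Cover) (p q : ℕ) {k : ℕ} (α : Alt k) : Alt k :=
  ((k : ℂ) + 1)⁻¹ • ∑ r : Fin (k + 1),
    Complex.exp (-(Complex.I * ((p : ℂ) - q) * ((Real.pi * (r : ℕ) / (k + 1) : ℝ) : ℂ))) •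
      α.compContinuousLinearMap (rot j (Real.pi * (r : ℕ) / (k + 1)))

/-- `typeProj` fixes the forms of type `(p,q)` and kills those of any other type of the same
degree. -/
theorem typeProj_of_isType (j : Cover →L[ℝ] Cover) {p q p' q' k : ℕ} (h : p + q = k)
    (h' : p' + q' = k) {α : Alt k} (hα : IsType j p' q' α) :
    typeProj j p q α = if p' = p then α else 0 := by
  set ζ : ℂ := Complex.exp (2 * Real.pi * Complex.I / ((k + 1 : ℕ) : ℂ)) with hζ
  have hprim : IsPrimitiveRoot ζ (k + 1) := Complex.isPrimitiveRoot_exp _ (Nat.succ_ne_zero k)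
  have hk : ((k : ℂ) + 1) ≠ 0 := by exact_mod_cast Nat.succ_ne_zero k
  have key : ∀ r : ℕ,
      Complex.exp (-(Complex.I * ((p : ℂ) - q) * ((Real.pi * r / (k + 1) : ℝ) : ℂ))) *
        Complex.exp (Complex.I * ((p' : ℂ) - q') * ((Real.pi * r / (k + 1) : ℝ) : ℂ)) =
      (ζ ^ ((p' : ℤ) - p)) ^ r := by
    intro r
    rw [hζ, ← Complex.exp_add, ← Complex.exp_int_mul, ← Complex.exp_nat_mul]
    congr 1
    have e1 : (q : ℂ) = k - p := by rw [← h]; push_cast; ring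
    have e2 : (q' : ℂ) = k - p' := by rw [← h']; push_cast; ring
    rw [e1, e2]
    push_cast
    field_simp
    ring
  have step : typeProj j p q α =
      (((k : ℂ) + 1)⁻¹ * ∑ r ∈ Finset.range (k + 1), (ζ ^ ((p' : ℤ) - p)) ^ r) • α := by
    ext v
    simp only [typeProj, hα _, ContinuousAlternatingMap.smul_apply,
      ContinuousAlternatingMap.sum_apply, smul_eq_mul]
    rw [mul_assoc, Finset.sum_mul,
      ← Fin.sum_univ_eq_sum_range (fun r => ((ζ ^ ((p' : ℤ) - p)) ^ r) * α v)]
    congr 1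
    refine Finset.sum_congr rfl fun r _ => ?_
    rw [← mul_assoc, key]
  rw [step]
  split_ifs with hp
  · simp [hp, hk]
  · have hne : ζ ^ ((p' : ℤ) - p) ≠ 1 := by
      intro h1
      rw [hprim.zpow_eq_one_iff_dvd] at h1
      obtain ⟨c, hc⟩ := h1
      have hc0 : c = 0 := by
        by_contra hc0
        rcases lt_or_gt_of_ne hc0 with h2 | h2
        · have : ((k + 1 : ℕ) : ℤ) * c ≤ ((k + 1 : ℕ) : ℤ) * (-1) := by gcongr; omega
          push_cast at *
          omega
        · have : ((k + 1 : ℕ) : ℤ) * 1 ≤ ((k + 1 : ℕ) : ℤ) * c := by gcongr; omega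
          push_cast at *
          omega
      rw [hc0] at hc
      omega
    have h1 : (ζ ^ ((p' : ℤ) - p)) ^ (k + 1) = 1 := by
      rw [← zpow_natCast, ← zpow_mul, mul_comm, zpow_mul, zpow_natCast, hprim.pow_eq_one,
        one_zpow]
    rw [geom_sum_eq hne, h1, sub_self, zero_div, mul_zero]
    exact zero_smul ℂ α

/-! ### The operators and the space of harmonic forms -/

/-- `∂̄` on forms of type `(p,q)`: the `(p,q+1)`-component of the exterior derivative. -/
def dbar (a b : ℝ) (p q : ℕ) {k : ℕ} (α : Form k) : Form (k + 1) :=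
  fun v => typeProj (J a b v) p (q + 1) (extDeriv α v)

/-- `∂` on forms of type `(p,q)`: the `(p+1,q)`-component of the exterior derivative. -/
def del (a b : ℝ) (p q : ℕ) {k : ℕ} (α : Form k) : Form (k + 1) :=
  fun v => typeProj (J a b v) (p + 1) q (extDeriv α v)

/-- The Hodge star of the standard orthonormal metric on one-forms. -/
def hodge1 (a b : ℝ) (α : Form 1) : Form 3 :=
  fun v => star (k := 1) (l := 3) (vol a b v) (unitaryFrame a b v) (α v)

/-- The Hodge star on two-forms. -/
def hodge2 (a b : ℝ) (α : Form 2) : Form 2 :=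
  fun v => star (k := 2) (l := 2) (vol a b v) (unitaryFrame a b v) (α v)

/-- The Hodge star on three-forms. -/
def hodge3 (a b : ℝ) (α : Form 3) : Form 1 :=
  fun v => star (k := 3) (l := 1) (vol a b v) (unitaryFrame a b v) (α v)

/-- The Hodge star on four-forms. -/
def hodge4 (a b : ℝ) (α : Form 4) : Form 0 :=
  fun v => star (k := 4) (l := 0) (vol a b v) (unitaryFrame a b v) (α v)

/-- `∂̄* = - * ∂ *` on `(0,1)`-forms; the star of a `(0,1)`-form has type `(1,2)`. -/
def dbarStar01 (a b : ℝ) (α : Form 1) : Form 0 :=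
  -hodge4 a b (del a b 1 2 (hodge1 a b α))

/-- `∂̄* = - * ∂ *` on `(0,2)`-forms; the star of a `(0,2)`-form has type `(0,2)`. -/
def dbarStar02 (a b : ℝ) (α : Form 2) : Form 1 :=
  -hodge3 a b (del a b 0 2 (hodge2 a b α))

/-- The `∂̄`-Laplacian `∂̄ ∂̄* + ∂̄* ∂̄` on `(0,1)`-forms. -/
def dbarLaplacian (a b : ℝ) (α : Form 1) : Form 1 :=
  dbar a b 0 0 (dbarStar01 a b α) + dbarStar02 a b (dbar a b 0 1 α)

/-! Linearity of the Laplacian on smooth forms, needed for the harmonic forms to be a space. -/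

section linearity

variable {k l : ℕ}

theorem alt_expand (α : Alt k) (w : Fin k → Cover) :
    α w = ∑ i : Fin k → Fin 4, ((∏ r, w r (i r) : ℝ) : ℂ) * α (fun r => Pi.single (i r) 1) := by
  have hw : w = fun r => ∑ s : Fin 4, w r s • (Pi.single s (1 : ℝ) : Cover) := by
    funext r
    exact pi_eq_sum_univ' (w r)
  conv_lhs => rw [hw]
  rw [← ContinuousAlternatingMap.coe_toAlternatingMap, ← AlternatingMap.coe_multilinearMap,
    MultilinearMap.map_sum]
  refine Finset.sum_congr rfl fun i _ => ?_
  rw [MultilinearMap.map_smul_univ, Complex.real_smul]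

/-- A form is smooth as soon as its values on constant vectors are. -/
theorem contDiff_of_apply {α : Form k} (h : ∀ w, ContDiff ℝ ∞ fun v => α v w) :
    ContDiff ℝ ∞ α := by
  let T : Alt k →ₗ[ℝ] ((Fin k → Fin 4) → ℂ) :=
    { toFun := fun β i => β (fun r => Pi.single (i r) 1)
      map_add' := fun _ _ => rfl
      map_smul' := fun _ _ => rfl }
  have hT : LinearMap.ker T = ⊥ := by
    rw [LinearMap.ker_eq_bot]
    intro β γ hβγ
    ext w
    rw [alt_expand β, alt_expand γ]
    exact Finset.sum_congr rfl fun i _ => congrArg _ (congrFun hβγ i)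
  obtain ⟨S, hS⟩ := T.exists_leftInverse_of_injective hT
  have e : α = fun v => LinearMap.toContinuousLinearMap S (T (α v)) := by
    funext v
    exact (LinearMap.congr_fun hS (α v)).symm
  rw [e]
  exact (LinearMap.toContinuousLinearMap S).contDiff.comp (contDiff_pi.2 fun i => h _)

theorem contDiff_apply_vec {α : Form k} (hα : ContDiff ℝ ∞ α) {w : Cover → Fin k → Cover}
    (hw : ∀ r, ContDiff ℝ ∞ fun v => w v r) : ContDiff ℝ ∞ fun v => α v (w v) := by
  have h1 : ∀ u : Fin k → Cover, ContDiff ℝ ∞ fun v => α v u := fun u =>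
    (ContinuousAlternatingMap.apply ℝ Cover ℂ u).contDiff.comp hα
  simp_rw [alt_expand (α _) (w _)]
  refine ContDiff.sum fun i _ => ContDiff.mul (Complex.ofRealCLM.contDiff.comp ?_) (h1 _)
  have h2 : ∀ r, ContDiff ℝ ∞ fun v => w v r (i r) := fun r =>
    (contDiff_apply ℝ ℝ (i r)).comp (hw r)
  exact contDiff_prod (t := Finset.univ) fun r _ => h2 r

theorem contDiff_contract (k : ℕ) {w : Cover → Fin k → Cover} {α : Form (l + k)}
    (hα : ContDiff ℝ ∞ α) (hw : ∀ r, ContDiff ℝ ∞ fun v => w v r) :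
    ContDiff ℝ ∞ fun v => contract k (w v) (α v) := by
  induction k with
  | zero => exact hα
  | succ k ih =>
    refine ih (w := fun v i => w v i.succ) (α := fun v => (α v).curryLeft (w v 0)) ?_
      fun r => hw r.succ
    refine contDiff_of_apply fun u => ?_
    refine contDiff_apply_vec (w := fun v => Matrix.vecCons (w v 0) u) hα fun r => ?_
    refine Fin.cases ?_ (fun r => ?_) r
    · exact hw 0
    · exact contDiff_const

theorem contDiff_star {μ : Form (l + k)} {e : Cover → Fin (l + k) → Cover} {α : Form k}
    (hμ : ContDiff ℝ ∞ μ) (he : ∀ r, ContDiff ℝ ∞ fun v => e v r) (hα : ContDiff ℝ ∞ α) :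
    ContDiff ℝ ∞ fun v => star (μ v) (e v) (α v) := by
  refine contDiff_of_apply fun u => ?_
  simp only [star, ContinuousAlternatingMap.smul_apply, ContinuousAlternatingMap.sum_apply,
    smul_eq_mul]
  refine contDiff_const.mul (ContDiff.sum fun i _ => ?_)
  refine (contDiff_apply_vec (w := fun v => e v ∘ i) hα fun r => he (i r)).mul ?_
  exact (ContinuousAlternatingMap.apply ℝ Cover ℂ u).contDiff.comp
    (contDiff_contract k (w := fun v => e v ∘ i) hμ fun r => he (i r))

theorem contDiff_coord (i : Fin 4) : ContDiff ℝ ∞ fun v : Cover => v i := contDiff_apply ℝ ℝ i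

theorem contDiff_frame (r : Fin 4) : ContDiff ℝ ∞ fun v => frame v r := by
  have h := contDiff_coord 1
  refine contDiff_pi.2 fun i => ?_
  fin_cases r <;> fin_cases i <;> simp [frame] <;> first | exact h | exact contDiff_const

theorem contDiff_unitaryFrame (a b : ℝ) (r : Fin 4) :
    ContDiff ℝ ∞ fun v => unitaryFrame a b v r := by
  have h := contDiff_frame
  fin_cases r
  · exact h 0
  · exact h 1
  · exact (h 2).sub ((h 3).const_smul (a / b))
  · exact (h 3).const_smul (-(1 / b))

theorem contDiff_coframe (r : Fin 4) : ContDiff ℝ ∞ fun v => coframe v r := by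
  have h := contDiff_coord 1
  fin_cases r
  · exact contDiff_const
  · exact contDiff_const
  · exact contDiff_const
  · exact contDiff_const.sub (h.smul contDiff_const)

theorem contDiff_coframe_apply (r : Fin 4) (u : Cover) :
    ContDiff ℝ ∞ fun v => coframe v r u := (contDiff_coframe r).clm_apply contDiff_const

theorem contDiff_J (a b : ℝ) : ContDiff ℝ ∞ (J a b) := by
  have h1 := contDiff_coframe
  have h2 := contDiff_frame
  unfold J
  exact ContDiff.sum fun i _ => ContDiff.sum fun j _ =>
    ((h1 j).smulRight (h2 i)).const_smul (JMatrix a b i j)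

theorem contDiff_phi1 (u : Cover) : ContDiff ℝ ∞ fun v => phi1 v u := by
  have h := fun r => Complex.ofRealCLM.contDiff.comp (contDiff_coframe_apply r u)
  exact (h 0).add (contDiff_const.mul (h 1))

theorem contDiff_phi2 (a b : ℝ) (u : Cover) : ContDiff ℝ ∞ fun v => phi2 a b v u := by
  have h := fun r => Complex.ofRealCLM.contDiff.comp (contDiff_coframe_apply r u)
  exact (contDiff_const.mul (h 2)).sub (contDiff_const.mul (h 3))

theorem contDiff_vol (a b : ℝ) : ContDiff ℝ ∞ (vol a b) := by
  refine contDiff_of_apply fun w => ?_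
  have key : ∀ (r : Fin 4) (u : Cover), ContDiff ℝ ∞ fun v =>
      (![phi1 v, conjForm (phi1 v), phi2 a b v, conjForm (phi2 a b v)] :
        Fin 4 → Cover →L[ℝ] ℂ) r u := by
    intro r u
    fin_cases r
    · exact contDiff_phi1 u
    · exact (Complex.conjCLE : ℂ →L[ℝ] ℂ).contDiff.comp (contDiff_phi1 u)
    · exact contDiff_phi2 a b u
    · exact (Complex.conjCLE : ℂ →L[ℝ] ℂ).contDiff.comp (contDiff_phi2 a b u)
  simp only [vol, wedge, ContinuousAlternatingMap.smul_apply,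
    ContinuousMultilinearMap.alternatization_apply_apply, smul_eq_mul]
  refine contDiff_const.mul (ContDiff.sum fun σ _ => ?_)
  refine ContDiff.const_smul _ ?_
  simp only [ContinuousMultilinearMap.compContinuousLinearMap_apply,
    ContinuousMultilinearMap.mkPiAlgebra_apply]
  exact contDiff_prod (t := Finset.univ) fun r _ => key r _

theorem contDiff_typeProj (a b : ℝ) (p q : ℕ) {α : Form k} (hα : ContDiff ℝ ∞ α) :
    ContDiff ℝ ∞ fun v => typeProj (J a b v) p q (α v) := by
  refine contDiff_of_apply fun w => ?_
  simp only [typeProj, ContinuousAlternatingMap.smul_apply, ContinuousAlternatingMap.sum_apply,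
    smul_eq_mul, ContinuousAlternatingMap.compContinuousLinearMap_apply]
  refine contDiff_const.mul (ContDiff.sum fun r _ => contDiff_const.mul ?_)
  refine contDiff_apply_vec hα fun s => ?_
  exact contDiff_const.add (contDiff_const.smul ((contDiff_J a b).clm_apply contDiff_const))

theorem contDiff_extDeriv {α : Form k} (hα : ContDiff ℝ ∞ α) : ContDiff ℝ ∞ (extDeriv α) := by
  refine contDiff_of_apply fun w => ?_
  have h1 : ∀ u : Fin k → Cover, ContDiff ℝ ∞ fun v => α v u := fun u =>
    (ContinuousAlternatingMap.apply ℝ Cover ℂ u).contDiff.comp hα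
  have h2 : Differentiable ℝ α := hα.differentiable (by simp)
  simp_rw [fun v => extDeriv_apply (h2 v) w]
  refine ContDiff.sum fun i _ => ContDiff.const_smul _ ?_
  exact ((h1 _).fderiv_right (m := ∞) le_rfl).clm_apply contDiff_const

theorem contDiff_dbar (a b : ℝ) (p q : ℕ) {α : Form k} (hα : ContDiff ℝ ∞ α) :
    ContDiff ℝ ∞ (dbar a b p q α) := contDiff_typeProj a b _ _ (contDiff_extDeriv hα)

theorem contDiff_del (a b : ℝ) (p q : ℕ) {α : Form k} (hα : ContDiff ℝ ∞ α) :
    ContDiff ℝ ∞ (del a b p q α) := contDiff_typeProj a b _ _ (contDiff_extDeriv hα)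

theorem contDiff_hodge1 (a b : ℝ) {α : Form 1} (hα : ContDiff ℝ ∞ α) :
    ContDiff ℝ ∞ (hodge1 a b α) :=
  contDiff_star (k := 1) (l := 3) (contDiff_vol a b) (contDiff_unitaryFrame a b) hα

theorem contDiff_hodge2 (a b : ℝ) {α : Form 2} (hα : ContDiff ℝ ∞ α) :
    ContDiff ℝ ∞ (hodge2 a b α) :=
  contDiff_star (k := 2) (l := 2) (contDiff_vol a b) (contDiff_unitaryFrame a b) hα

theorem contDiff_hodge4 (a b : ℝ) {α : Form 4} (hα : ContDiff ℝ ∞ α) :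
    ContDiff ℝ ∞ (hodge4 a b α) :=
  contDiff_star (k := 4) (l := 0) (contDiff_vol a b) (contDiff_unitaryFrame a b) hα

theorem contDiff_dbarStar01 (a b : ℝ) {α : Form 1} (hα : ContDiff ℝ ∞ α) :
    ContDiff ℝ ∞ (dbarStar01 a b α) :=
  (contDiff_hodge4 a b (contDiff_del a b 1 2 (contDiff_hodge1 a b hα))).neg

theorem star_lin (μ : Alt (l + k)) (e : Fin (l + k) → Cover) (α β : Alt k) (c : ℂ) :
    star μ e (α + c • β) = star μ e α + c • star μ e β := by
  ext u
  simp only [star, ContinuousAlternatingMap.smul_apply, ContinuousAlternatingMap.sum_apply,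
    ContinuousAlternatingMap.add_apply, smul_eq_mul, add_mul, Finset.sum_add_distrib, mul_add]
  simp only [Finset.mul_sum]
  congr 1
  exact Finset.sum_congr rfl fun i _ => by ring

theorem typeProj_lin (j : Cover →L[ℝ] Cover) (p q : ℕ) (α β : Alt k) (c : ℂ) :
    typeProj j p q (α + c • β) = typeProj j p q α + c • typeProj j p q β := by
  ext u
  simp only [typeProj, ContinuousAlternatingMap.smul_apply, ContinuousAlternatingMap.sum_apply,
    ContinuousAlternatingMap.compContinuousLinearMap_apply,
    ContinuousAlternatingMap.add_apply, smul_eq_mul, Finset.sum_add_distrib, mul_add]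
  simp only [Finset.mul_sum]
  congr 1
  exact Finset.sum_congr rfl fun i _ => by ring

theorem contDiff_lin {α β : Form k} (hα : ContDiff ℝ ∞ α) (hβ : ContDiff ℝ ∞ β) (c : ℂ) :
    ContDiff ℝ ∞ (α + c • β) := by
  have h : ∀ {γ : Form k}, ContDiff ℝ ∞ γ → ∀ w, ContDiff ℝ ∞ fun v => γ v w := fun hγ w =>
    (ContinuousAlternatingMap.apply ℝ Cover ℂ w).contDiff.comp hγ
  exact contDiff_of_apply fun w => (h hα w).add (contDiff_const.mul (h hβ w))

theorem extDeriv_lin {α β : Form k} (hα : ContDiff ℝ ∞ α) (hβ : ContDiff ℝ ∞ β) (c : ℂ) :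
    extDeriv (α + c • β) = extDeriv α + c • extDeriv β := by
  have d : ∀ {γ : Form k}, ContDiff ℝ ∞ γ → Differentiable ℝ γ := fun hγ =>
    hγ.differentiable (by simp)
  have dw : ∀ {γ : Form k}, ContDiff ℝ ∞ γ → ∀ w, Differentiable ℝ fun v => γ v w :=
    fun hγ w => (d hγ).continuousAlternatingMap_apply_const w
  funext v
  ext w
  change _ = extDeriv α v w + c * extDeriv β v w
  rw [extDeriv_apply (d (contDiff_lin hα hβ c) v), extDeriv_apply (d hα v),
    extDeriv_apply (d hβ v), Finset.mul_sum, ← Finset.sum_add_distrib]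
  refine Finset.sum_congr rfl fun i _ => ?_
  have e : (fun y => (α + c • β) y (i.removeNth w)) =
      fun y => α y (i.removeNth w) + c * β y (i.removeNth w) := rfl
  rw [e, fderiv_fun_add (dw hα _ v) ((dw hβ _ v).const_mul c), fderiv_const_mul (dw hβ _ v)]
  simp
  ring

theorem dbar_lin (a b : ℝ) (p q : ℕ) {α β : Form k} (hα : ContDiff ℝ ∞ α)
    (hβ : ContDiff ℝ ∞ β) (c : ℂ) :
    dbar a b p q (α + c • β) = dbar a b p q α + c • dbar a b p q β := by
  funext v
  simp only [dbar, extDeriv_lin hα hβ]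
  exact typeProj_lin _ _ _ _ _ c

theorem del_lin (a b : ℝ) (p q : ℕ) {α β : Form k} (hα : ContDiff ℝ ∞ α)
    (hβ : ContDiff ℝ ∞ β) (c : ℂ) :
    del a b p q (α + c • β) = del a b p q α + c • del a b p q β := by
  funext v
  simp only [del, extDeriv_lin hα hβ]
  exact typeProj_lin _ _ _ _ _ c

theorem neg_lin (α β : Form k) (c : ℂ) : -(α + c • β) = -α + c • -β := by
  funext v
  ext w
  change -(α v w + c * β v w) = -α v w + c * -β v w
  ring

theorem dbarStar01_lin (a b : ℝ) {α β : Form 1} (hα : ContDiff ℝ ∞ α) (hβ : ContDiff ℝ ∞ β)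
    (c : ℂ) : dbarStar01 a b (α + c • β) = dbarStar01 a b α + c • dbarStar01 a b β := by
  have h1 : hodge1 a b (α + c • β) = hodge1 a b α + c • hodge1 a b β :=
    funext fun v => star_lin (k := 1) (l := 3) _ _ _ _ c
  have h4 : ∀ γ δ : Form 4, hodge4 a b (γ + c • δ) = hodge4 a b γ + c • hodge4 a b δ :=
    fun γ δ => funext fun v => star_lin (k := 4) (l := 0) _ _ _ _ c
  rw [dbarStar01, h1, del_lin a b 1 2 (contDiff_hodge1 a b hα) (contDiff_hodge1 a b hβ), h4,
    neg_lin]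
  rfl

theorem dbarStar02_lin (a b : ℝ) {α β : Form 2} (hα : ContDiff ℝ ∞ α) (hβ : ContDiff ℝ ∞ β)
    (c : ℂ) : dbarStar02 a b (α + c • β) = dbarStar02 a b α + c • dbarStar02 a b β := by
  have h1 : hodge2 a b (α + c • β) = hodge2 a b α + c • hodge2 a b β :=
    funext fun v => star_lin (k := 2) (l := 2) _ _ _ _ c
  have h3 : ∀ γ δ : Form 3, hodge3 a b (γ + c • δ) = hodge3 a b γ + c • hodge3 a b δ :=
    fun γ δ => funext fun v => star_lin (k := 3) (l := 1) _ _ _ _ c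
  rw [dbarStar02, h1, del_lin a b 0 2 (contDiff_hodge2 a b hα) (contDiff_hodge2 a b hβ), h3,
    neg_lin]
  rfl

theorem dbarLaplacian_lin (a b : ℝ) {α β : Form 1} (hα : ContDiff ℝ ∞ α)
    (hβ : ContDiff ℝ ∞ β) (c : ℂ) :
    dbarLaplacian a b (α + c • β) = dbarLaplacian a b α + c • dbarLaplacian a b β := by
  unfold dbarLaplacian
  rw [dbarStar01_lin a b hα hβ,
    dbar_lin a b 0 0 (contDiff_dbarStar01 a b hα) (contDiff_dbarStar01 a b hβ),
    dbar_lin a b 0 1 hα hβ,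
    dbarStar02_lin a b (contDiff_dbar a b 0 1 hα) (contDiff_dbar a b 0 1 hβ)]
  funext v
  ext w
  simp only [Pi.add_apply, Pi.smul_apply, ContinuousAlternatingMap.add_apply,
    ContinuousAlternatingMap.smul_apply, smul_eq_mul]
  ring

end linearity

/-- The smooth `(0,1)`-forms on `(KT⁴, J_{a,b})`. -/
structure IsForm01 (a b : ℝ) (α : Form 1) : Prop where
  smooth : ContDiff ℝ ∞ α
  descends : Descends α
  type01 : ∀ v, IsType (J a b v) 0 1 (α v)

theorem isForm01_lin {a b : ℝ} {α β : Form 1} (hα : IsForm01 a b α) (hβ : IsForm01 a b β)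
    (c : ℂ) : IsForm01 a b (α + c • β) where
  smooth := contDiff_lin hα.smooth hβ.smooth c
  descends n v := by
    ext w
    have h1 := DFunLike.congr_fun (hα.descends n v) w
    have h2 := DFunLike.congr_fun (hβ.descends n v) w
    exact congrArg₂ (fun x y : ℂ => x + c * y) h1 h2
  type01 v θ := by
    ext w
    have h1 := DFunLike.congr_fun (hα.type01 v θ) w
    have h2 := DFunLike.congr_fun (hβ.type01 v θ) w
    refine (congrArg₂ (fun x y : ℂ => x + c * y) h1 h2).trans ?_
    simp only [Pi.add_apply, Pi.smul_apply, ContinuousAlternatingMap.add_apply,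
      ContinuousAlternatingMap.smul_apply, smul_eq_mul]
    ring

theorem isForm01_zero (a b : ℝ) : IsForm01 a b 0 where
  smooth := contDiff_const
  descends _ _ := rfl
  type01 _ _ := (smul_zero (M := ℂ) (A := Alt 1) _).symm

theorem dbarLaplacian_zero (a b : ℝ) : dbarLaplacian a b 0 = 0 := by
  have h0 : ContDiff ℝ ∞ (0 : Form 1) := contDiff_const
  have h := dbarLaplacian_lin a b h0 h0 (-1)
  funext v
  ext w
  have hz : (0 : Form 1) + (-1 : ℂ) • (0 : Form 1) = 0 := by
    funext v
    ext w
    change (0 : ℂ) + (-1) * 0 = 0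
    ring
  rw [hz] at h
  have h' := DFunLike.congr_fun (congrFun h v) w
  change dbarLaplacian a b 0 v w = dbarLaplacian a b 0 v w + (-1) * dbarLaplacian a b 0 v w at h'
  rw [h']
  change _ = (0 : ℂ)
  ring

/-- The space `ℋ^{0,1}` of `∂̄`-harmonic `(0,1)`-forms of `(KT⁴, J_{a,b})` with the standard
orthonormal metric: the kernel of the `∂̄`-Laplacian in the space of smooth `(0,1)`-forms. -/
def harmonic01 (a b : ℝ) : Submodule ℂ (Form 1) where
  carrier := {α | IsForm01 a b α ∧ dbarLaplacian a b α = 0}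
  zero_mem' := ⟨isForm01_zero a b, dbarLaplacian_zero a b⟩
  add_mem' := by
    rintro α β ⟨hα, hα'⟩ ⟨hβ, hβ'⟩
    have e : α + β = α + (1 : ℂ) • β := congrArg (α + ·) (one_smul ℂ β).symm
    rw [e]
    refine ⟨isForm01_lin hα hβ 1, ?_⟩
    rw [dbarLaplacian_lin a b hα.smooth hβ.smooth, hα', hβ']
    exact (zero_add _).trans (smul_zero (M := ℂ) (A := Form 1) 1)
  smul_mem' := by
    rintro c β ⟨hβ, hβ'⟩
    have e : c • β = 0 + c • β := (zero_add _).symm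
    rw [e]
    refine ⟨isForm01_lin (isForm01_zero a b) hβ c, ?_⟩
    rw [dbarLaplacian_lin a b (isForm01_zero a b).smooth hβ.smooth, dbarLaplacian_zero, hβ']
    exact (zero_add _).trans (smul_zero (M := ℂ) (A := Form 1) c)

/-- The Hodge number `h^{0,1}` of `(KT⁴, J_{a,b})` with the standard orthonormal metric. -/
def h01 (a b : ℝ) : ℕ := Module.finrank ℂ (harmonic01 a b)

/-- The integer pairs `(m, l)` on the circle `(l - d)² + m² = d²`. -/
def circlePoints (d : ℝ) : Set (ℤ × ℤ) :=
  {x | ((x.2 : ℝ) - d) ^ 2 + (x.1 : ℝ) ^ 2 = d ^ 2}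

/-- The product of `β + 1` over the exponents `β` with which the primes congruent to `1` modulo
`4` occur in `n`. -/
def oneModFourProd (n : ℕ) : ℕ :=
  ∏ r ∈ n.primeFactors with r % 4 = 1, (n.factorization r + 1)

end KT

end

/-! A smooth `(0,1)`-form on the quotient is `f φ̄₁ + g φ̄₂` with `f, g` invariant under the deck
group. Both `∂̄` and `∂̄*` have constant coefficients in the left-invariant frame, apart from a
zero-order term `b/4` that comes from `dφ̄₂`. Pairing the Laplacian with the form and integrating by
parts over the compact quotient shows that a form is harmonic exactly when `∂̄` and `∂̄*` kill it
(`dbarLaplacian_form01_eq_zero_iff`). These two equations can be solved for `∂f/∂x` and `∂g/∂x`.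

The pair is then expanded in Fourier modes with frequencies `k, m, n` in `t, y, z`; the field `∂/∂y
+ x ∂/∂z` acts on a mode as `2πi(m + n x)`. For `n ≠ 0` a mode decays faster than every power of
`x`, and the equations become a first order linear system on the line that is equivalent to a
harmonic oscillator. A nonzero decaying solution forces a resonance between the parameters and the
oscillator spectrum. For `b = 8πp/q` this resonance is a quadratic equation for `π` with integer
coefficients and nonzero leading term (`oscillator_nonresonance`). It has no solution, by a
Hermite–Lindemann argument for `π` (`pi_not_quadratic`), so all modes with `n ≠ 0` vanish.

For `n = 0` the modes are periodic in `x` as well, and with frequency `l` in `x` the equations are a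
homogeneous `2 × 2` linear system. Its determinant vanishes exactly when `k = 0` and `(m, l)` lies
on the circle, and then the kernel is one-dimensional. Hence reading off one coefficient per lattice
point, `coefMap`, is injective, and explicit plane waves show that it is onto. This gives the
dimension for every `a`.

For the count, clearing denominators turns the points of the circle into Gaussian integers of norm
`p²` congruent to `-p` modulo `q`. The number of all Gaussian integers of norm `p²` is `4 ∏ (β_j +
1)`, by unique factorization (`ncard_ofNorm_sq`). Modulo `q = 2` they fall into two residue classes
of equal size, modulo `q = 3, 4, 5` into the four classes `±p, ±ip` of equal size. -/

/-! ### Counting Gaussian integers of a given norm -/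

namespace GaussianInt

/-- The Gaussian integers of norm `n`. -/
def ofNorm (n : ℕ) : Set GaussianInt := {z | z.norm = n}

theorem norm_eq_sq_add_sq (z : GaussianInt) : z.norm = z.re ^ 2 + z.im ^ 2 := by
  rw [Zsqrtd.norm_def]; ring

theorem mem_ofNorm {n : ℕ} {z : GaussianInt} : z ∈ ofNorm n ↔ z.re ^ 2 + z.im ^ 2 = n := by
  rw [← norm_eq_sq_add_sq]; rfl

theorem finite_ofNorm (n : ℕ) : (ofNorm n).Finite := by
  refine ((Set.finite_Icc (-n : ℤ) n).prod (Set.finite_Icc (-n : ℤ) n) |>.image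
    fun x : ℤ × ℤ => (⟨x.1, x.2⟩ : GaussianInt)).subset ?_
  intro z hz
  rw [mem_ofNorm] at hz
  refine ⟨(z.re, z.im), ⟨⟨?_, ?_⟩, ?_, ?_⟩, rfl⟩ <;> dsimp only <;>
    nlinarith [sq_nonneg z.re, sq_nonneg z.im, Int.le_self_sq z.re, Int.le_self_sq (-z.re),
      Int.le_self_sq z.im, Int.le_self_sq (-z.im)]

theorem mul_image_ofNorm {w : GaussianInt} (hw : w ≠ 0) {N : ℕ} (hN : w.norm = N) (n : ℕ) :
    {z ∈ ofNorm (N * n) | w ∣ z} = (w * ·) '' ofNorm n := by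
  ext z
  constructor
  · rintro ⟨hz, y, rfl⟩
    refine ⟨y, ?_, rfl⟩
    have h : (w * y).norm = ((N * n : ℕ) : ℤ) := hz
    rw [Zsqrtd.norm_mul, hN] at h
    push_cast at h
    have h0 : (N : ℤ) ≠ 0 := by
      rw [← hN]
      exact fun h0 => hw (norm_eq_zero.1 h0)
    exact mul_left_cancel₀ h0 h
  · rintro ⟨y, hy, rfl⟩
    refine ⟨?_, dvd_mul_right _ _⟩
    change (w * y).norm = ((N * n : ℕ) : ℤ)
    have hy' : y.norm = n := hy
    rw [Zsqrtd.norm_mul, hN, hy']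
    push_cast
    rfl

theorem ncard_ofNorm_dvd {w : GaussianInt} (hw : w ≠ 0) {N : ℕ} (hN : w.norm = N) (n : ℕ) :
    {z ∈ ofNorm (N * n) | w ∣ z}.ncard = (ofNorm n).ncard := by
  rw [mul_image_ofNorm hw hN, Set.ncard_image_of_injective _ (mul_right_injective₀ hw)]

theorem prime_of_norm_prime {w : GaussianInt} {r : ℕ} (hr : r.Prime) (h : w.norm = r) :
    Prime w := by
  rw [← irreducible_iff_prime]
  have habs : w.norm.natAbs = r := by simp [h]
  refine ⟨fun hu => ?_, fun {x y} hxy => ?_⟩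
  · rw [← Zsqrtd.norm_eq_one_iff, habs] at hu
    exact hr.one_lt.ne' hu
  · rw [hxy, Zsqrtd.norm_mul, Int.natAbs_mul] at habs
    rw [← Zsqrtd.norm_eq_one_iff, ← Zsqrtd.norm_eq_one_iff]
    rw [← habs] at hr
    rcases Nat.prime_mul_iff.1 hr with h | h
    · exact Or.inr h.2
    · exact Or.inl h.2

theorem dvd_star_iff {w z : GaussianInt} : w ∣ star z ↔ star w ∣ z := by
  constructor
  · rintro ⟨y, hy⟩
    exact ⟨star y, by rw [← star_star z, hy, star_mul']⟩
  · rintro ⟨y, rfl⟩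
    exact ⟨star y, by rw [star_mul', star_star]⟩

/-- Since `n = z * star z`, a prime dividing `n` divides one of the factors. -/
theorem dvd_or_star_dvd {w z : GaussianInt} (hw : Prime w) {n : ℕ} (hz : z ∈ ofNorm n)
    (h : w ∣ (n : GaussianInt)) : w ∣ z ∨ star w ∣ z := by
  have hz' : ((z.norm : ℤ) : GaussianInt) = z * star z := Zsqrtd.norm_eq_mul_conj z
  have hn : z.norm = n := hz
  rw [hn] at hz'
  rw [← dvd_star_iff]
  refine hw.dvd_or_dvd ?_
  rw [← hz']
  simpa using h

theorem ncard_ofNorm_eq_of_forall_dvd {w : GaussianInt} (hw : w ≠ 0) {N : ℕ} (hN : w.norm = N)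
    (n : ℕ) (h : ∀ z ∈ ofNorm (N * n), w ∣ z) :
    (ofNorm (N * n)).ncard = (ofNorm n).ncard := by
  rw [← ncard_ofNorm_dvd hw hN n]
  congr 1
  ext z
  exact ⟨fun hz => ⟨hz, h z hz⟩, fun hz => hz.1⟩

/-- The prime `1 + i` is associated to its conjugate, so it divides every element of even norm, and
dividing by it is a bijection. -/
theorem ncard_ofNorm_two_mul (n : ℕ) : (ofNorm (2 * n)).ncard = (ofNorm n).ncard := by
  have hN : (⟨1, 1⟩ : GaussianInt).norm = (2 : ℕ) := by simp [Zsqrtd.norm_def]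
  have hw := prime_of_norm_prime Nat.prime_two hN
  refine ncard_ofNorm_eq_of_forall_dvd hw.ne_zero hN n fun z hz => ?_
  have h2 : (⟨1, 1⟩ : GaussianInt) ∣ ((2 * n : ℕ) : GaussianInt) := by
    push_cast
    exact Dvd.dvd.mul_right ⟨⟨1, -1⟩, by ext <;> simp⟩ _
  rcases dvd_or_star_dvd hw hz h2 with h | h
  · exact h
  · refine dvd_trans ⟨⟨0, -1⟩, ?_⟩ h
    ext <;> simp

/-- Such an `r` stays prime in the Gaussian integers and equals its own conjugate, so it divides
every element whose norm it divides; its norm is `r * r`. -/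
theorem ncard_ofNorm_sq_mul_of_mod_four_eq_three {r : ℕ} (hr : r.Prime) (h3 : r % 4 = 3) (n : ℕ) :
    (ofNorm (r * r * n)).ncard = (ofNorm n).ncard := by
  have := Fact.mk hr
  have hw := prime_of_nat_prime_of_mod_four_eq_three r h3
  refine ncard_ofNorm_eq_of_forall_dvd hw.ne_zero (by simp) n fun z hz => ?_
  have h2 : (r : GaussianInt) ∣ ((r * r * n : ℕ) : GaussianInt) := by
    push_cast
    exact Dvd.dvd.mul_right (dvd_mul_right _ _) _
  rcases dvd_or_star_dvd hw hz h2 with h | h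
  · exact h
  · simpa using h

/-- The prime elements above a prime number that is `1` modulo `4`. -/
theorem exists_split {r : ℕ} (hr : r.Prime) (h1 : r % 4 = 1) :
    ∃ w : GaussianInt, w.norm = r ∧ ¬ star w ∣ w := by
  have := Fact.mk hr
  obtain ⟨x, y, hxy⟩ := Nat.Prime.sq_add_sq (p := r) (by omega)
  have hN : (⟨x, y⟩ : GaussianInt).norm = r := by
    rw [norm_eq_sq_add_sq, ← hxy]; push_cast; rfl
  refine ⟨⟨x, y⟩, hN, fun h => ?_⟩
  -- If the conjugate divided `w`, it would divide the trace `2x`. Comparing norms gives `r ∣ x`,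
  -- then `r ∣ y`, and `x² + y² = r` would be divisible by `r²`.
  have h2 : star (⟨x, y⟩ : GaussianInt) ∣ ((2 * x : ℕ) : GaussianInt) := by
    have : ((2 * x : ℕ) : GaussianInt) = ⟨x, y⟩ + star ⟨x, y⟩ := by
      ext <;> simp; ring
    rw [this]
    exact dvd_add h dvd_rfl
  obtain ⟨c, hc⟩ := h2
  have h3 := congrArg Zsqrtd.norm hc
  rw [Zsqrtd.norm_mul, Zsqrtd.norm_conj, hN, Zsqrtd.norm_natCast] at h3
  have h4 : r ∣ 2 * x := by
    have : (r : ℤ) ∣ ((2 * x * (2 * x) : ℕ) : ℤ) := ⟨c.norm, by rw [← h3]; push_cast; ring⟩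
    rcases hr.dvd_mul.1 (Int.natCast_dvd_natCast.1 this) with h | h <;> exact h
  have h5 : r ∣ x := by
    rcases hr.dvd_mul.1 h4 with h | h
    · have := Nat.le_of_dvd (by norm_num) h
      have := hr.two_le
      omega
    · exact h
  have hy0 : r ∣ y := by
    have : r ∣ y ^ 2 := by
      rw [← Nat.dvd_add_right (dvd_pow h5 two_ne_zero), hxy]
    exact hr.dvd_of_dvd_pow this
  obtain ⟨s, rfl⟩ := h5
  obtain ⟨t, rfl⟩ := hy0
  have h6 : r * (s ^ 2 + t ^ 2) = 1 := by
    refine Nat.eq_of_mul_eq_mul_left hr.pos ?_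
    rw [mul_one]
    calc r * (r * (s ^ 2 + t ^ 2)) = (r * s) ^ 2 + (r * t) ^ 2 := by ring
      _ = r := hxy
  exact hr.one_lt.ne' (Nat.eq_one_of_mul_eq_one_right h6)

/-- Inclusion–exclusion: every element of norm `r * n` is divisible by one of the two conjugate
primes above `r`, each divisibility class has as many elements as there are of norm `n`, and being
divisible by both means being divisible by `r`, because the two primes are not associated. -/
theorem ncard_ofNorm_split {r : ℕ} (hr : r.Prime) (h1 : r % 4 = 1) (n : ℕ) :
    (ofNorm (r * n)).ncard + {z ∈ ofNorm (r * n) | (r : GaussianInt) ∣ z}.ncard =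
      2 * (ofNorm n).ncard := by
  obtain ⟨w, hN, hs⟩ := exists_split hr h1
  have hN' : (star w).norm = r := by rw [Zsqrtd.norm_conj, hN]
  have hw := prime_of_norm_prime hr hN
  have hw' := prime_of_norm_prime hr hN'
  have hr' : (r : GaussianInt) = w * star w := by
    rw [← Zsqrtd.norm_eq_mul_conj, hN]; simp
  have hunion : ofNorm (r * n) =
      {z ∈ ofNorm (r * n) | w ∣ z} ∪ {z ∈ ofNorm (r * n) | star w ∣ z} := by
    ext z
    constructor
    · intro hz
      have : w ∣ ((r * n : ℕ) : GaussianInt) := by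
        push_cast
        rw [hr', mul_assoc]
        exact dvd_mul_right _ _
      exact (dvd_or_star_dvd hw hz this).imp (fun h => ⟨hz, h⟩) fun h => ⟨hz, h⟩
    · rintro (hz | hz) <;> exact hz.1
  have hinter : {z ∈ ofNorm (r * n) | (r : GaussianInt) ∣ z} =
      {z ∈ ofNorm (r * n) | w ∣ z} ∩ {z ∈ ofNorm (r * n) | star w ∣ z} := by
    ext z
    constructor
    · rintro ⟨hz, h⟩
      rw [hr'] at h
      exact ⟨⟨hz, dvd_trans (dvd_mul_right _ _) h⟩, hz, dvd_trans (dvd_mul_left _ _) h⟩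
    · rintro ⟨⟨hz, y, rfl⟩, -, h⟩
      refine ⟨hz, ?_⟩
      rw [hr']
      exact mul_dvd_mul_left w ((hw'.dvd_or_dvd h).resolve_left hs)
  have hfin := finite_ofNorm (r * n)
  have h := Set.ncard_union_add_ncard_inter {z ∈ ofNorm (r * n) | w ∣ z}
    {z ∈ ofNorm (r * n) | star w ∣ z} (hfin.subset fun z hz => hz.1)
    (hfin.subset fun z hz => hz.1)
  rwa [← hunion, ← hinter, ncard_ofNorm_dvd hw.ne_zero hN, ncard_ofNorm_dvd hw'.ne_zero hN',
    ← two_mul] at h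

/-- The elements divisible by `r` correspond to those of norm smaller by a factor `r²`, so the split
formula is the recurrence `c (k + 2) = 2 c (k + 1) - c k`. The count is therefore linear in `k`,
with `c 1 = 2 c 0` since no element of norm `r * n` is divisible by `r` when `r ∤ n`. -/
theorem ncard_ofNorm_pow_mul {r : ℕ} (hr : r.Prime) (h1 : r % 4 = 1) {n : ℕ} (hn : ¬ r ∣ n)
    (k : ℕ) : (ofNorm (r ^ k * n)).ncard = (k + 1) * (ofNorm n).ncard := by
  have hr0 : (r : GaussianInt) ≠ 0 := by exact_mod_cast hr.ne_zero
  induction k using Nat.twoStepInduction with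
  | zero => simp
  | one =>
    have h := ncard_ofNorm_split hr h1 n
    have hempty : {z ∈ ofNorm (r * n) | (r : GaussianInt) ∣ z} = ∅ := by
      rw [Set.eq_empty_iff_forall_notMem]
      rintro z ⟨hz, y, rfl⟩
      have h2 : ((r : GaussianInt) * y).norm = ((r * n : ℕ) : ℤ) := hz
      rw [Zsqrtd.norm_mul, Zsqrtd.norm_natCast] at h2
      push_cast at h2
      rw [mul_assoc] at h2
      have h3 := mul_left_cancel₀ (by exact_mod_cast hr.ne_zero : (r : ℤ) ≠ 0) h2
      exact hn (Int.natCast_dvd_natCast.1 ⟨_, h3.symm⟩)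
    rw [hempty, Set.ncard_empty] at h
    rw [pow_one]
    omega
  | more k ih0 ih1 =>
    have h := ncard_ofNorm_split hr h1 (r ^ (k + 1) * n)
    have e1 : r * (r ^ (k + 1) * n) = r ^ (k + 2) * n := by ring
    have e2 : r * (r ^ (k + 1) * n) = r * r * (r ^ k * n) := by ring
    conv at h => lhs; rhs; rw [e2]
    rw [ncard_ofNorm_dvd hr0 (by simp), e1, ih0, ih1] at h
    nlinarith

theorem ofNorm_one : ofNorm 1 = {⟨1, 0⟩, ⟨-1, 0⟩, ⟨0, 1⟩, ⟨0, -1⟩} := by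
  ext z
  rw [mem_ofNorm]
  constructor
  · intro h
    push_cast at h
    have hx1 : z.re ≤ 1 := by nlinarith [sq_nonneg z.im]
    have hx2 : -1 ≤ z.re := by nlinarith [sq_nonneg z.im]
    have hy1 : z.im ≤ 1 := by nlinarith [sq_nonneg z.re]
    have hy2 : -1 ≤ z.im := by nlinarith [sq_nonneg z.re]
    obtain ⟨x, y⟩ := z
    dsimp only at *
    interval_cases x <;> interval_cases y <;> simp_all
  · rintro (rfl | rfl | rfl | rfl) <;> simp

theorem ncard_ofNorm_one : (ofNorm 1).ncard = 4 := by
  rw [ofNorm_one]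
  have : ({⟨1, 0⟩, ⟨-1, 0⟩, ⟨0, 1⟩, ⟨0, -1⟩} : Set GaussianInt) =
      (({⟨1, 0⟩, ⟨-1, 0⟩, ⟨0, 1⟩, ⟨0, -1⟩} : Finset GaussianInt) : Set GaussianInt) := by
    push_cast; rfl
  rw [this, Set.ncard_coe_finset]
  rfl

end GaussianInt

/-! ### Lattice points of the circle and residue classes modulo `q` -/

namespace KT

theorem oneModFourProd_eq (n : ℕ) :
    oneModFourProd n = n.factorization.prod fun r k => if r % 4 = 1 then k + 1 else 1 := by
  rw [oneModFourProd, Finset.prod_filter, Finsupp.prod, Nat.support_factorization]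

theorem oneModFourProd_mul {m n : ℕ} (h : m.Coprime n) :
    oneModFourProd (m * n) = oneModFourProd m * oneModFourProd n := by
  rw [oneModFourProd_eq, oneModFourProd_eq, oneModFourProd_eq, Nat.factorization_mul_of_coprime h]
  exact Finsupp.prod_add_index_of_disjoint
    (by simpa using h.disjoint_primeFactors) _

theorem oneModFourProd_prime_pow {r : ℕ} (hr : r.Prime) (k : ℕ) :
    oneModFourProd (r ^ k) = if r % 4 = 1 then k + 1 else 1 := by
  rw [oneModFourProd_eq, hr.factorization_pow, Finsupp.prod_single_index]
  simp

/-- The smallest prime factor is split off with its full power. It occurs in `n²` with an even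
exponent, which is what the primes `3` modulo `4` need; the factor `4` counts the units. -/
theorem ncard_ofNorm_sq {n : ℕ} (hn : n ≠ 0) :
    (GaussianInt.ofNorm (n ^ 2)).ncard = 4 * oneModFourProd (n ^ 2) := by
  induction n using Nat.strong_induction_on with
  | _ n ih =>
    rcases eq_or_ne n 1 with rfl | h1
    · simp [GaussianInt.ncard_ofNorm_one, oneModFourProd]
    have hr := Nat.minFac_prime h1
    set r := n.minFac with hr_def
    obtain ⟨e, m, hm, hnm⟩ := Nat.exists_eq_pow_mul_and_not_dvd hn r hr.ne_one
    have hm0 : m ≠ 0 := by rintro rfl; simp at hm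
    have he : e ≠ 0 := by
      rintro rfl
      rw [pow_zero, one_mul] at hnm
      exact hm (hnm ▸ Nat.minFac_dvd n)
    have hlt : m < n := by
      rw [hnm]
      exact lt_mul_left (Nat.pos_of_ne_zero hm0) (Nat.one_lt_pow he hr.one_lt)
    have hcop : Nat.Coprime (r ^ (2 * e)) (m ^ 2) :=
      Nat.Coprime.pow _ _ ((Nat.Prime.coprime_iff_not_dvd hr).2 hm)
    have hsq : n ^ 2 = r ^ (2 * e) * m ^ 2 := by rw [hnm]; ring
    have hm2 : ¬ r ∣ m ^ 2 := fun h => hm (hr.dvd_of_dvd_pow h)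
    rw [hsq, oneModFourProd_mul hcop, oneModFourProd_prime_pow hr, mul_left_comm, ← ih m hlt hm0]
    have hcases : r = 2 ∨ r % 4 = 1 ∨ r % 4 = 3 := by
      rcases hr.eq_two_or_odd with h | h
      · exact Or.inl h
      · right; omega
    rcases hcases with h | h | h
    · rw [h]
      have : ∀ k j, (GaussianInt.ofNorm (2 ^ k * j)).ncard = (GaussianInt.ofNorm j).ncard := by
        intro k j
        induction k with
        | zero => simp
        | succ k ihk => rw [pow_succ', mul_assoc, GaussianInt.ncard_ofNorm_two_mul, ihk]
      rw [this]
      simp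
    · rw [GaussianInt.ncard_ofNorm_pow_mul hr h hm2, if_pos h]
    · have : ∀ k j, (GaussianInt.ofNorm (r ^ (2 * k) * j)).ncard =
          (GaussianInt.ofNorm j).ncard := by
        intro k j
        induction k with
        | zero => simp
        | succ k ihk =>
          have e1 : r ^ (2 * (k + 1)) * j = r * r * (r ^ (2 * k) * j) := by ring
          rw [e1, GaussianInt.ncard_ofNorm_sq_mul_of_mod_four_eq_three hr h, ihk]
      rw [this, if_neg (by omega), one_mul]

/-- The Gaussian integers of norm `p²` that are congruent to `-p` modulo `q`. -/
def congruentPoints (p : ℤ) (q : ℕ) : Set GaussianInt :=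
  {z ∈ GaussianInt.ofNorm (p.natAbs ^ 2) | (q : ℤ) ∣ z.im ∧ (q : ℤ) ∣ z.re + p}

theorem mem_ofNorm_natAbs_sq {p : ℤ} {z : GaussianInt} :
    z ∈ GaussianInt.ofNorm (p.natAbs ^ 2) ↔ z.re ^ 2 + z.im ^ 2 = p ^ 2 := by
  rw [GaussianInt.mem_ofNorm]; push_cast; rw [sq_abs]

/-- Multiplying the equation of the circle by `q²` makes it `(q l - p)² + (q m)² = p²`. -/
theorem image_circlePoints (p : ℤ) {q : ℕ} (hq : 0 < q) :
    (fun x : ℤ × ℤ => (⟨q * x.2 - p, q * x.1⟩ : GaussianInt)) '' circlePoints ((p : ℝ) / q) =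
      congruentPoints p q := by
  have hq' : (q : ℝ) ≠ 0 := by exact_mod_cast hq.ne'
  have key : ∀ m l : ℤ, (m, l) ∈ circlePoints ((p : ℝ) / q) ↔
      (q * l - p) ^ 2 + (q * m) ^ 2 = p ^ 2 := by
    intro m l
    have h : (((q * l - p) ^ 2 + (q * m) ^ 2 : ℤ) : ℝ) - ((p ^ 2 : ℤ) : ℝ) =
        q ^ 2 * ((((l : ℝ) - p / q) ^ 2 + (m : ℝ) ^ 2) - ((p : ℝ) / q) ^ 2) := by
      push_cast; field_simp
    rw [← sub_eq_zero]
    constructor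
    · intro h'
      have h'' : ((l : ℝ) - p / q) ^ 2 + (m : ℝ) ^ 2 = ((p : ℝ) / q) ^ 2 := h'
      rw [h'', sub_self, mul_zero] at h
      exact_mod_cast h
    · intro h'
      have h'' : (((q * l - p) ^ 2 + (q * m) ^ 2 : ℤ) : ℝ) - ((p ^ 2 : ℤ) : ℝ) = 0 := by
        exact_mod_cast h'
      rw [h''] at h
      exact sub_eq_zero.1 ((mul_eq_zero.1 h.symm).resolve_left (pow_ne_zero 2 hq'))
  ext z
  constructor
  · rintro ⟨⟨m, l⟩, h, rfl⟩
    refine ⟨mem_ofNorm_natAbs_sq.2 ((key m l).1 h), dvd_mul_right _ _, ?_⟩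
    simp
  · rintro ⟨h, ⟨m, hm⟩, ⟨l, hl⟩⟩
    rw [mem_ofNorm_natAbs_sq] at h
    refine ⟨(m, l), (key m l).2 ?_, ?_⟩
    · rw [← hm, ← hl, ← h]; ring
    · ext
      · change q * l - p = _; rw [← hl]; ring
      · exact hm.symm

theorem ncard_circlePoints (p : ℤ) {q : ℕ} (hq : 0 < q) :
    (circlePoints ((p : ℝ) / q)).ncard = (congruentPoints p q).ncard := by
  rw [← image_circlePoints p hq, Set.ncard_image_of_injective]
  rintro ⟨m, l⟩ ⟨m', l'⟩ h
  have h1 := congrArg Zsqrtd.re h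
  have h2 := congrArg Zsqrtd.im h
  have hq' : (q : ℤ) ≠ 0 := by exact_mod_cast hq.ne'
  ext
  · exact mul_left_cancel₀ hq' h2
  · exact mul_left_cancel₀ hq' (sub_left_injective h1)

theorem finite_circlePoints (p : ℤ) {q : ℕ} (hq : 0 < q) :
    (circlePoints ((p : ℝ) / q)).Finite := by
  refine Set.Finite.of_finite_image (f := fun x : ℤ × ℤ =>
    (⟨q * x.2 - p, q * x.1⟩ : GaussianInt)) ?_ ?_
  · rw [image_circlePoints p hq]
    exact (GaussianInt.finite_ofNorm _).subset fun z hz => hz.1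
  · rintro ⟨m, l⟩ - ⟨m', l'⟩ - h
    have h1 := congrArg Zsqrtd.re h
    have h2 := congrArg Zsqrtd.im h
    have hq' : (q : ℤ) ≠ 0 := by exact_mod_cast hq.ne'
    ext
    · exact mul_left_cancel₀ hq' h2
    · exact mul_left_cancel₀ hq' (sub_left_injective h1)

theorem congruentPoints_one (p : ℤ) :
    congruentPoints p 1 = GaussianInt.ofNorm (p.natAbs ^ 2) := by
  ext z
  simp [congruentPoints]

/-- Points of norm `p²` congruent to `-p`, `-i p`, `p` or `i p`. -/
theorem ncard_rotated (p : ℤ) (q : ℕ) :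
    {z ∈ GaussianInt.ofNorm (p.natAbs ^ 2) | (q : ℤ) ∣ z.re ∧ (q : ℤ) ∣ z.im + p}.ncard =
      (congruentPoints p q).ncard ∧
    {z ∈ GaussianInt.ofNorm (p.natAbs ^ 2) | (q : ℤ) ∣ z.im ∧ (q : ℤ) ∣ z.re - p}.ncard =
      (congruentPoints p q).ncard ∧
    {z ∈ GaussianInt.ofNorm (p.natAbs ^ 2) | (q : ℤ) ∣ z.re ∧ (q : ℤ) ∣ z.im - p}.ncard =
      (congruentPoints p q).ncard := by
  have key : ∀ (S : Set GaussianInt) (σ : GaussianInt → GaussianInt),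
      Function.Involutive σ → (∀ z, z ∈ S ↔ σ z ∈ congruentPoints p q) →
      S.ncard = (congruentPoints p q).ncard := by
    intro S σ hσ h
    have hS : S = σ '' congruentPoints p q := by
      ext z
      rw [h]
      exact ⟨fun hz => ⟨_, hz, hσ z⟩, by rintro ⟨y, hy, rfl⟩; rwa [hσ y]⟩
    rw [hS, Set.ncard_image_of_injective _ hσ.injective]
  -- The three bijections are the reflection in the diagonal, the half turn and the reflection in
  -- the antidiagonal, all involutions that preserve the norm.
  refine ⟨key _ (fun z => ⟨z.im, z.re⟩) (fun z => rfl) fun z => ?_,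
    key _ (fun z => -z) neg_neg fun z => ?_,
    key _ (fun z => ⟨-z.im, -z.re⟩) (fun z => by ext <;> simp) fun z => ?_⟩
  · simp only [congruentPoints, Set.mem_ofPred_eq, mem_ofNorm_natAbs_sq]
    rw [add_comm (z.im ^ 2)]
  · simp only [congruentPoints, Set.mem_ofPred_eq, mem_ofNorm_natAbs_sq, Zsqrtd.re_neg,
      Zsqrtd.im_neg, neg_sq, dvd_neg]
    rw [← dvd_neg (b := z.re - p), neg_sub, neg_add_eq_sub]
  · simp only [congruentPoints, Set.mem_ofPred_eq, mem_ofNorm_natAbs_sq, neg_sq, dvd_neg]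
    rw [← dvd_neg (b := z.im - p), neg_sub, neg_add_eq_sub, add_comm (z.im ^ 2)]

/-- For odd `p` exactly one of the two coordinates is odd. Only two classes arise because `p` and
`-p` agree modulo `2`. -/
theorem ncard_congruentPoints_two {p : ℤ} (hp : ¬ (2 : ℤ) ∣ p) :
    (GaussianInt.ofNorm (p.natAbs ^ 2)).ncard = 2 * (congruentPoints p 2).ncard := by
  have hfin := GaussianInt.finite_ofNorm (p.natAbs ^ 2)
  obtain ⟨h1, -, -⟩ := ncard_rotated p 2
  have hU : GaussianInt.ofNorm (p.natAbs ^ 2) = congruentPoints p 2 ∪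
      {z ∈ GaussianInt.ofNorm (p.natAbs ^ 2) | ((2 : ℕ) : ℤ) ∣ z.re ∧ ((2 : ℕ) : ℤ) ∣ z.im + p} := by
    ext z
    simp only [congruentPoints, Set.mem_union, Set.mem_ofPred_eq, ← and_or_left]
    refine ⟨fun hz => ⟨hz, ?_⟩, fun hz => hz.1⟩
    rw [mem_ofNorm_natAbs_sq] at hz
    have key : ∀ x y p : ZMod 2, p ≠ 0 → x ^ 2 + y ^ 2 = p ^ 2 → (y = 0 ∧ x + p = 0) ∨
        (x = 0 ∧ y + p = 0) := by decide
    have h := key z.re z.im p (fun h => hp ((ZMod.intCast_zmod_eq_zero_iff_dvd p 2).1 h))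
      (by exact_mod_cast congrArg (Int.cast : ℤ → ZMod 2) hz)
    simp only [← ZMod.intCast_zmod_eq_zero_iff_dvd]
    push_cast
    exact h
  rw [hU, Set.ncard_union_eq _ (hfin.subset fun z hz => hz.1) (hfin.subset fun z hz => hz.1), h1,
    two_mul]
  rw [Set.disjoint_left]
  rintro z ⟨-, h2, h3⟩ ⟨-, h4, h5⟩
  push_cast at *
  omega

/-- The classes of `-p, -ip, p, ip` have equal size by symmetry and cover all points by `h`; the
conditions `q ∤ p` and `q ∤ 2p` make them disjoint. -/
theorem ncard_congruentPoints_of_exactly_one {p : ℤ} {q : ℕ} (hp : ¬ (q : ℤ) ∣ p)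
    (hp2 : ¬ (q : ℤ) ∣ 2 * p)
    (h : ∀ x y : ℤ, x ^ 2 + y ^ 2 = p ^ 2 → ((q : ℤ) ∣ y ∧ (q : ℤ) ∣ x + p) ∨
      ((q : ℤ) ∣ x ∧ (q : ℤ) ∣ y + p) ∨ ((q : ℤ) ∣ y ∧ (q : ℤ) ∣ x - p) ∨
      ((q : ℤ) ∣ x ∧ (q : ℤ) ∣ y - p)) :
    (GaussianInt.ofNorm (p.natAbs ^ 2)).ncard = 4 * (congruentPoints p q).ncard := by
  have hfin := GaussianInt.finite_ofNorm (p.natAbs ^ 2)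
  obtain ⟨h1, h2, h3⟩ := ncard_rotated p q
  have hU : GaussianInt.ofNorm (p.natAbs ^ 2) = congruentPoints p q ∪
      ({z ∈ GaussianInt.ofNorm (p.natAbs ^ 2) | (q : ℤ) ∣ z.re ∧ (q : ℤ) ∣ z.im + p} ∪
      ({z ∈ GaussianInt.ofNorm (p.natAbs ^ 2) | (q : ℤ) ∣ z.im ∧ (q : ℤ) ∣ z.re - p} ∪
      {z ∈ GaussianInt.ofNorm (p.natAbs ^ 2) | (q : ℤ) ∣ z.re ∧ (q : ℤ) ∣ z.im - p})) := by
    ext z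
    simp only [congruentPoints, Set.mem_union, Set.mem_ofPred_eq, ← and_or_left]
    exact ⟨fun hz => ⟨hz, h _ _ (mem_ofNorm_natAbs_sq.1 hz)⟩, fun hz => hz.1⟩
  have d1 : ∀ {x : ℤ}, (q : ℤ) ∣ x → (q : ℤ) ∣ x + p → False := fun h h' =>
    hp ((dvd_add_right h).1 h')
  have d2 : ∀ {x : ℤ}, (q : ℤ) ∣ x → (q : ℤ) ∣ x - p → False := fun h h' =>
    hp ((dvd_sub_right h).1 h')
  have d3 : ∀ {x : ℤ}, (q : ℤ) ∣ x + p → (q : ℤ) ∣ x - p → False := fun h h' =>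
    hp2 (by have := dvd_sub h h'; ring_nf at this; rwa [mul_comm] at this)
  have := hfin.to_subtype
  have : Finite (congruentPoints p q) := (hfin.subset fun z hz => hz.1).to_subtype
  rw [hU, Set.ncard_union_eq, Set.ncard_union_eq, Set.ncard_union_eq, h1, h2, h3]
  · ring
  · rw [Set.disjoint_left]
    rintro z ⟨-, h4, h5⟩ ⟨-, h6, h7⟩
    exact d2 h4 h7
  · rw [Set.disjoint_left]
    rintro z ⟨-, h4, h5⟩ (⟨-, h6, h7⟩ | ⟨-, h6, h7⟩)
    · exact d1 h6 h5
    · exact d3 h5 h7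
  · rw [Set.disjoint_left]
    rintro z ⟨-, h4, h5⟩ (⟨-, h6, h7⟩ | ⟨-, h6, h7⟩ | ⟨-, h6, h7⟩)
    · exact d1 h4 h7
    · exact d3 h5 h7
    · exact d2 h4 h7

theorem ncard_congruentPoints_three {p : ℤ} (hp : ¬ (3 : ℤ) ∣ p) :
    (GaussianInt.ofNorm (p.natAbs ^ 2)).ncard = 4 * (congruentPoints p 3).ncard := by
  refine ncard_congruentPoints_of_exactly_one hp (by push_cast; omega) fun x y hxy => ?_
  have key : ∀ x y p : ZMod 3, p ≠ 0 → x ^ 2 + y ^ 2 = p ^ 2 → (y = 0 ∧ x + p = 0) ∨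
      (x = 0 ∧ y + p = 0) ∨ (y = 0 ∧ x - p = 0) ∨ (x = 0 ∧ y - p = 0) := by decide
  have h := key x y p (fun h => hp ((ZMod.intCast_zmod_eq_zero_iff_dvd p 3).1 h))
    (by exact_mod_cast congrArg (Int.cast : ℤ → ZMod 3) hxy)
  simp only [← ZMod.intCast_zmod_eq_zero_iff_dvd]
  push_cast
  exact h

/-- The squares modulo `5` are `0, 1, -1`, and a sum of two of them is a nonzero square only if one
of the two vanishes. The same happens modulo `3`. -/
theorem ncard_congruentPoints_five {p : ℤ} (hp : ¬ (5 : ℤ) ∣ p) :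
    (GaussianInt.ofNorm (p.natAbs ^ 2)).ncard = 4 * (congruentPoints p 5).ncard := by
  refine ncard_congruentPoints_of_exactly_one hp (by push_cast; omega) fun x y hxy => ?_
  have key : ∀ x y p : ZMod 5, p ≠ 0 → x ^ 2 + y ^ 2 = p ^ 2 → (y = 0 ∧ x + p = 0) ∨
      (x = 0 ∧ y + p = 0) ∨ (y = 0 ∧ x - p = 0) ∨ (x = 0 ∧ y - p = 0) := by decide
  have h := key x y p (fun h => hp ((ZMod.intCast_zmod_eq_zero_iff_dvd p 5).1 h))
    (by exact_mod_cast congrArg (Int.cast : ℤ → ZMod 5) hxy)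
  simp only [← ZMod.intCast_zmod_eq_zero_iff_dvd]
  push_cast
  exact h

/-- Modulo `4` the equation allows an even coordinate congruent to `2`, so it has to be read modulo
`8`: there `p² = 1`, the odd coordinate has square `1`, and the even one has square `0`, hence is
divisible by `4`. In `ZMod 8`, divisibility of `x` by `4` is expressed as `2 * x = 0`, and oddness
of `p` as `4 * p ≠ 0`. -/
theorem ncard_congruentPoints_four {p : ℤ} (hp : ¬ (2 : ℤ) ∣ p) :
    (GaussianInt.ofNorm (p.natAbs ^ 2)).ncard = 4 * (congruentPoints p 4).ncard := by
  refine ncard_congruentPoints_of_exactly_one (by push_cast; omega) (by push_cast; omega)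
    fun x y hxy => ?_
  have key : ∀ x y p : ZMod 8, 4 * p ≠ 0 → x ^ 2 + y ^ 2 = p ^ 2 → (2 * y = 0 ∧ 2 * (x + p) = 0) ∨
      (2 * x = 0 ∧ 2 * (y + p) = 0) ∨ (2 * y = 0 ∧ 2 * (x - p) = 0) ∨
      (2 * x = 0 ∧ 2 * (y - p) = 0) := by decide
  have conv : ∀ x : ℤ, ((4 : ℕ) : ℤ) ∣ x ↔ ((2 * x : ℤ) : ZMod 8) = 0 := by
    intro x
    rw [ZMod.intCast_zmod_eq_zero_iff_dvd]
    push_cast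
    omega
  have h := key x y p (fun h => by
    have h' : ((4 * p : ℤ) : ZMod 8) = 0 := by exact_mod_cast h
    rw [ZMod.intCast_zmod_eq_zero_iff_dvd] at h'
    push_cast at h'
    omega)
    (by exact_mod_cast congrArg (Int.cast : ℤ → ZMod 8) hxy)
  simp only [conv]
  push_cast
  exact h

end KT

/-! ### `π` is not a root of an integral quadratic polynomial -/

namespace LindemannWeierstrass

open Polynomial Filter

theorem exists_prime_mul_pow_div_factorial_lt_one (N : ℕ) (C c : ℝ) :
    ∃ p : ℕ, N < p ∧ p.Prime ∧ C * (c ^ p / (p - 1).factorial) < 1 := by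
  have h1 : Tendsto (fun n : ℕ => C * (c * (c ^ n / n.factorial))) atTop (nhds 0) := by
    have := ((FloorSemiring.tendsto_pow_div_factorial_atTop c).const_mul c).const_mul C
    simpa using this
  obtain ⟨M, hM⟩ := (h1.eventually (gt_mem_nhds one_pos)).exists_forall_of_atTop
  obtain ⟨p, hp, hpp⟩ := Nat.exists_infinite_primes (N + M + 1)
  refine ⟨p, by omega, hpp, ?_⟩
  obtain ⟨k, rfl⟩ : ∃ k, p = k + 1 := ⟨p - 1, by omega⟩
  have := hM k (by omega)
  rw [Nat.add_sub_cancel, pow_succ']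
  rwa [mul_div_assoc]

/-- The exponentials of a family of algebraic numbers whose weighted power sums, after scaling by an
integer `A`, are integers have no nonzero integral weighted sum. -/
theorem intCast_add_sum_exp_ne_zero {ι : Type*} [Fintype ι] (θ : ι → ℂ) (m : ι → ℤ) {K A : ℤ}
    (hK : K ≠ 0) (hA : A ≠ 0) (f : ℤ[X]) (hf : f.eval 0 ≠ 0) (hθ : ∀ i, aeval (θ i) f = 0)
    (hsum : ∀ j : ℕ, ∃ s : ℤ, ∑ i, (m i : ℂ) * (A * θ i) ^ j = s) :
    (K : ℂ) + ∑ i, (m i : ℂ) * Complex.exp (θ i) ≠ 0 := by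
  intro hzero
  obtain ⟨c, hc⟩ := exp_polynomial_approx f hf
  have hf0 : f ≠ 0 := by rintro rfl; simp at hf
  have hroot : ∀ i, θ i ∈ f.aroots ℂ := fun i => by
    rw [mem_aroots]; exact ⟨hf0, hθ i⟩
  set N := f.natDegree
  -- The prime exceeds `|f(0)|`, as the approximation theorem requires, and also `|K|` and `|A|`, so
  -- that it divides neither. The base of the power absorbs the denominators `A ^ (p * N)`.
  obtain ⟨p, hpN, hpp, hlt⟩ := exists_prime_mul_pow_div_factorial_lt_one
    ((eval 0 f).natAbs + K.natAbs + A.natAbs) (∑ i, ‖(m i : ℂ)‖) (|c| * |(A : ℝ)| ^ N)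
  obtain ⟨n, hn, g, hg, hbound⟩ := hc p (by omega) hpp
  -- The degree of `g` is below `p * N`, so the power of `A` clears the denominators of all the
  -- power sums that occur.
  have hT : ∃ T : ℤ, (A : ℂ) ^ (p * N) * ∑ i, (m i : ℂ) * aeval (θ i) g = T := by
    choose s hs using hsum
    refine ⟨∑ j ∈ Finset.range (p * N + 1), g.coeff j * A ^ (p * N - j) * s j, ?_⟩
    have hg' : g.natDegree < p * N + 1 := by omega
    have h2 : ∀ i, aeval (θ i) g = ∑ j ∈ Finset.range (p * N + 1), (g.coeff j : ℂ) * θ i ^ j := by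
      intro i
      rw [aeval_def, eval₂_eq_sum_range' _ hg']
      simp
    simp_rw [h2, Finset.mul_sum]
    rw [Finset.sum_comm]
    push_cast
    refine Finset.sum_congr rfl fun j hj => ?_
    rw [← hs, Finset.mul_sum]
    refine Finset.sum_congr rfl fun i _ => ?_
    have hj' : p * N = (p * N - j) + j := by
      have := Finset.mem_range.1 hj
      omega
    conv_lhs => rw [hj', pow_add]
    rw [mul_pow]
    ring
  obtain ⟨T, hT⟩ := hT
  have hnorm : ‖((n * K * A ^ (p * N) + p * T : ℤ) : ℂ)‖ < 1 := by
    -- Multiplying the assumed relation by `n * A ^ (p * N)` and replacing each `n e^θ` by `p g(θ)`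
    -- leaves an integer on one side and only the small approximation errors on the other.
    have h3 : ((n * K * A ^ (p * N) + p * T : ℤ) : ℂ) =
        -((A : ℂ) ^ (p * N) * ∑ i, (m i : ℂ) * (n • Complex.exp (θ i) - p • aeval (θ i) g)) := by
      push_cast
      rw [← hT]
      have h4 : ∑ i, (m i : ℂ) * (n • Complex.exp (θ i) - p • aeval (θ i) g) =
          n * ∑ i, (m i : ℂ) * Complex.exp (θ i) - p * ∑ i, (m i : ℂ) * aeval (θ i) g := by
        rw [Finset.mul_sum, Finset.mul_sum, ← Finset.sum_sub_distrib]
        refine Finset.sum_congr rfl fun i _ => ?_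
        rw [zsmul_eq_mul, nsmul_eq_mul]
        ring
      rw [h4]
      linear_combination (n : ℂ) * A ^ (p * N) * hzero
    rw [h3, norm_neg, norm_mul, norm_pow]
    refine lt_of_le_of_lt ?_ hlt
    have h5 : ‖∑ i, (m i : ℂ) * (n • Complex.exp (θ i) - p • aeval (θ i) g)‖ ≤
        (∑ i, ‖(m i : ℂ)‖) * (|c| ^ p / (p - 1).factorial) := by
      rw [Finset.sum_mul]
      refine (norm_sum_le _ _).trans (Finset.sum_le_sum fun i _ => ?_)
      rw [norm_mul]
      refine mul_le_mul_of_nonneg_left ((hbound (hroot i)).trans ?_) (norm_nonneg _)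
      refine div_le_div_of_nonneg_right ?_ (Nat.cast_nonneg _)
      rw [← abs_pow]
      exact le_abs_self _
    calc ‖(A : ℂ)‖ ^ (p * N) * _ ≤
          ‖(A : ℂ)‖ ^ (p * N) * ((∑ i, ‖(m i : ℂ)‖) * (|c| ^ p / (p - 1).factorial)) := by gcongr
      _ = (∑ i, ‖(m i : ℂ)‖) * ((|c| * |(A : ℝ)| ^ N) ^ p / (p - 1).factorial) := by
        rw [Complex.norm_intCast, mul_pow, ← pow_mul, mul_comm N p]
        ring
  rw [Complex.norm_intCast] at hnorm
  have h0 : n * K * A ^ (p * N) + p * T = 0 := by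
    rw [← Int.abs_lt_one_iff]
    exact_mod_cast hnorm
  -- The integer of absolute value below `1` is zero, so `p` divides `n * K * A ^ (p * N)`, which
  -- the choice of `p` forbids.
  have hdvd : (p : ℤ) ∣ n * K * A ^ (p * N) := ⟨-T, by linarith⟩
  have hpI : Prime (p : ℤ) := Nat.prime_iff_prime_int.1 hpp
  rcases hpI.dvd_or_dvd hdvd with h | h
  · rcases hpI.dvd_or_dvd h with h | h
    · exact hn h
    · have := Nat.le_of_dvd (Int.natAbs_pos.2 hK) (Int.natCast_dvd.1 h)
      omega
  · have := Nat.le_of_dvd (Int.natAbs_pos.2 hA) (Int.natCast_dvd.1 (hpI.dvd_of_dvd_pow h))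
    omega

/-- Newton's recurrence for the power sums of the two roots of `X² - s X + t`. -/
theorem exists_int_pow_add_pow {y y' : ℂ} {s t : ℤ} (hs : y + y' = s) (ht : y * y' = t) (j : ℕ) :
    ∃ k : ℤ, y ^ j + y' ^ j = k := by
  induction j using Nat.twoStepInduction with
  | zero => exact ⟨2, by norm_num⟩
  | one => exact ⟨s, by simpa using hs⟩
  | more j h0 h1 =>
    obtain ⟨k0, h0⟩ := h0
    obtain ⟨k1, h1⟩ := h1
    refine ⟨s * k1 - t * k0, ?_⟩
    push_cast
    rw [← h0, ← h1, ← hs, ← ht]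
    ring

/-- Odd powers cancel between opposite signs. Even powers involve only `-y²` and `-y'²`, so the
factor `i` does no harm; this is why exponents are later used together with their negatives. -/
theorem exists_int_pow_add_neg_pow {y y' : ℂ} {s t : ℤ} (hs : y ^ 2 + y' ^ 2 = s)
    (ht : y ^ 2 * y' ^ 2 = t) (j : ℕ) :
    ∃ k : ℤ, (Complex.I * y) ^ j + (-(Complex.I * y)) ^ j +
      ((Complex.I * y') ^ j + (-(Complex.I * y')) ^ j) = k := by
  rcases Nat.even_or_odd' j with ⟨i, rfl | rfl⟩
  · obtain ⟨k, hk⟩ := exists_int_pow_add_pow (y := -y ^ 2) (y' := -y' ^ 2) (s := -s) (t := t)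
      (by push_cast; rw [← hs]; ring) (by rw [← ht]; ring) i
    refine ⟨2 * k, ?_⟩
    push_cast
    rw [← hk]
    simp only [pow_mul, mul_pow, neg_sq, Complex.I_sq, neg_one_mul]
    ring
  · refine ⟨0, ?_⟩
    rw [Odd.neg_pow ⟨i, rfl⟩, Odd.neg_pow ⟨i, rfl⟩]
    simp

open Complex in
-- The relation `2 + e^{iπ} + e^{-iπ} = 0` has exponents whose squares are rational if `π²` is.
theorem pi_sq_ne_rational {A C : ℤ} (hA : A ≠ 0) : (A : ℝ) * Real.pi ^ 2 + C ≠ 0 := by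
  intro h
  have h' : (A : ℂ) * (Real.pi : ℂ) ^ 2 + C = 0 := by exact_mod_cast h
  have hC : C ≠ 0 := by
    rintro rfl
    have : (A : ℝ) * Real.pi ^ 2 ≠ 0 :=
      mul_ne_zero (by exact_mod_cast hA) (pow_ne_zero 2 Real.pi_ne_zero)
    simp at h
    exact this (by simp [h])
  refine intCast_add_sum_exp_ne_zero ![I * Real.pi, -(I * Real.pi)] ![1, 1] (K := 2) two_ne_zero
    (A := A) hA (Polynomial.C A * X ^ 2 - Polynomial.C C) (by simpa using hC) ?_ ?_ ?_
  · intro i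
    fin_cases i <;>
    · simp [mul_pow]
      linear_combination -h'
  · intro j
    obtain ⟨k, hk⟩ := exists_int_pow_add_neg_pow (y := A * Real.pi) (y' := 0) (s := -(A * C))
      (t := 0) (by push_cast; linear_combination (A : ℂ) * h') (by simp) j
    -- With `y' = 0` the auxiliary sum has two extra terms `0 ^ j`, which vanish only for `j > 0`.
    rcases Nat.eq_zero_or_pos j with rfl | hj
    · exact ⟨2, by norm_num⟩
    refine ⟨k, ?_⟩
    rw [← hk]
    simp [Fin.sum_univ_two, hj.ne']
    ring_nf
  · have e1 : exp (I * Real.pi) = -1 := by rw [mul_comm]; exact exp_pi_mul_I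
    have e2 : exp (-(I * Real.pi)) = -1 := by rw [exp_neg, e1]; norm_num
    simp [Fin.sum_univ_two, e1, e2]
    norm_num

open Complex in
-- Let `u = iπ` and let `w = iπ'` with `π'` the other root. Since `1 + e^u = 0`, the product `(1 +
-- e^u)(1 + e^{-u})(1 + e^w)(1 + e^{-w})` vanishes. Expanding it gives `4`, twice the exponentials
-- of `±u, ±w`, and the exponentials of `±(u + w), ±(u - w)`, a set of exponents stable under
-- conjugation. The constant `4` must be the only contribution of the exponent zero, so `B`, `C` and
-- the discriminant have to be nonzero: if `B = 0`, then `π²` is rational, and in the other two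
-- cases `π` itself is rational.
theorem pi_not_quadratic {A B C : ℤ} (hA : A ≠ 0) :
    (A : ℝ) * Real.pi ^ 2 + B * Real.pi + C ≠ 0 := by
  intro h
  have hirr : ∀ u v : ℤ, u ≠ 0 → (u : ℝ) * Real.pi + v ≠ 0 := by
    intro u v hu huv
    refine irrational_pi ⟨(-v : ℚ) / u, ?_⟩
    have hu' : (u : ℝ) ≠ 0 := by exact_mod_cast hu
    push_cast
    field_simp
    linarith
  have h' : (A : ℂ) * (Real.pi : ℂ) ^ 2 + B * Real.pi + C = 0 := by exact_mod_cast h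
  have hA' : (A : ℂ) ≠ 0 := by exact_mod_cast hA
  have hB : B ≠ 0 := by
    rintro rfl
    refine pi_sq_ne_rational (C := C) hA ?_
    simpa using h
  have hC : C ≠ 0 := by
    rintro rfl
    have h1 : Real.pi * (A * Real.pi + B) = 0 := by push_cast at h; linarith
    exact hirr A B hA ((mul_eq_zero.1 h1).resolve_left Real.pi_ne_zero)
  have hD : B ^ 2 - 4 * A * C ≠ 0 := by
    intro hD
    have hD' : (B : ℝ) ^ 2 - 4 * A * C = 0 := by exact_mod_cast hD
    have h1 : (((2 * A : ℤ) : ℝ) * Real.pi + B) ^ 2 = 0 := by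
      push_cast
      linear_combination 4 * (A : ℝ) * h + hD'
    exact hirr (2 * A) B (mul_ne_zero two_ne_zero hA) (pow_eq_zero_iff two_ne_zero |>.1 h1)
  -- `y` and `y'` are `A` times `π` and its conjugate
  set y : ℂ := A * Real.pi with hy
  set y' : ℂ := -B - y with hy'
  have hs : y + y' = -B := by rw [hy']; ring
  have ht : y * y' = A * C := by rw [hy', hy]; linear_combination -(A : ℂ) * h'
  set u : ℂ := I * y / A with hu
  set w : ℂ := I * y' / A with hw
  have hupi : u = Real.pi * I := by rw [hu, hy]; field_simp
  have hAu : A * u = I * y := by rw [hu]; field_simp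
  have hAw : A * w = I * y' := by rw [hw]; field_simp
  have hAuw : A * (u + w) = -(I * B) := by rw [mul_add, hAu, hAw]; linear_combination I * hs
  have hAuw' : A * (u - w) = I * (y - y') := by rw [mul_sub, hAu, hAw]; ring
  have q1 : (A * u) ^ 2 * (A * w) ^ 2 = A ^ 2 * C ^ 2 := by
    simp only [hAu, hAw, mul_pow, I_sq]; linear_combination (y * y' + A * C) * ht
  have q2 : (A * u) ^ 2 + (A * w) ^ 2 = -(B ^ 2 - 2 * A * C) := by
    simp only [hAu, hAw, mul_pow, I_sq]
    linear_combination (-(y + y') + B) * hs + 2 * ht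
  have q3 : (A * (u + w)) ^ 2 = -B ^ 2 := by
    rw [hAuw, neg_sq, mul_pow, I_sq]; ring
  have q4 : (A * (u - w)) ^ 2 = -(B ^ 2 - 4 * A * C) := by
    rw [hAuw', mul_pow, I_sq]; linear_combination (-(y + y') + B) * hs + 4 * ht
  have h4 : ∀ z : ℂ, ((A * z) ^ 2 = (A * u) ^ 2 ∨ (A * z) ^ 2 = (A * w) ^ 2) ∨
      (A * z) ^ 2 = -B ^ 2 ∨ (A * z) ^ 2 = -(B ^ 2 - 4 * A * C) →
      ((A * z) ^ 4 + (B ^ 2 - 2 * A * C) * (A * z) ^ 2 + A ^ 2 * C ^ 2) *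
        ((A * z) ^ 2 + B ^ 2) * ((A * z) ^ 2 + (B ^ 2 - 4 * A * C)) = 0 := by
    intro z hz
    have hfac : (A * z) ^ 4 + (B ^ 2 - 2 * A * C) * (A * z) ^ 2 + A ^ 2 * C ^ 2 =
        ((A * z) ^ 2 - (A * u) ^ 2) * ((A * z) ^ 2 - (A * w) ^ 2) := by
      linear_combination (A * z) ^ 2 * q2 - q1
    rw [hfac]
    rcases hz with (hz | hz) | hz | hz <;> rw [hz] <;> ring
  have n1 : ∀ z : ℂ, (A * -z) ^ 2 = (A * z) ^ 2 := fun z => by ring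
  -- The three factors vanish at `±u, ±w`, at `±(u + w)` and at `±(u - w)` respectively.
  set F : ℤ[X] := ((Polynomial.C A * X) ^ 4 +
      Polynomial.C (B ^ 2 - 2 * A * C) * (Polynomial.C A * X) ^ 2 +
      Polynomial.C A ^ 2 * Polynomial.C C ^ 2) * ((Polynomial.C A * X) ^ 2 + Polynomial.C B ^ 2) *
      ((Polynomial.C A * X) ^ 2 + Polynomial.C (B ^ 2 - 4 * A * C))
    with hF
  have hF0 : F.eval 0 ≠ 0 := by
    have : F.eval 0 = A ^ 2 * C ^ 2 * B ^ 2 * (B ^ 2 - 4 * A * C) := by simp [hF]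
    rw [this]
    exact mul_ne_zero (mul_ne_zero (mul_ne_zero (pow_ne_zero 2 hA) (pow_ne_zero 2 hC))
      (pow_ne_zero 2 hB)) hD
  have hFz : ∀ z : ℂ, aeval z F =
      ((A * z) ^ 4 + (B ^ 2 - 2 * A * C) * (A * z) ^ 2 + A ^ 2 * C ^ 2) *
        ((A * z) ^ 2 + B ^ 2) * ((A * z) ^ 2 + (B ^ 2 - 4 * A * C)) := by
    intro z
    have hc : ∀ k : ℤ, aeval z (Polynomial.C k) = (k : ℂ) := fun k => by simp
    rw [hF]
    simp only [map_mul (aeval z), map_add (aeval z), map_pow (aeval z), aeval_X, hc]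
    push_cast
    rfl
  clear_value F
  refine intCast_add_sum_exp_ne_zero
    ![u, -u, w, -w, u + w, -(u + w), u - w, -(u - w)] ![2, 2, 2, 2, 1, 1, 1, 1]
    (K := 4) four_ne_zero (A := A) hA F hF0 ?_ ?_ ?_
  · intro i
    rw [hFz]
    refine h4 _ ?_
    fin_cases i
    · exact Or.inl (Or.inl rfl)
    · exact Or.inl (Or.inl (n1 u))
    · exact Or.inl (Or.inr rfl)
    · exact Or.inl (Or.inr (n1 w))
    · exact Or.inr (Or.inl q3)
    · exact Or.inr (Or.inl ((n1 (u + w)).trans q3))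
    · exact Or.inr (Or.inr q4)
    · exact Or.inr (Or.inr ((n1 (u - w)).trans q4))
  · intro j
    obtain ⟨k, hk⟩ := exists_int_pow_add_neg_pow (y := y) (y' := y') (s := B ^ 2 - 2 * A * C)
      (t := A ^ 2 * C ^ 2) (by push_cast; linear_combination (y + y' - B) * hs - 2 * ht)
      (by push_cast; linear_combination (y * y' + A * C) * ht) j
    obtain ⟨k', hk'⟩ := exists_int_pow_add_neg_pow (y := B) (y' := y - y')
      (s := B ^ 2 + (B ^ 2 - 4 * A * C))
      (t := B ^ 2 * (B ^ 2 - 4 * A * C))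
      (by push_cast; linear_combination (y + y' - B) * hs - 4 * ht)
      (by push_cast; linear_combination (B : ℂ) ^ 2 * ((y + y' - B) * hs - 4 * ht)) j
    refine ⟨2 * k + k', ?_⟩
    push_cast
    rw [← hk, ← hk']
    simp only [Fin.sum_univ_eight]
    simp [mul_neg, hAu, hAw, hAuw, hAuw', -neg_add_rev, -neg_sub]
    ring
  · have e1 : exp u = -1 := by rw [hupi]; exact exp_pi_mul_I
    have e2 : exp (-u) = -1 := by rw [exp_neg, e1]; norm_num
    simp only [Fin.sum_univ_eight]
    simp [neg_add, exp_add, e1, e2, -neg_add_rev, -neg_sub, sub_eq_add_neg]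
    ring

end LindemannWeierstrass

/-! ### Decaying solutions of the harmonic oscillator on the line -/

namespace KT

open Filter Topology

/-- A function on the line decays faster than every power. -/
def RapidDecay (u : ℝ → ℂ) : Prop := ∀ j : ℕ, ∃ C : ℝ, ∀ x, |x| ^ j * ‖u x‖ ≤ C

theorem RapidDecay.add {u w : ℝ → ℂ} (hu : RapidDecay u) (hw : RapidDecay w) :
    RapidDecay fun x => u x + w x := by
  intro j
  obtain ⟨C, hC⟩ := hu j
  obtain ⟨D, hD⟩ := hw j
  refine ⟨C + D, fun x => ?_⟩
  calc |x| ^ j * ‖u x + w x‖ ≤ |x| ^ j * (‖u x‖ + ‖w x‖) := by gcongr; exact norm_add_le _ _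
    _ = |x| ^ j * ‖u x‖ + |x| ^ j * ‖w x‖ := mul_add _ _ _
    _ ≤ C + D := add_le_add (hC x) (hD x)

theorem RapidDecay.mul_bounded {u w : ℝ → ℂ} (hu : RapidDecay u) {K : ℝ}
    (hw : ∀ x, ‖w x‖ ≤ K) : RapidDecay fun x => w x * u x := by
  intro j
  obtain ⟨C, hC⟩ := hu j
  have hK : 0 ≤ K := (norm_nonneg _).trans (hw 0)
  refine ⟨K * C, fun x => ?_⟩
  rw [norm_mul]
  calc |x| ^ j * (‖w x‖ * ‖u x‖) = ‖w x‖ * (|x| ^ j * ‖u x‖) := by ring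
    _ ≤ K * C := mul_le_mul (hw x) (hC x) (by positivity) hK

theorem RapidDecay.const_mul {u : ℝ → ℂ} (hu : RapidDecay u) (c : ℂ) :
    RapidDecay fun x => c * u x := hu.mul_bounded (K := ‖c‖) fun _ => le_rfl

theorem RapidDecay.sub {u w : ℝ → ℂ} (hu : RapidDecay u) (hw : RapidDecay w) :
    RapidDecay fun x => u x - w x := by
  simpa [sub_eq_add_neg] using hu.add (hw.const_mul (-1))

theorem RapidDecay.ofReal_mul {u : ℝ → ℂ} (hu : RapidDecay u) :
    RapidDecay fun x => (x : ℂ) * u x := by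
  intro j
  obtain ⟨C, hC⟩ := hu (j + 1)
  refine ⟨C, fun x => ?_⟩
  rw [norm_mul, Complex.norm_real, Real.norm_eq_abs, ← mul_assoc, ← pow_succ]
  exact hC x

theorem RapidDecay.comp_add {u : ℝ → ℂ} (hu : RapidDecay u) (c : ℝ) :
    RapidDecay fun x => u (x + c) := by
  intro j
  obtain ⟨C, hC⟩ := hu j
  obtain ⟨D, hD⟩ := hu 0
  refine ⟨2 ^ j * (C + |c| ^ j * D), fun x => ?_⟩
  have h1 : |x| ^ j ≤ 2 ^ j * (|x + c| ^ j + |c| ^ j) := by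
    have h2 : |x| ≤ 2 * max |x + c| |c| := by
      have := abs_sub (x + c) c
      rw [add_sub_cancel_right] at this
      linarith [le_max_left |x + c| |c|, le_max_right |x + c| |c|]
    calc |x| ^ j ≤ (2 * max |x + c| |c|) ^ j := by gcongr
      _ = 2 ^ j * max |x + c| |c| ^ j := mul_pow _ _ _
      _ ≤ 2 ^ j * (|x + c| ^ j + |c| ^ j) := by
        gcongr
        rcases max_choice |x + c| |c| with h | h <;> rw [h]
        · exact le_add_of_nonneg_right (by positivity)
        · exact le_add_of_nonneg_left (by positivity)
  have h3 := hC (x + c)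
  have h4 := hD (x + c)
  rw [pow_zero, one_mul] at h4
  calc |x| ^ j * ‖u (x + c)‖ ≤ 2 ^ j * (|x + c| ^ j + |c| ^ j) * ‖u (x + c)‖ := by gcongr
    _ = 2 ^ j * (|x + c| ^ j * ‖u (x + c)‖ + |c| ^ j * ‖u (x + c)‖) := by ring
    _ ≤ 2 ^ j * (C + |c| ^ j * D) := by gcongr

theorem RapidDecay.tendsto {u : ℝ → ℂ} (hu : RapidDecay u) : Tendsto u (cocompact ℝ) (𝓝 0) := by
  obtain ⟨C, hC⟩ := hu 1
  have h1 : Tendsto (fun x : ℝ => C * |x|⁻¹) (cocompact ℝ) (𝓝 0) := by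
    have := (tendsto_inv_atTop_zero.comp (tendsto_norm_cocompact_atTop (E := ℝ))).const_mul C
    simpa using this
  refine squeeze_zero_norm' ?_ h1
  have h0 : ∀ᶠ x : ℝ in cocompact ℝ, x ≠ 0 :=
    (isCompact_singleton (x := (0 : ℝ))).compl_mem_cocompact
  filter_upwards [h0] with x hx
  have := hC x
  rw [pow_one] at this
  rw [← div_eq_mul_inv, le_div_iff₀ (abs_pos.2 hx), mul_comm]
  exact this

theorem eq_zero_of_deriv_eq_zero {u : ℝ → ℂ} (h : ∀ x, HasDerivAt u 0 x)
    (hu : Tendsto u atTop (𝓝 0)) : u = 0 := by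
  have hc : ∀ x, u x = u 0 := fun x =>
    is_const_of_deriv_eq_zero (fun y => (h y).differentiableAt) (fun y => (h y).deriv) x 0
  have h0 : u 0 = 0 := by
    refine tendsto_nhds_unique ?_ hu
    exact (tendsto_const_nhds (x := u 0)).congr fun x => (hc x).symm
  funext x
  rw [hc, h0]
  rfl

/-- Energy argument: `ψ = Re(Ū U')` has derivative `|U'|² + (τ²x² - Re Λ)|U|² ≥ 0` and tends to `0`
at both ends, so it vanishes identically. Then `U' = 0`, and a decaying constant is `0`. -/
theorem hermite_eq_zero_of_re_nonpos {τ : ℝ} {Λ : ℂ} (hΛ : Λ.re ≤ 0) {U U' : ℝ → ℂ}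
    (hU : ∀ x, HasDerivAt U (U' x) x)
    (hU' : ∀ x, HasDerivAt U' ((((τ * x) ^ 2 : ℝ) - Λ) * U x) x)
    (dU : RapidDecay U) (dU' : RapidDecay U') : U = 0 := by
  set ψ : ℝ → ℝ := fun x => (U x).re * (U' x).re + (U x).im * (U' x).im with hψ
  have re_d : ∀ {u : ℝ → ℂ} {u' : ℂ} {x : ℝ}, HasDerivAt u u' x →
      HasDerivAt (fun y => (u y).re) u'.re x := fun h =>
    Complex.reCLM.hasFDerivAt.comp_hasDerivAt _ h
  have im_d : ∀ {u : ℝ → ℂ} {u' : ℂ} {x : ℝ}, HasDerivAt u u' x →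
      HasDerivAt (fun y => (u y).im) u'.im x := fun h =>
    Complex.imCLM.hasFDerivAt.comp_hasDerivAt _ h
  have hψd : ∀ x, HasDerivAt ψ ((U' x).re ^ 2 + (U' x).im ^ 2 +
      ((τ * x) ^ 2 - Λ.re) * ((U x).re ^ 2 + (U x).im ^ 2)) x := by
    intro x
    refine (((re_d (hU x)).mul (re_d (hU' x))).add
      ((im_d (hU x)).mul (im_d (hU' x)))).congr_deriv ?_
    simp only [Complex.mul_re, Complex.mul_im, Complex.sub_re, Complex.sub_im, Complex.ofReal_re,
      Complex.ofReal_im]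
    ring
  have hmono : Monotone ψ := by
    refine monotone_of_deriv_nonneg (fun x => (hψd x).differentiableAt) fun x => ?_
    rw [(hψd x).deriv]
    have : 0 ≤ (τ * x) ^ 2 - Λ.re := by nlinarith [sq_nonneg (τ * x)]
    positivity
  have t0 : Tendsto ψ (cocompact ℝ) (𝓝 0) := by
    have r := fun {u : ℝ → ℂ} (h : RapidDecay u) =>
      (Complex.continuous_re.tendsto 0).comp h.tendsto
    have i := fun {u : ℝ → ℂ} (h : RapidDecay u) =>
      (Complex.continuous_im.tendsto 0).comp h.tendsto
    have := ((r dU).mul (r dU')).add ((i dU).mul (i dU'))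
    simpa using this
  rw [cocompact_eq_atBot_atTop, tendsto_sup] at t0
  have hψ0 : ∀ x, ψ x = 0 := fun x =>
    le_antisymm (hmono.ge_of_tendsto t0.2 x) (hmono.le_of_tendsto t0.1 x)
  have hU'0 : ∀ x, U' x = 0 := by
    intro x
    have h1 : HasDerivAt ψ 0 x := by
      have : ψ = fun _ => 0 := funext hψ0
      rw [this]
      exact hasDerivAt_const x 0
    have h2 := (hψd x).unique h1
    have h3 : 0 ≤ (τ * x) ^ 2 - Λ.re := by nlinarith [sq_nonneg (τ * x)]
    have h4 : 0 ≤ ((τ * x) ^ 2 - Λ.re) * ((U x).re ^ 2 + (U x).im ^ 2) := by positivity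
    apply Complex.ext
    · change _ = (0 : ℝ); nlinarith [sq_nonneg (U' x).re, sq_nonneg (U' x).im]
    · change _ = (0 : ℝ); nlinarith [sq_nonneg (U' x).re, sq_nonneg (U' x).im]
  refine eq_zero_of_deriv_eq_zero (fun x => hU'0 x ▸ hU x) ?_
  have := dU.tendsto
  rw [cocompact_eq_atBot_atTop, tendsto_sup] at this
  exact this.2

/-- The spectrum of the harmonic oscillator, through the annihilation operator. -/
theorem hermite_spectrum {τ : ℝ} (N : ℕ) : ∀ {Λ : ℂ}, Λ.re ≤ 2 * τ * N →
    ∀ {U U' : ℝ → ℂ}, (∀ x, HasDerivAt U (U' x) x) →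
    (∀ x, HasDerivAt U' ((((τ * x) ^ 2 : ℝ) - Λ) * U x) x) →
    RapidDecay U → RapidDecay U' → U = 0 ∨ ∃ j : ℕ, Λ = τ * (2 * j + 1) := by
  induction N with
  | zero =>
    intro Λ hΛ U U' hU hU' dU dU'
    exact Or.inl (hermite_eq_zero_of_re_nonpos (by simpa using hΛ) hU hU' dU dU')
  | succ N ih =>
    intro Λ hΛ U U' hU hU' dU dU'
    -- The annihilation operator `d/dx + τ x` lowers the eigenvalue by `2τ`, so `N` applications
    -- reach a nonpositive real part.
    set V : ℝ → ℂ := fun x => U' x + τ * (x * U x) with hV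
    set V' : ℝ → ℂ := fun x => τ * (x * V x) + (τ - Λ) * U x with hV'
    have hx : ∀ x : ℝ, HasDerivAt (fun y : ℝ => (y : ℂ)) 1 x := fun x =>
      (hasDerivAt_id x).ofReal_comp
    have hVd : ∀ x, HasDerivAt V (V' x) x := by
      intro x
      refine ((hU' x).add (((hx x).mul (hU x)).const_mul (τ : ℂ))).congr_deriv ?_
      simp only [hV', hV]
      push_cast
      ring
    have hVd' : ∀ x, HasDerivAt V' ((((τ * x) ^ 2 : ℝ) - (Λ - 2 * τ)) * V x) x := by
      intro x
      refine ((((hx x).mul (hVd x)).const_mul (τ : ℂ)).add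
        ((hU x).const_mul ((τ : ℂ) - Λ))).congr_deriv ?_
      simp only [hV', hV]
      push_cast
      ring
    have dV : RapidDecay V := dU'.add (dU.ofReal_mul.const_mul _)
    have dV' : RapidDecay V' := (dV.ofReal_mul.const_mul _).add (dU.const_mul _)
    have hre : (Λ - 2 * τ).re ≤ 2 * τ * N := by
      have : (Λ - 2 * τ).re = Λ.re - 2 * τ := by simp
      rw [this]
      push_cast at hΛ
      linarith
    rcases ih hre hVd hVd' dV dV' with h | ⟨j, hj⟩
    -- If the lowered function vanishes, then `V' = (τ - Λ) U = 0`, so either `Λ` is the ground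
    -- level or `U = 0`.
    · by_cases hΛτ : Λ = τ
      · exact Or.inr ⟨0, by simp [hΛτ]⟩
      left
      have hV'0 : ∀ x, V' x = 0 := fun x => by
        have h1 := hVd x
        rw [h] at h1
        exact h1.unique (hasDerivAt_const x (0 : ℂ))
      funext x
      have h2 := hV'0 x
      simp only [hV', h, Pi.zero_apply, mul_zero, zero_add] at h2
      exact (mul_eq_zero.1 h2).resolve_left (sub_ne_zero.2 (Ne.symm hΛτ))
    · refine Or.inr ⟨j + 1, ?_⟩
      push_cast
      linear_combination hj

/-- Eliminating `W` gives `U'' = (τ²x² + τ + A B) U`, an oscillator with eigenvalue `-(τ + A B)`.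
The hypothesis excludes its whole spectrum, and for `j = 0` it says `A ≠ 0`, which recovers `W = 0`
from `U = 0`. -/
theorem oscillator_system_eq_zero {τ : ℝ} (hτ : τ ≠ 0) {A B : ℂ}
    (hAB : ∀ j : ℕ, A * B ≠ -2 * (|τ| : ℝ) * j) {U W : ℝ → ℂ}
    (hU : ∀ x, HasDerivAt U (τ * (x * U x) + A * W x) x)
    (hW : ∀ x, HasDerivAt W (-(τ * (x * W x)) + B * U x) x)
    (dU : RapidDecay U) (dW : RapidDecay W) : U = 0 ∧ W = 0 := by
  set U' : ℝ → ℂ := fun x => τ * (x * U x) + A * W x with hU'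
  have hx : ∀ x : ℝ, HasDerivAt (fun y : ℝ => (y : ℂ)) 1 x := fun x =>
    (hasDerivAt_id x).ofReal_comp
  have hUd' : ∀ x, HasDerivAt U' ((((|τ| * x) ^ 2 : ℝ) - -(τ + A * B)) * U x) x := by
    intro x
    refine ((((hx x).mul (hU x)).const_mul (τ : ℂ)).add ((hW x).const_mul A)).congr_deriv ?_
    rw [mul_pow, sq_abs]
    push_cast
    ring
  have dU' : RapidDecay U' := (dU.ofReal_mul.const_mul _).add (dW.const_mul _)
  have hA : A ≠ 0 := by
    rintro rfl
    exact hAB 0 (by simp)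
  obtain ⟨N, hN⟩ := exists_nat_ge ((-(τ + A * B)).re / (2 * |τ|))
  have hpos : 0 < |τ| := abs_pos.2 hτ
  rw [div_le_iff₀ (by positivity)] at hN
  have hU0 : U = 0 := by
    rcases hermite_spectrum (τ := |τ|) N (Λ := -(τ + A * B)) (by linarith) hU hUd' dU dU' with h | ⟨j, hj⟩
    · exact h
    exfalso
    -- The eigenvalue condition reads `A B = -τ - |τ|(2j + 1)`, which is `-2|τ| j` for negative `τ`
    -- and `-2|τ|(j + 1)` for positive `τ`.
    rcases lt_or_gt_of_ne hτ with h | h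
    · rw [abs_of_neg h] at hj hAB
      refine hAB j ?_
      push_cast at hj ⊢
      linear_combination -hj
    · rw [abs_of_pos h] at hj hAB
      refine hAB (j + 1) ?_
      push_cast at hj ⊢
      linear_combination -hj
  refine ⟨hU0, ?_⟩
  funext x
  have h1 := hU x
  rw [hU0] at h1
  have h2 := h1.unique (hasDerivAt_const x (0 : ℂ))
  simp only [Pi.zero_apply, mul_zero, zero_add] at h2
  exact (mul_eq_zero.1 h2).resolve_left hA

/-- The first order systems that the nonzero central characters give have no decaying solution. -/
theorem first_order_system_eq_zero {τ κ P Q x₀ : ℝ} (hτ : τ ≠ 0)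
    (hAB : ∀ j : ℕ, ((κ : ℂ) - Complex.I * (P + Q)) * (κ + Complex.I * (P - Q)) ≠
      -2 * (|τ| : ℝ) * j) {f g : ℝ → ℂ}
    (hf : ∀ x : ℝ, HasDerivAt f (κ * f x + (τ * (x - x₀) + Complex.I * P) * g x) x)
    (hg : ∀ x : ℝ, HasDerivAt g ((-κ + 2 * Complex.I * Q) * g x +
      (τ * (x - x₀) - Complex.I * P) * f x) x)
    (df : RapidDecay f) (dg : RapidDecay g) : f = 0 ∧ g = 0 := by
  -- The sum and the difference of `f` and `g` both carry the diagonal term `iQ`. The unimodular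
  -- factor `E` removes it without affecting the decay, and the shift by `x₀` centres the
  -- oscillator.
  set E : ℝ → ℂ := fun x => Complex.exp (-(Complex.I * Q) * x) with hE
  have hEd : ∀ x, HasDerivAt E (-(Complex.I * Q) * E x) x := by
    intro x
    have h1 : HasDerivAt (fun y : ℝ => -(Complex.I * Q) * (y : ℂ)) (-(Complex.I * Q)) x := by
      simpa using ((hasDerivAt_id x).ofReal_comp).const_mul (-(Complex.I * (Q : ℂ)))
    simpa [hE, mul_comm] using h1.cexp
  have hE1 : ∀ x, ‖E x‖ ≤ 1 := by
    intro x
    have : -(Complex.I * Q) * (x : ℂ) = ((-Q * x : ℝ) : ℂ) * Complex.I := by push_cast; ring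
    simp only [hE, this, Complex.norm_exp_ofReal_mul_I, le_refl]
  have hE0 : ∀ x, E x ≠ 0 := fun x => Complex.exp_ne_zero _
  have fd : ∀ x, HasDerivAt (fun y => f (y + x₀))
      (κ * f (x + x₀) + (τ * x + Complex.I * P) * g (x + x₀)) x := by
    intro x
    have := (hf (x + x₀)).comp_add_const x x₀
    simpa using this
  have gd : ∀ x, HasDerivAt (fun y => g (y + x₀)) ((-κ + 2 * Complex.I * Q) * g (x + x₀) +
      (τ * x - Complex.I * P) * f (x + x₀)) x := by
    intro x
    have := (hg (x + x₀)).comp_add_const x x₀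
    simpa using this
  obtain ⟨h1, h2⟩ := oscillator_system_eq_zero hτ hAB
    (U := fun x => E x * (f (x + x₀) + g (x + x₀))) (W := fun x => E x * (f (x + x₀) - g (x + x₀)))
    (fun x => ((hEd x).mul ((fd x).add (gd x))).congr_deriv (by simp only [Pi.add_apply]; ring))
    (fun x => ((hEd x).mul ((fd x).sub (gd x))).congr_deriv (by simp only [Pi.sub_apply]; ring))
    (((df.comp_add x₀).add (dg.comp_add x₀)).mul_bounded hE1)
    (((df.comp_add x₀).sub (dg.comp_add x₀)).mul_bounded hE1)
  have h3 : ∀ x, f (x + x₀) + g (x + x₀) = 0 := fun x =>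
    (mul_eq_zero.1 (congrFun h1 x)).resolve_left (hE0 x)
  have h4 : ∀ x, f (x + x₀) - g (x + x₀) = 0 := fun x =>
    (mul_eq_zero.1 (congrFun h2 x)).resolve_left (hE0 x)
  constructor <;> funext x
  · have h3 := h3 (x - x₀)
    have h4 := h4 (x - x₀)
    rw [sub_add_cancel] at h3 h4
    change f x = 0
    linear_combination (h3 + h4) / 2
  · have h3 := h3 (x - x₀)
    have h4 := h4 (x - x₀)
    rw [sub_add_cancel] at h3 h4
    change g x = 0
    linear_combination (h3 - h4) / 2

end KT

/-! ### Fourier projections in one coordinate of the covering -/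

namespace KT

open Filter Topology Complex

/-- The character `s ↦ exp (2 π i k s)` of the circle. -/
noncomputable def chr (k : ℤ) (s : ℝ) : ℂ := exp (2 * Real.pi * I * k * s)

/-- The unit vector of the `i`-th coordinate. -/
abbrev unitVec (i : Fin 4) : Cover := Pi.single i 1

/-- The `i`-th partial derivative. -/
noncomputable def partialDeriv (i : Fin 4) (f : Cover → ℂ) (v : Cover) : ℂ :=
  fderiv ℝ f v (unitVec i)

/-- The projection to the functions that are multiplied by the character `k` under translation in
the `i`-th coordinate. -/
noncomputable def proj (i : Fin 4) (k : ℤ) (f : Cover → ℂ) (v : Cover) : ℂ :=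
  ∫ s in (0 : ℝ)..1, chr (-k) s * f (v + s • unitVec i)

theorem continuous_chr (k : ℤ) : Continuous (chr k) := by
  unfold chr
  fun_prop

theorem norm_chr (k : ℤ) (s : ℝ) : ‖chr k s‖ = 1 := by
  have : 2 * Real.pi * I * k * s = ((2 * Real.pi * k * s : ℝ) : ℂ) * I := by push_cast; ring
  rw [chr, this, norm_exp_ofReal_mul_I]

theorem chr_add (k : ℤ) (s t : ℝ) : chr k (s + t) = chr k s * chr k t := by
  rw [chr, chr, chr, ← exp_add]
  congr 1
  push_cast
  ring

theorem chr_one (k : ℤ) : chr k 1 = 1 := by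
  have := exp_int_mul_two_pi_mul_I k
  rw [chr, ← this]
  congr 1
  push_cast
  ring

theorem chr_neg_mul (k : ℤ) (s : ℝ) : chr (-k) s = chr k (-s) := by
  rw [chr, chr]
  push_cast
  ring_nf

theorem chr_zero_left (s : ℝ) : chr 0 s = 1 := by simp [chr]

theorem chr_zero_right (k : ℤ) : chr k 0 = 1 := by simp [chr]

section proj

variable {f g : Cover → ℂ}

theorem continuous_proj_integrand (hf : Continuous f) (i : Fin 4) (k : ℤ) (v : Cover) :
    Continuous fun s : ℝ => chr (-k) s * f (v + s • unitVec i) :=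
  (continuous_chr _).mul (hf.comp (by fun_prop))

theorem proj_add (hf : Continuous f) (hg : Continuous g) (i : Fin 4) (k : ℤ) :
    proj i k (fun v => f v + g v) = fun v => proj i k f v + proj i k g v := by
  funext v
  simp only [proj, mul_add]
  exact intervalIntegral.integral_add
    ((continuous_proj_integrand hf i k v).intervalIntegrable _ _)
    ((continuous_proj_integrand hg i k v).intervalIntegrable _ _)

theorem proj_const_mul (c : ℂ) (i : Fin 4) (k : ℤ) :
    proj i k (fun v => c * f v) = fun v => c * proj i k f v := by
  funext v
  simp only [proj, mul_left_comm _ c]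
  exact intervalIntegral.integral_const_mul _ _

theorem proj_zero (i : Fin 4) (k : ℤ) : proj i k (fun _ => 0) = fun _ => 0 := by
  funext v
  simp [proj]

theorem proj_coord_mul {i j : Fin 4} (hij : j ≠ i) (k : ℤ) :
    proj i k (fun v => (v j : ℂ) * f v) = fun v => (v j : ℂ) * proj i k f v := by
  funext v
  simp only [proj, Pi.add_apply, Pi.smul_apply, Pi.single_eq_of_ne hij, smul_zero, add_zero,
    mul_left_comm _ ((v j : ℂ))]
  exact intervalIntegral.integral_const_mul _ _

theorem norm_proj_le {C : ℝ} (hf : ∀ v, ‖f v‖ ≤ C) (i : Fin 4) (k : ℤ) (v : Cover) :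
    ‖proj i k f v‖ ≤ C := by
  have := intervalIntegral.norm_integral_le_of_norm_le_const (a := (0 : ℝ)) (b := 1) (C := C)
    (f := fun s => chr (-k) s * f (v + s • unitVec i)) fun s _ => by
      rw [norm_mul, norm_chr, one_mul]
      exact hf _
  rw [sub_zero, abs_one, mul_one] at this
  exact this

theorem hasFDerivAt_proj (hf : ContDiff ℝ ∞ f) (i : Fin 4) (k : ℤ) (v : Cover) :
    HasFDerivAt (proj i k f)
      (∫ s in (0 : ℝ)..1, chr (-k) s • fderiv ℝ f (v + s • unitVec i)) v := by
  have hd : Differentiable ℝ f := hf.differentiable (by simp)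
  have hc : Continuous (fderiv ℝ f) := hf.continuous_fderiv (by simp)
  obtain ⟨C, hC⟩ := ((isCompact_closedBall v 1).prod (isCompact_Icc (a := (0 : ℝ)) (b := 1))).image
    (f := fun x : Cover × ℝ => fderiv ℝ f (x.1 + x.2 • unitVec i))
    (hc.comp (by fun_prop)) |>.isBounded.exists_norm_le
  have hcont : ∀ w, Continuous fun s : ℝ => chr (-k) s • fderiv ℝ f (w + s • unitVec i) :=
    fun w => (continuous_chr _).smul (hc.comp (by fun_prop))
  refine intervalIntegral.hasFDerivAt_integral_of_dominated_of_fderiv_le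
    (F := fun w s => chr (-k) s * f (w + s • unitVec i))
    (F' := fun w s => chr (-k) s • fderiv ℝ f (w + s • unitVec i)) (bound := fun _ => C)
    (Metric.closedBall_mem_nhds v one_pos) ?_ ?_ ?_ ?_ ?_ ?_
  · exact Eventually.of_forall fun w =>
      (continuous_proj_integrand hf.continuous i k w).aestronglyMeasurable
  · exact (continuous_proj_integrand hf.continuous i k v).intervalIntegrable _ _
  · exact (hcont v).aestronglyMeasurable
  · refine Eventually.of_forall fun s hs w hw => ?_
    rw [Set.uIoc_of_le zero_le_one] at hs
    rw [norm_smul, norm_chr, one_mul]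
    exact hC _ ⟨(w, s), ⟨hw, hs.1.le, hs.2⟩, rfl⟩
  · exact intervalIntegrable_const
  · refine Eventually.of_forall fun s _ w _ => ?_
    have h1 : HasFDerivAt (fun w => f (w + s • unitVec i)) (fderiv ℝ f (w + s • unitVec i)) w := by
      exact (hd (w + s • unitVec i)).hasFDerivAt.comp w
        ((hasFDerivAt_id w).add_const (s • unitVec i))
    exact h1.const_mul _

theorem fderiv_proj (hf : ContDiff ℝ ∞ f) (i : Fin 4) (k : ℤ) (v w : Cover) :
    fderiv ℝ (proj i k f) v w = proj i k (fun x => fderiv ℝ f x w) v := by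
  have hc : Continuous (fderiv ℝ f) := hf.continuous_fderiv (by simp)
  rw [(hasFDerivAt_proj hf i k v).fderiv, ContinuousLinearMap.intervalIntegral_apply]
  · rfl
  · exact ((continuous_chr _).smul (hc.comp (by fun_prop))).intervalIntegrable _ _

theorem contDiff_fderiv_apply (hf : ContDiff ℝ ∞ f) (w : Cover) :
    ContDiff ℝ ∞ fun x => fderiv ℝ f x w :=
  (hf.fderiv_right (m := ∞) le_rfl).clm_apply contDiff_const

theorem contDiff_partialDeriv (hf : ContDiff ℝ ∞ f) (i : Fin 4) : ContDiff ℝ ∞ (partialDeriv i f) :=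
  contDiff_fderiv_apply hf _

theorem contDiff_proj (hf : ContDiff ℝ ∞ f) (i : Fin 4) (k : ℤ) : ContDiff ℝ ∞ (proj i k f) := by
  rw [contDiff_infty]
  intro n
  induction n generalizing f with
  | zero =>
    exact contDiff_zero.2 (Differentiable.continuous (𝕜 := ℝ) fun v =>
      (hasFDerivAt_proj hf i k v).differentiableAt)
  | succ n ih =>
    push_cast
    rw [contDiff_succ_iff_fderiv_apply]
    refine ⟨fun v => (hasFDerivAt_proj hf i k v).differentiableAt, by simp, fun w => ?_⟩
    simp_rw [fderiv_proj hf]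
    exact ih (contDiff_fderiv_apply hf w)

theorem partialDeriv_proj (hf : ContDiff ℝ ∞ f) (i j : Fin 4) (k : ℤ) :
    partialDeriv j (proj i k f) = proj i k (partialDeriv j f) :=
  funext fun v => fderiv_proj hf i k v _

/-- The function is periodic in the `i`-th coordinate. -/
def PeriodicIn (i : Fin 4) (f : Cover → ℂ) : Prop := ∀ v, f (v + unitVec i) = f v

theorem PeriodicIn.proj {i : Fin 4} (hf : PeriodicIn i f) (j : Fin 4) (k : ℤ) :
    PeriodicIn i (proj j k f) := by
  intro v
  simp only [KT.proj]
  refine intervalIntegral.integral_congr fun s _ => ?_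
  rw [add_right_comm, hf]

theorem proj_add_smul {i : Fin 4} (hp : PeriodicIn i f) (k : ℤ) (v : Cover)
    (r : ℝ) : proj i k f (v + r • unitVec i) = chr k r * proj i k f v := by
  set G : ℝ → ℂ := fun s => chr (-k) s * f (v + s • unitVec i) with hG
  have hper : Function.Periodic G 1 := by
    intro s
    simp only [hG]
    rw [chr_add, chr_one, mul_one, add_smul, one_smul, ← add_assoc, hp]
  have h1 : ∀ s : ℝ, chr (-k) s * f (v + r • unitVec i + s • unitVec i) = chr k r * G (s + r) := by
    intro s
    simp only [hG]
    have h2 : chr k r * chr (-k) (s + r) = chr (-k) s := by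
      rw [chr_add, mul_left_comm, chr_neg_mul k r, ← chr_add, add_neg_cancel, chr_zero_right,
        mul_one]
    rw [← mul_assoc, h2, add_smul, add_comm (s • _), add_assoc]
  simp only [proj, h1]
  rw [intervalIntegral.integral_const_mul, intervalIntegral.integral_comp_add_right, zero_add,
    add_comm 1 r, hper.intervalIntegral_add_eq r 0, zero_add]

theorem hasDerivAt_chr (k : ℤ) (r : ℝ) :
    HasDerivAt (chr k) (2 * Real.pi * I * k * chr k r) r := by
  have h1 : HasDerivAt (fun y : ℝ => 2 * Real.pi * I * k * (y : ℂ)) (2 * Real.pi * I * k) r := by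
    simpa using ((hasDerivAt_id r).ofReal_comp).const_mul (2 * (Real.pi : ℂ) * I * (k : ℂ))
  refine (h1.cexp).congr_deriv ?_
  rw [chr, mul_comm]

theorem hasDerivAt_line (hf : ContDiff ℝ ∞ f) (v w : Cover) (r : ℝ) :
    HasDerivAt (fun s : ℝ => f (v + s • w)) (fderiv ℝ f (v + r • w) w) r := by
  have hd : Differentiable ℝ f := hf.differentiable (by simp)
  have h1 : HasDerivAt (fun s : ℝ => v + s • w) w r := by
    simpa using ((hasDerivAt_id r).smul_const w).const_add v
  exact (hd _).hasFDerivAt.comp_hasDerivAt r h1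

theorem partialDeriv_proj_self (hf : ContDiff ℝ ∞ f) {i : Fin 4} (hp : PeriodicIn i f) (k : ℤ) :
    partialDeriv i (proj i k f) = fun v => 2 * Real.pi * I * k * proj i k f v := by
  funext v
  have h1 := hasDerivAt_line (contDiff_proj hf i k) v (unitVec i) 0
  have h2 := (hasDerivAt_chr k 0).mul_const (proj i k f v)
  simp_rw [proj_add_smul hp] at h1
  have h3 := h1.unique h2
  rw [zero_smul, add_zero, chr_zero_right, mul_one] at h3
  exact h3

theorem proj_partialDeriv_self (hf : ContDiff ℝ ∞ f) {i : Fin 4} (hp : PeriodicIn i f) (k : ℤ) :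
    proj i k (partialDeriv i f) = fun v => 2 * Real.pi * I * k * proj i k f v := by
  rw [← partialDeriv_proj hf, partialDeriv_proj_self hf hp]

/-- A continuous function that is periodic in a coordinate vanishes if all its projections do. -/
theorem eq_zero_of_proj_eq_zero (hf : Continuous f) {i : Fin 4} (hp : PeriodicIn i f)
    (h : ∀ k, proj i k f = 0) : f = 0 := by
  funext v
  have : Fact ((0 : ℝ) < 1) := ⟨one_pos⟩
  have hper : Function.Periodic (fun s : ℝ => f (v + s • unitVec i)) 1 := by
    intro s
    simp only [add_smul, one_smul, ← add_assoc, hp _]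
  have hcont : Continuous fun s : ℝ => f (v + s • unitVec i) := hf.comp (by fun_prop)
  let F : C(AddCircle (1 : ℝ), ℂ) := ⟨hper.lift, hcont.quotient_liftOn' _⟩
  have hF : ∀ s : ℝ, F (s : AddCircle (1 : ℝ)) = f (v + s • unitVec i) := fun s => rfl
  have hcoeff : ∀ k, fourierCoeff F k = 0 := by
    intro k
    rw [fourierCoeff_eq_intervalIntegral _ _ 0]
    have h1 := congrFun (h k) v
    simp only [proj, Pi.zero_apply] at h1
    rw [zero_add, div_one, one_smul, ← h1]
    refine intervalIntegral.integral_congr fun s _ => ?_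
    simp only [smul_eq_mul, hF]
    congr 1
    rw [fourier_coe_apply, chr]
    congr 1
    push_cast
    ring
  -- A continuous function with summable Fourier coefficients is the pointwise sum of its series;
  -- here all the terms are zero.
  have hsum : Summable (fourierCoeff F) := by
    rw [show fourierCoeff F = 0 from funext hcoeff]
    exact summable_zero
  have h2 := has_pointwise_sum_fourier_series_of_summable hsum ((0 : ℝ) : AddCircle (1 : ℝ))
  simp only [hcoeff, zero_smul] at h2
  have h3 := h2.unique hasSum_zero
  rw [hF, zero_smul, add_zero] at h3
  exact h3

/-- The mean in a coordinate of a real function. -/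
noncomputable def mean (i : Fin 4) (r : Cover → ℝ) (v : Cover) : ℝ :=
  ∫ s in (0 : ℝ)..1, r (v + s • unitVec i)

/-- If the mean in a coordinate of a nonnegative continuous function vanishes at a point, so does the
function on the unit segment. -/
theorem eq_zero_of_mean_eq_zero {r : Cover → ℝ} (hr : Continuous r) (h0 : ∀ v, 0 ≤ r v)
    (i : Fin 4) {v : Cover} (h : mean i r v = 0) {s : ℝ}
    (hs : s ∈ Set.Icc (0 : ℝ) 1) : r (v + s • unitVec i) = 0 := by
  have hc : Continuous fun s : ℝ => r (v + s • unitVec i) := hr.comp (by fun_prop)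
  by_contra hne
  have hpos : 0 < ∫ s in (0 : ℝ)..1, r (v + s • unitVec i) :=
    intervalIntegral.integral_pos one_pos hc.continuousOn (fun x _ => h0 _)
      ⟨s, hs, lt_of_le_of_ne (h0 _) (Ne.symm hne)⟩
  exact hpos.ne' h

theorem proj_ofReal (i : Fin 4) (r : Cover → ℝ) :
    proj i 0 (fun w => (r w : ℂ)) = fun v => (mean i r v : ℂ) := by
  funext v
  rw [proj, mean, ← intervalIntegral.integral_ofReal]
  simp only [neg_zero, chr_zero_left, one_mul]

theorem mean_nonneg {r : Cover → ℝ} (h0 : ∀ v, 0 ≤ r v) (i : Fin 4) (v : Cover) :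
    0 ≤ mean i r v :=
  intervalIntegral.integral_nonneg zero_le_one fun _ _ => h0 _

theorem continuous_mean {r : Cover → ℝ} (hr : Continuous r) (i : Fin 4) :
    Continuous (mean i r) := by
  refine intervalIntegral.continuous_parametric_intervalIntegral_of_continuous' ?_ _ _
  exact hr.comp (by fun_prop)

end proj

/-- A solution of a full system of constant coefficient equations is determined by one value. -/
theorem eq_zero_of_partialDeriv {c : Cover → ℂ} (hc : ContDiff ℝ ∞ c) (μ : Fin 4 → ℂ)
    (h : ∀ i v, partialDeriv i c v = μ i * c v) (h0 : c 0 = 0) : c = 0 := by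
  funext v
  set ν : ℂ := ∑ i, (v i : ℂ) * μ i with hν
  have hd : ∀ r : ℝ, HasDerivAt (fun s : ℝ => c ((0 : Cover) + s • v)) (ν * c (0 + r • v)) r := by
    intro r
    refine (hasDerivAt_line hc 0 v r).congr_deriv ?_
    have hv : v = ∑ i, v i • unitVec i := pi_eq_sum_univ' v
    conv_lhs => rw [show (fderiv ℝ c (0 + r • v)) v =
      (fderiv ℝ c (0 + r • v)) (∑ i, v i • unitVec i) by rw [← hv]]
    rw [map_sum, hν, Finset.sum_mul]
    refine Finset.sum_congr rfl fun i _ => ?_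
    rw [map_smul]
    have := h i (0 + r • v)
    rw [partialDeriv] at this
    rw [this, real_smul, mul_assoc]
  set G : ℝ → ℂ := fun s => exp (-(ν * s)) * c (0 + s • v) with hG
  -- Along the ray to `v` the function satisfies `c' = ν c`, and the integrating factor `exp (-ν s)`
  -- makes it constant.
  have hG' : ∀ r, HasDerivAt G 0 r := by
    intro r
    have h1 : HasDerivAt (fun y : ℝ => -(ν * (y : ℂ))) (-ν) r := by
      exact (((hasDerivAt_id r).ofReal_comp).const_mul ν).neg.congr_deriv (by simp)
    refine (h1.cexp.mul (hd r)).congr_deriv ?_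
    ring
  have h2 : G 1 = G 0 :=
    is_const_of_deriv_eq_zero (fun y => (hG' y).differentiableAt) (fun y => (hG' y).deriv) 1 0
  simp only [hG, zero_add, one_smul, zero_smul, h0, mul_zero] at h2
  exact (mul_eq_zero.1 h2).resolve_left (exp_ne_zero _)

end KT

/-! ### Invariant functions: Fourier modes, decay and integration by parts -/

namespace KT

open Filter Topology Complex

/-- The function descends to `KT⁴`. -/
def Invariant (f : Cover → ℂ) : Prop := ∀ (n : Fin 4 → ℤ) (v : Cover), f (deck n v) = f v

/-- The derivative in the direction of a vector field of the frame. -/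
noncomputable def frameDeriv (j : Fin 4) (f : Cover → ℂ) (v : Cover) : ℂ :=
  fderiv ℝ f v (frame v j)

theorem hasFDerivAt_deck (n : Fin 4 → ℤ) (v : Cover) :
    HasFDerivAt (deck n) (ContinuousLinearMap.id ℝ Cover +
      ((n 1 : ℝ) • ContinuousLinearMap.proj (R := ℝ) (φ := fun _ : Fin 4 => ℝ) 2).smulRight
        (unitVec 3)) v := by
  have h : deck n = fun v => (ContinuousLinearMap.id ℝ Cover +
      ((n 1 : ℝ) • ContinuousLinearMap.proj (R := ℝ) (φ := fun _ : Fin 4 => ℝ) 2).smulRight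
        (unitVec 3)) v + fun i => (n i : ℝ) := by
    funext v i
    fin_cases i <;> simp [deck]
    ring
  rw [h]
  exact (ContinuousLinearMap.hasFDerivAt _).add_const _

theorem fderiv_deck_apply (n : Fin 4 → ℤ) (v w : Cover) :
    fderiv ℝ (deck n) v w = ![w 0, w 1, w 2, w 3 + n 1 * w 2] := by
  rw [(hasFDerivAt_deck n v).fderiv]
  ext i
  fin_cases i <;> simp

/-- The frame is left-invariant. Hence derivatives of invariant functions along it are again
invariant, while coordinate derivatives need not be. -/
theorem fderiv_deck_frame (n : Fin 4 → ℤ) (v : Cover) (j : Fin 4) :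
    fderiv ℝ (deck n) v (frame v j) = frame (deck n v) j := by
  rw [fderiv_deck_apply]
  ext i
  fin_cases j <;> fin_cases i <;> simp [frame, deck]

theorem frame_zero (v : Cover) : frame v 0 = unitVec 0 := by
  ext i; fin_cases i <;> simp [frame]

theorem frame_one (v : Cover) : frame v 1 = unitVec 1 := by
  ext i; fin_cases i <;> simp [frame]

theorem frame_two (v : Cover) : frame v 2 = unitVec 2 + v 1 • unitVec 3 := by
  ext i; fin_cases i <;> simp [frame]

theorem frame_three (v : Cover) : frame v 3 = unitVec 3 := by
  ext i; fin_cases i <;> simp [frame]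

section functions

variable {f g : Cover → ℂ}

theorem frameDeriv_zero (f : Cover → ℂ) : frameDeriv 0 f = partialDeriv 0 f := by
  funext v; rw [frameDeriv, frame_zero, partialDeriv]

theorem frameDeriv_one (f : Cover → ℂ) : frameDeriv 1 f = partialDeriv 1 f := by
  funext v; rw [frameDeriv, frame_one, partialDeriv]

theorem frameDeriv_two (f : Cover → ℂ) :
    frameDeriv 2 f = fun v => partialDeriv 2 f v + (v 1 : ℂ) * partialDeriv 3 f v := by
  funext v
  rw [frameDeriv, frame_two, map_add, map_smul, partialDeriv, partialDeriv, real_smul]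

theorem frameDeriv_three (f : Cover → ℂ) : frameDeriv 3 f = partialDeriv 3 f := by
  funext v; rw [frameDeriv, frame_three, partialDeriv]

theorem contDiff_frameDeriv (hf : ContDiff ℝ ∞ f) (j : Fin 4) : ContDiff ℝ ∞ (frameDeriv j f) :=
  (hf.fderiv_right (m := ∞) le_rfl).clm_apply (contDiff_frame j)

theorem Invariant.frameDeriv (hf : Invariant f) (hs : ContDiff ℝ ∞ f) (j : Fin 4) :
    Invariant (frameDeriv j f) := by
  intro n v
  have hd : Differentiable ℝ f := hs.differentiable (by simp)
  have h1 : fderiv ℝ f v = (fderiv ℝ f (deck n v)).comp (fderiv ℝ (deck n) v) := by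
    rw [← fderiv_comp v (hd _) (hasFDerivAt_deck n v).differentiableAt]
    congr 1
    exact (funext fun w => hf n w).symm
  rw [KT.frameDeriv, KT.frameDeriv, h1, ContinuousLinearMap.comp_apply, fderiv_deck_frame]

theorem frameDeriv_mul (hf : ContDiff ℝ ∞ f) (hg : ContDiff ℝ ∞ g) (j : Fin 4) :
    frameDeriv j (fun v => f v * g v) =
      fun v => f v * frameDeriv j g v + frameDeriv j f v * g v := by
  funext v
  have hf' : DifferentiableAt ℝ f v := hf.differentiable (by simp) v
  have hg' : DifferentiableAt ℝ g v := hg.differentiable (by simp) v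
  simp only [frameDeriv]
  rw [fderiv_fun_mul hf' hg']
  simp [mul_comm]

theorem frameDeriv_const_mul (hf : ContDiff ℝ ∞ f) (c : ℂ) (j : Fin 4) :
    frameDeriv j (fun v => c * f v) = fun v => c * frameDeriv j f v := by
  funext v
  have hf' : DifferentiableAt ℝ f v := hf.differentiable (by simp) v
  simp only [frameDeriv]
  rw [fderiv_const_mul hf']
  simp

theorem contDiff_conj (hf : ContDiff ℝ ∞ f) : ContDiff ℝ ∞ fun v => (starRingEnd ℂ) (f v) :=
  (conjCLE : ℂ →L[ℝ] ℂ).contDiff.comp hf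

theorem frameDeriv_conj (hf : ContDiff ℝ ∞ f) (j : Fin 4) :
    frameDeriv j (fun v => (starRingEnd ℂ) (f v)) = fun v => (starRingEnd ℂ) (frameDeriv j f v) := by
  funext v
  have hf' : DifferentiableAt ℝ f v := hf.differentiable (by simp) v
  have h := ((conjCLE : ℂ →L[ℝ] ℂ).hasFDerivAt.comp v hf'.hasFDerivAt).fderiv
  simp only [frameDeriv]
  change fderiv ℝ ((conjCLE : ℂ →L[ℝ] ℂ) ∘ f) v _ = _
  rw [h]
  simp

/-- The `x`-translation is the exception because its deck transformation also shears `z` by `y`. -/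
theorem Invariant.periodicIn (hf : Invariant f) {i : Fin 4} (hi : i ≠ 1) : PeriodicIn i f := by
  intro v
  rw [← hf (Pi.single i 1) v]
  congr 1
  ext j
  fin_cases i <;> first | exact absurd rfl hi | (fin_cases j <;> simp [deck])

theorem exists_deck_eq (v : Cover) :
    ∃ (n : Fin 4 → ℤ) (w : Cover), (∀ i, w i ∈ Set.Icc (0 : ℝ) 1) ∧ deck n w = v := by
  -- The unit cube contains a fundamental domain. The shear `⌊v 1⌋ * y` is evaluated at the reduced
  -- `y`, so it is subtracted from `z` before the integer part of `z` is taken.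
  refine ⟨![⌊v 0⌋, ⌊v 1⌋, ⌊v 2⌋, ⌊v 3 - ⌊v 1⌋ * Int.fract (v 2)⌋],
    ![Int.fract (v 0), Int.fract (v 1), Int.fract (v 2),
      Int.fract (v 3 - ⌊v 1⌋ * Int.fract (v 2))], ?_, ?_⟩
  · intro i
    fin_cases i <;> exact ⟨Int.fract_nonneg _, (Int.fract_lt_one _).le⟩
  · ext i
    fin_cases i <;> simp [deck]

theorem Invariant.exists_norm_le (hf : Invariant f) (hc : Continuous f) :
    ∃ C, ∀ v, ‖f v‖ ≤ C := by
  obtain ⟨C, hC⟩ := ((isCompact_univ_pi fun _ : Fin 4 => isCompact_Icc (a := (0 : ℝ)) (b := 1)).image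
    hc).isBounded.exists_norm_le
  refine ⟨C, fun v => ?_⟩
  obtain ⟨n, w, hw, rfl⟩ := exists_deck_eq v
  rw [hf]
  exact hC _ ⟨w, fun i _ => hw i, rfl⟩

/-- The component of a function on `KT⁴` with frequencies `k`, `m`, `n` in `t`, `y`, `z`. -/
noncomputable def mode (k m n : ℤ) (f : Cover → ℂ) : Cover → ℂ := proj 0 k (proj 2 m (proj 3 n f))

theorem contDiff_mode (hf : ContDiff ℝ ∞ f) (k m n : ℤ) : ContDiff ℝ ∞ (mode k m n f) :=
  contDiff_proj (contDiff_proj (contDiff_proj hf _ _) _ _) _ _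

theorem mode_add (hf : ContDiff ℝ ∞ f) (hg : ContDiff ℝ ∞ g) (k m n : ℤ) :
    mode k m n (fun v => f v + g v) = fun v => mode k m n f v + mode k m n g v := by
  have c := fun {h : Cover → ℂ} (hh : ContDiff ℝ ∞ h) i l => (contDiff_proj hh i l).continuous
  simp only [mode]
  rw [proj_add hf.continuous hg.continuous, proj_add (c hf _ _) (c hg _ _),
    proj_add (c (contDiff_proj hf _ _) _ _) (c (contDiff_proj hg _ _) _ _)]

theorem mode_const_mul (c : ℂ) (k m n : ℤ) :
    mode k m n (fun v => c * f v) = fun v => c * mode k m n f v := by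
  simp only [mode, proj_const_mul]

theorem partialDeriv_mode (hf : ContDiff ℝ ∞ f) (j : Fin 4) (k m n : ℤ) :
    partialDeriv j (mode k m n f) = mode k m n (partialDeriv j f) := by
  simp only [mode]
  rw [partialDeriv_proj (contDiff_proj (contDiff_proj hf _ _) _ _),
    partialDeriv_proj (contDiff_proj hf _ _), partialDeriv_proj hf]

theorem mode_partialDeriv_zero (hf : ContDiff ℝ ∞ f) (hi : Invariant f) (k m n : ℤ) :
    mode k m n (partialDeriv 0 f) = fun v => 2 * Real.pi * I * k * mode k m n f v := by
  have hp : PeriodicIn 0 (proj 2 m (proj 3 n f)) :=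
    ((hi.periodicIn (by decide)).proj _ _).proj _ _
  simp only [mode]
  rw [← partialDeriv_proj hf, ← partialDeriv_proj (contDiff_proj hf _ _),
    proj_partialDeriv_self (contDiff_proj (contDiff_proj hf _ _) _ _) hp]

theorem mode_partialDeriv_two (hf : ContDiff ℝ ∞ f) (hi : Invariant f) (k m n : ℤ) :
    mode k m n (partialDeriv 2 f) = fun v => 2 * Real.pi * I * m * mode k m n f v := by
  have hp : PeriodicIn 2 (proj 3 n f) := (hi.periodicIn (by decide)).proj _ _
  simp only [mode]
  rw [← partialDeriv_proj hf, proj_partialDeriv_self (contDiff_proj hf _ _) hp, proj_const_mul]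

theorem mode_partialDeriv_three (hf : ContDiff ℝ ∞ f) (hi : Invariant f) (k m n : ℤ) :
    mode k m n (partialDeriv 3 f) = fun v => 2 * Real.pi * I * n * mode k m n f v := by
  have hp : PeriodicIn 3 f := hi.periodicIn (by decide)
  simp only [mode]
  rw [proj_partialDeriv_self hf hp, proj_const_mul, proj_const_mul]

theorem mode_coord_mul (k m n : ℤ) :
    mode k m n (fun v => (v 1 : ℂ) * f v) = fun v => (v 1 : ℂ) * mode k m n f v := by
  simp only [mode]
  rw [proj_coord_mul (by decide), proj_coord_mul (by decide), proj_coord_mul (by decide)]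

theorem contDiff_coord_mul (hf : ContDiff ℝ ∞ f) : ContDiff ℝ ∞ fun v : Cover => (v 1 : ℂ) * f v :=
  (ofRealCLM.contDiff.comp (contDiff_coord 1)).mul hf

theorem mode_frameDeriv_two (hf : ContDiff ℝ ∞ f) (hi : Invariant f) (k m n : ℤ) :
    mode k m n (frameDeriv 2 f) = fun v => 2 * Real.pi * I * (m + n * v 1) * mode k m n f v := by
  rw [frameDeriv_two, mode_add (contDiff_partialDeriv hf 2)
    (contDiff_coord_mul (contDiff_partialDeriv hf 3)), mode_coord_mul,
    mode_partialDeriv_two hf hi, mode_partialDeriv_three hf hi]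
  funext v
  ring

theorem norm_mode_le {C : ℝ} (hf : ∀ v, ‖f v‖ ≤ C) (k m n : ℤ) (v : Cover) :
    ‖mode k m n f v‖ ≤ C :=
  norm_proj_le (fun v => norm_proj_le (fun v => norm_proj_le hf _ _ v) _ _ v) _ _ v

theorem eq_zero_of_mode_eq_zero (hf : ContDiff ℝ ∞ f) (hi : Invariant f)
    (h : ∀ k m n, mode k m n f = 0) : f = 0 := by
  have p := fun {i : Fin 4} (h : i ≠ 1) => hi.periodicIn h
  refine eq_zero_of_proj_eq_zero hf.continuous (p (i := 3) (by decide)) fun n => ?_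
  refine eq_zero_of_proj_eq_zero (contDiff_proj hf _ _).continuous
    ((p (i := 2) (by decide)).proj _ _) fun m => ?_
  exact eq_zero_of_proj_eq_zero (contDiff_proj (contDiff_proj hf _ _) _ _).continuous
    (((p (i := 0) (by decide)).proj _ _).proj _ _) fun k => h k m n

/-- The mean over the central circle is periodic in `x`. -/
theorem periodicIn_one_mode (hi : Invariant f) (k m : ℤ) :
    PeriodicIn 1 (mode k m 0 f) := by
  refine PeriodicIn.proj (PeriodicIn.proj ?_ _ _) _ _
  intro v
  -- The mean over `z` does not depend on `z`, so the shift by `y` in `z` that the deck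
  -- transformation needs can be inserted freely.
  have h1 : (proj 3 0 f) (v + unitVec 1) =
      proj 3 0 f (v + unitVec 1 + v 2 • unitVec 3) := by
    rw [proj_add_smul (hi.periodicIn (by decide)), chr_zero_left, one_mul]
  rw [h1]
  simp only [proj]
  refine intervalIntegral.integral_congr fun s _ => ?_
  rw [← hi (Pi.single 1 1) (v + s • unitVec 3)]
  congr 2
  ext j
  fin_cases j <;> simp [deck]
  ring

/-- The line in the direction `x` through a point. -/
theorem hasDerivAt_mode_update (hf : ContDiff ℝ ∞ f) (k m n : ℤ) (v : Cover) (x : ℝ) :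
    HasDerivAt (fun x => mode k m n f (Function.update v 1 x))
      (mode k m n (frameDeriv 1 f) (Function.update v 1 x)) x := by
  have hd : Differentiable ℝ (mode k m n f) := (contDiff_mode hf k m n).differentiable (by simp)
  have h1 := (hd (Function.update v 1 x)).hasFDerivAt.comp_hasDerivAt x
    (hasDerivAt_update v 1 x)
  rw [frameDeriv_one, ← partialDeriv_mode hf]
  exact h1

/-- Each application of `∂/∂y + x ∂/∂z` multiplies the mode by `2πi(m + n x)` and leaves it a mode
of an invariant, hence bounded, function. So every power of `m + n x` times the mode is bounded, and
`|n| ≥ 1` lets `|m + n x| + |m|` control `|x|`. -/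
theorem rapidDecay_mode (hf : ContDiff ℝ ∞ f) (hi : Invariant f) (k m : ℤ) {n : ℤ} (hn : n ≠ 0)
    (v : Cover) : RapidDecay fun x => mode k m n f (Function.update v 1 x) := by
  have key : ∀ j : ℕ, ∀ g : Cover → ℂ, ContDiff ℝ ∞ g → Invariant g → ∃ C : ℝ, ∀ x : ℝ,
      |(m : ℝ) + n * x| ^ j * ‖mode k m n g (Function.update v 1 x)‖ ≤ C := by
    intro j
    induction j with
    | zero =>
      intro g hg hgi
      obtain ⟨C, hC⟩ := hgi.exists_norm_le hg.continuous
      exact ⟨C, fun x => by simpa using norm_mode_le hC k m n _⟩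
    | succ j ih =>
      intro g hg hgi
      obtain ⟨C, hC⟩ := ih (frameDeriv 2 g) (contDiff_frameDeriv hg 2) (hgi.frameDeriv hg 2)
      refine ⟨C / (2 * Real.pi), fun x => ?_⟩
      have h1 := hC x
      rw [mode_frameDeriv_two hg hgi] at h1
      simp only [Function.update_self] at h1
      have h2 : ‖2 * (Real.pi : ℂ) * I * (m + n * x)‖ = 2 * Real.pi * |(m : ℝ) + n * x| := by
        have : ((m : ℂ) + n * x) = (((m : ℝ) + n * x : ℝ) : ℂ) := by push_cast; rfl
        rw [this, norm_mul, norm_real, Real.norm_eq_abs]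
        simp [abs_of_pos Real.pi_pos]
      rw [norm_mul, h2] at h1
      rw [le_div_iff₀ (by positivity)]
      calc _ = |(m : ℝ) + n * x| ^ j * (2 * Real.pi * |(m : ℝ) + n * x| *
            ‖mode k m n g (Function.update v 1 x)‖) := by ring
        _ ≤ C := h1
  intro j
  obtain ⟨C, hC⟩ := key j f hf hi
  obtain ⟨D, hD⟩ := key 0 f hf hi
  refine ⟨2 ^ (j - 1) * (C + |(m : ℝ)| ^ j * D), fun x => ?_⟩
  set u := ‖mode k m n f (Function.update v 1 x)‖
  have hn1 : (1 : ℝ) ≤ |(n : ℝ)| := by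
    rw [← Int.cast_abs]
    exact_mod_cast Int.one_le_abs hn
  have h1 : |x| ≤ |(m : ℝ) + n * x| + |(m : ℝ)| := by
    have h2 := abs_sub ((m : ℝ) + n * x) m
    rw [add_sub_cancel_left, abs_mul] at h2
    nlinarith [abs_nonneg x]
  have h3 : |x| ^ j ≤ 2 ^ (j - 1) * (|(m : ℝ) + n * x| ^ j + |(m : ℝ)| ^ j) :=
    (pow_le_pow_left₀ (abs_nonneg x) h1 j).trans (add_pow_le (abs_nonneg _) (abs_nonneg _) j)
  have hD' := hD x
  rw [pow_zero, one_mul] at hD'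
  calc |x| ^ j * u ≤ 2 ^ (j - 1) * (|(m : ℝ) + n * x| ^ j + |(m : ℝ)| ^ j) * u := by
        gcongr
    _ = 2 ^ (j - 1) * (|(m : ℝ) + n * x| ^ j * u + |(m : ℝ)| ^ j * u) := by ring
    _ ≤ 2 ^ (j - 1) * (C + |(m : ℝ)| ^ j * D) := by
        gcongr
        exact hC x

/-- The integral of a function over `KT⁴`. -/
noncomputable def total (f : Cover → ℂ) : ℂ := proj 1 0 (mode 0 0 0 f) 0

theorem total_add (hf : ContDiff ℝ ∞ f) (hg : ContDiff ℝ ∞ g) :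
    total (fun v => f v + g v) = total f + total g := by
  rw [total, mode_add hf hg, proj_add (contDiff_mode hf _ _ _).continuous
    (contDiff_mode hg _ _ _).continuous]
  rfl

theorem total_const_mul (c : ℂ) : total (fun v => c * f v) = c * total f := by
  rw [total, mode_const_mul, proj_const_mul]
  rfl

/-- The frame fields preserve the volume. In the zero mode the derivatives in `t, y, z` carry the
factor frequency zero, and the `x`-derivative integrates to zero by the periodicity of the mean over
`z`. -/
theorem total_frameDeriv (hf : ContDiff ℝ ∞ f) (hi : Invariant f) (j : Fin 4) :
    total (frameDeriv j f) = 0 := by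
  have hz : ∀ c : ℂ, c = 0 → (fun v => c * mode 0 0 0 f v) = fun _ => 0 := by
    rintro _ rfl
    simp
  have h0 : ∀ {h : Cover → ℂ}, mode 0 0 0 h = (fun _ => 0) → total h = 0 := by
    intro h hh
    rw [total, hh, proj_zero]
  fin_cases j
  · exact h0 (by
      simp only [Fin.zero_eta]
      rw [frameDeriv_zero, mode_partialDeriv_zero hf hi, hz _ (by simp)])
  · simp only [Fin.mk_one]
    rw [frameDeriv_one, total, ← partialDeriv_mode hf,
      proj_partialDeriv_self (contDiff_mode hf _ _ _) (periodicIn_one_mode hi _ _)]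
    simp
  · exact h0 (by
      simp only [Fin.reduceFinMk]
      rw [mode_frameDeriv_two hf hi]
      simp)
  · exact h0 (by
      simp only [Fin.reduceFinMk]
      rw [frameDeriv_three, mode_partialDeriv_three hf hi, hz _ (by simp)])

theorem total_mul_frameDeriv (hf : ContDiff ℝ ∞ f) (hi : Invariant f) (hg : ContDiff ℝ ∞ g)
    (hgi : Invariant g) (j : Fin 4) :
    total (fun v => f v * frameDeriv j g v) = -total (fun v => frameDeriv j f v * g v) := by
  have h1 := total_frameDeriv (f := fun v => f v * g v) (hf.mul hg)
    (fun n v => by simp only [hi n v, hgi n v]) j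
  rw [frameDeriv_mul hf hg, total_add (hf.mul (contDiff_frameDeriv hg j))
    ((contDiff_frameDeriv hf j).mul hg)] at h1
  exact eq_neg_of_add_eq_zero_left h1

theorem eq_zero_of_total_ofReal {r : Cover → ℝ} (hr : Continuous r) (h0 : ∀ v, 0 ≤ r v)
    (hi : ∀ n v, r (deck n v) = r v) (h : total (fun v => (r v : ℂ)) = 0) : r = 0 := by
  funext v
  obtain ⟨n, w, hw, rfl⟩ := exists_deck_eq v
  rw [hi]
  simp only [total, mode, proj_ofReal] at h
  have n3 := mean_nonneg h0 3
  have n2 := mean_nonneg n3 2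
  have n0 := mean_nonneg n2 0
  have c3 := continuous_mean hr 3
  have c2 := continuous_mean c3 2
  have c0 := continuous_mean c2 0
  have h1 := eq_zero_of_mean_eq_zero c0 n0 1 (by exact_mod_cast h) (hw 1)
  have h2 := eq_zero_of_mean_eq_zero c2 n2 0 h1 (hw 0)
  have h3 := eq_zero_of_mean_eq_zero c3 n3 2 h2 (hw 2)
  have h4 := eq_zero_of_mean_eq_zero hr h0 3 h3 (hw 3)
  have hw' : w = 0 + w 1 • unitVec 1 + w 0 • unitVec 0 + w 2 • unitVec 2 + w 3 • unitVec 3 := by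
    ext i
    fin_cases i <;> simp
  rw [hw']
  exact h4

theorem eq_zero_of_total_mul_conj (hf : ContDiff ℝ ∞ f) (hi : Invariant f)
    (hg : ContDiff ℝ ∞ g) (hgi : Invariant g) {c d : ℝ} (hc : 0 < c) (hd : 0 < d)
    (h : (c : ℂ) * total (fun v => f v * (starRingEnd ℂ) (f v)) +
      d * total (fun v => g v * (starRingEnd ℂ) (g v)) = 0) : f = 0 ∧ g = 0 := by
  have h1 := eq_zero_of_total_ofReal (r := fun v => c * normSq (f v) + d * normSq (g v))
    (by
      have := hf.continuous
      have := hg.continuous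
      have := continuous_normSq
      fun_prop)
    (fun v => by have := normSq_nonneg (f v); have := normSq_nonneg (g v); positivity)
    (fun n v => by rw [hi, hgi]) (by
      rw [← h, ← total_const_mul, ← total_const_mul, ← total_add]
      · congr 1
        funext v
        push_cast
        rw [mul_conj, mul_conj]
      · exact contDiff_const.mul (hf.mul (contDiff_conj hf))
      · exact contDiff_const.mul (hg.mul (contDiff_conj hg)))
  constructor <;> funext v
  · have h2 := congrFun h1 v
    simp only [Pi.zero_apply] at h2
    have h3 := normSq_nonneg (f v)
    have h4 := normSq_nonneg (g v)
    exact normSq_eq_zero.1 (by nlinarith [mul_nonneg hc.le h3, mul_nonneg hd.le h4])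
  · have h2 := congrFun h1 v
    simp only [Pi.zero_apply] at h2
    have h3 := normSq_nonneg (f v)
    have h4 := normSq_nonneg (g v)
    exact normSq_eq_zero.1 (by nlinarith [mul_nonneg hc.le h3, mul_nonneg hd.le h4])

end functions

end KT

/-! ### The operators `∂̄` and `∂̄*` in the unitary coframe -/

namespace KT

open Complex

/-! ### Wedge products and types -/

theorem wedge_apply {k : ℕ} (θ : Fin k → Cover →L[ℝ] ℂ) (w : Fin k → Cover) :
    wedge θ w = Matrix.det (Matrix.of fun i j => θ j (w i)) := by
  rw [wedge, ContinuousMultilinearMap.alternatization_apply_apply, Matrix.det_apply]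
  rfl

theorem wedge_one_apply (θ : Cover →L[ℝ] ℂ) (w : Fin 1 → Cover) : wedge ![θ] w = θ (w 0) := by
  rw [wedge_apply, Matrix.det_fin_one]; rfl

theorem wedge_two_apply (θ η : Cover →L[ℝ] ℂ) (w : Fin 2 → Cover) :
    wedge ![θ, η] w = θ (w 0) * η (w 1) - η (w 0) * θ (w 1) := by
  rw [wedge_apply, Matrix.det_fin_two]; rfl

theorem wedge_three_apply (θ η ζ : Cover →L[ℝ] ℂ) (w : Fin 3 → Cover) :
    wedge ![θ, η, ζ] w = θ (w 0) * η (w 1) * ζ (w 2) - θ (w 0) * ζ (w 1) * η (w 2) -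
      η (w 0) * θ (w 1) * ζ (w 2) + η (w 0) * ζ (w 1) * θ (w 2) +
      ζ (w 0) * θ (w 1) * η (w 2) - ζ (w 0) * η (w 1) * θ (w 2) := by
  rw [wedge_apply, Matrix.det_fin_three]; rfl

/-- The rotation multiplies the columns of the determinant by the characters of the single factors,
so the weights add up. -/
theorem isType_wedge {j : Cover →L[ℝ] Cover} {p q k : ℕ} {θ : Fin k → Cover →L[ℝ] ℂ}
    (ε : Fin k → ℂ) (h : ∀ r (t : ℝ) u, θ r (rot j t u) = exp (I * ε r * t) * θ r u)
    (hε : ∑ r, ε r = p - q) : IsType j p q (wedge θ) := by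
  intro t
  ext w
  rw [ContinuousAlternatingMap.compContinuousLinearMap_apply, wedge_apply,
    ContinuousAlternatingMap.smul_apply, wedge_apply, smul_eq_mul]
  have h1 : (Matrix.of fun i r => θ r ((rot j t ∘ w) i)) =
      Matrix.of fun i r => exp (I * ε r * t) * (Matrix.of fun i r => θ r (w i)) i r := by
    ext i r
    exact h r t (w i)
  have h2 : exp (I * ((p : ℂ) - q) * t) = ∏ r, exp (I * ε r * t) := by
    rw [← exp_sum, ← hε, Finset.mul_sum, Finset.sum_mul]
  rw [h2, ← Matrix.det_mul_row, h1]

theorem isType_lin {j : Cover →L[ℝ] Cover} {p q k : ℕ} {α β : Alt k} (hα : IsType j p q α)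
    (hβ : IsType j p q β) (c : ℂ) : IsType j p q (α + c • β) := by
  intro θ
  ext w
  have h1 := DFunLike.congr_fun (hα θ) w
  have h2 := DFunLike.congr_fun (hβ θ) w
  refine (congrArg₂ (fun x y : ℂ => x + c * y) h1 h2).trans ?_
  simp only [ContinuousAlternatingMap.add_apply, ContinuousAlternatingMap.smul_apply, smul_eq_mul]
  ring

theorem isType_zero (j : Cover →L[ℝ] Cover) (p q k : ℕ) : IsType j p q (0 : Alt k) :=
  fun _ => (smul_zero (M := ℂ) (A := Alt k) _).symm

theorem isType_smul {j : Cover →L[ℝ] Cover} {p q k : ℕ} {β : Alt k}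
    (hβ : IsType j p q β) (c : ℂ) : IsType j p q (c • β) := by
  have := isType_lin (isType_zero j p q k) hβ c
  rwa [zero_add] at this

theorem isType_add {j : Cover →L[ℝ] Cover} {p q k : ℕ} {α β : Alt k} (hα : IsType j p q α)
    (hβ : IsType j p q β) : IsType j p q (α + β) := by
  have := isType_lin hα hβ 1
  rwa [one_smul] at this

theorem typeProj_add (j : Cover →L[ℝ] Cover) (p q : ℕ) {k : ℕ} (α β : Alt k) :
    typeProj j p q (α + β) = typeProj j p q α + typeProj j p q β := by
  have := typeProj_lin j p q α β 1
  rwa [one_smul, one_smul] at this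

theorem phi1_apply (v u : Cover) : phi1 v u = u 0 + I * u 1 := by
  simp [phi1, coframe]

theorem conj_phi1_apply (v u : Cover) : conjForm (phi1 v) u = u 0 - I * u 1 := by
  simp [conjForm, phi1, coframe, sub_eq_add_neg]

theorem phi2_apply (a b : ℝ) (v u : Cover) :
    phi2 a b v u = (1 - a * I) * u 2 - I * b * (u 3 - v 1 * u 2) := by
  simp [phi2, coframe]

theorem conj_phi2_apply (a b : ℝ) (v u : Cover) :
    conjForm (phi2 a b v) u = (1 + a * I) * u 2 + I * b * (u 3 - v 1 * u 2) := by
  simp [conjForm, phi2, coframe]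

theorem phi1_rot (a b : ℝ) (v : Cover) (t : ℝ) (u : Cover) :
    phi1 v (rot (J a b v) t u) = exp (I * 1 * t) * phi1 v u := by
  have h : rot (J a b v) t u = Real.cos t • u + Real.sin t • J a b v u := rfl
  rw [h, map_add, map_smul, map_smul, phi1_J, mul_one, mul_comm I (t : ℂ), exp_mul_I]
  simp only [real_smul, ofReal_cos, ofReal_sin]
  ring

theorem phi2_rot {a b : ℝ} (hb : b ≠ 0) (v : Cover) (t : ℝ) (u : Cover) :
    phi2 a b v (rot (J a b v) t u) = exp (I * 1 * t) * phi2 a b v u := by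
  have h : rot (J a b v) t u = Real.cos t • u + Real.sin t • J a b v u := rfl
  rw [h, map_add, map_smul, map_smul, phi2_J hb, mul_one, mul_comm I (t : ℂ), exp_mul_I]
  simp only [real_smul, ofReal_cos, ofReal_sin]
  ring

theorem conjForm_rot {θ : Cover →L[ℝ] ℂ} {j : Cover →L[ℝ] Cover} {t : ℝ} {u : Cover}
    (h : θ (rot j t u) = exp (I * 1 * t) * θ u) :
    conjForm θ (rot j t u) = exp (I * (-1) * t) * conjForm θ u := by
  change (starRingEnd ℂ) (θ (rot j t u)) = _ * (starRingEnd ℂ) (θ u)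
  rw [h, map_mul, ← exp_conj]
  simp

/-- The forms `φ₁, φ₂, φ̄₁, φ̄₂`. -/
noncomputable def phis (a b : ℝ) (v : Cover) : Fin 4 → Cover →L[ℝ] ℂ :=
  ![phi1 v, phi2 a b v, conjForm (phi1 v), conjForm (phi2 a b v)]

theorem phis_rot {a b : ℝ} (hb : b ≠ 0) (v : Cover) (i : Fin 4) (t : ℝ) (u : Cover) :
    phis a b v i (rot (J a b v) t u) =
      exp (I * (![1, 1, -1, -1] : Fin 4 → ℂ) i * t) * phis a b v i u := by
  fin_cases i
  · exact phi1_rot a b v t u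
  · exact phi2_rot hb v t u
  · exact conjForm_rot (phi1_rot a b v t u)
  · exact conjForm_rot (phi2_rot hb v t u)

theorem isType_wedge_phis {a b : ℝ} (hb : b ≠ 0) (v : Cover) {k : ℕ} (i : Fin k → Fin 4) {p q : ℕ}
    (h : ∑ r, (![1, 1, -1, -1] : Fin 4 → ℂ) (i r) = p - q) :
    IsType (J a b v) p q (wedge fun r => phis a b v (i r)) :=
  isType_wedge (fun r => (![1, 1, -1, -1] : Fin 4 → ℂ) (i r)) (fun r => phis_rot hb v (i r)) h

/-! ### The orthonormal frame -/

theorem fin_fun_sum {n : ℕ} {M : Type*} [AddCommMonoid M] (F : (Fin (n + 1) → Fin 4) → M) :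
    ∑ i, F i = ∑ a : Fin 4, ∑ i : Fin n → Fin 4, F (Fin.cons a i) := by
  rw [← (Fin.consEquiv fun _ : Fin (n + 1) => Fin 4).sum_comp, Fintype.sum_prod_type]
  rfl

theorem phi1_unitaryFrame (a b : ℝ) (v : Cover) (i : Fin 4) :
    phi1 v (unitaryFrame a b v i) = (![1, I, 0, 0] : Fin 4 → ℂ) i := by
  rw [phi1_apply]
  fin_cases i <;> simp [unitaryFrame, frame]

theorem conj_phi1_unitaryFrame (a b : ℝ) (v : Cover) (i : Fin 4) :
    conjForm (phi1 v) (unitaryFrame a b v i) = (![1, -I, 0, 0] : Fin 4 → ℂ) i := by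
  rw [conj_phi1_apply]
  fin_cases i <;> simp [unitaryFrame, frame]

theorem phi2_unitaryFrame {a b : ℝ} (hb : b ≠ 0) (v : Cover) (i : Fin 4) :
    phi2 a b v (unitaryFrame a b v i) = (![0, 0, 1, I] : Fin 4 → ℂ) i := by
  have hb' : (b : ℂ) ≠ 0 := by exact_mod_cast hb
  rw [phi2_apply]
  fin_cases i <;> simp [unitaryFrame, frame] <;> field_simp <;> ring

theorem conj_phi2_unitaryFrame {a b : ℝ} (hb : b ≠ 0) (v : Cover) (i : Fin 4) :
    conjForm (phi2 a b v) (unitaryFrame a b v i) = (![0, 0, 1, -I] : Fin 4 → ℂ) i := by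
  have hb' : (b : ℂ) ≠ 0 := by exact_mod_cast hb
  rw [conj_phi2_apply]
  fin_cases i <;> simp [unitaryFrame, frame] <;> field_simp <;> ring

theorem vol_apply (a b : ℝ) (v : Cover) (w : Fin 4 → Cover) :
    vol a b v w = (I / 2) ^ 2 * Matrix.det (Matrix.of fun i j =>
      (![phi1 v, conjForm (phi1 v), phi2 a b v, conjForm (phi2 a b v)] : Fin 4 → Cover →L[ℝ] ℂ) j
        (w i)) := by
  rw [vol, ContinuousAlternatingMap.smul_apply, wedge_apply, smul_eq_mul]

/-- The volume form is a constant multiple of the determinant. -/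
theorem vol_eq_det (a b : ℝ) (v : Cover) (w : Fin 4 → Cover) :
    vol a b v w = -b * ((Matrix.of w).det : ℝ) := by
  rw [vol_apply]
  simp only [Matrix.det_succ_row_zero, Fin.sum_univ_succ, Matrix.of_apply, Matrix.submatrix_apply]
  simp [Fin.succAbove, phi1_apply, conj_phi1_apply, phi2_apply, conj_phi2_apply]
  ring_nf
  simp

end KT

namespace KT

open Complex

/-! ### The Hodge star in the orthonormal frame -/

theorem alt_four_apply (β : Alt 4) (w : Fin 4 → Cover) :
    β w = ((Matrix.of w).det : ℝ) * β unitVec := by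
  let γ : Cover [⋀^Fin 4]→ₗ[ℝ] ℂ :=
    (LinearMap.toSpanSingleton ℝ ℂ (β unitVec)).compAlternatingMap
      (Matrix.detRowAlternating (R := ℝ) (n := Fin 4))
  have h : β.toAlternatingMap = γ := by
    refine (Pi.basisFun ℝ (Fin 4)).ext_alternating fun i hi => ?_
    let σ : Equiv.Perm (Fin 4) := Equiv.ofBijective i (Finite.injective_iff_bijective.1 hi)
    have e1 : (fun r => (Pi.basisFun ℝ (Fin 4)) (i r)) = (unitVec : Fin 4 → Cover) ∘ σ := by
      funext r
      simp [σ]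
    rw [e1, AlternatingMap.map_perm, AlternatingMap.map_perm]
    congr 1
    have h1 : Matrix.detRowAlternating (R := ℝ) (n := Fin 4) unitVec = 1 := by
      have : (unitVec : Fin 4 → Cover) = (1 : Matrix (Fin 4) (Fin 4) ℝ) := by
        ext r s
        simp [Matrix.one_apply, Pi.single_apply, eq_comm]
      rw [this]
      exact Matrix.det_one
    change β unitVec = Matrix.detRowAlternating (R := ℝ) (n := Fin 4) unitVec • β unitVec
    rw [h1, one_smul]
  have h2 := DFunLike.congr_fun h w
  change β w = (Matrix.of w).det • β unitVec at h2
  rw [h2, real_smul]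

theorem det_unitaryFrame {a b : ℝ} (v : Cover) :
    (Matrix.of (unitaryFrame a b v)).det = -(1 / b) := by
  simp only [Matrix.det_succ_row_zero, Fin.sum_univ_succ, Matrix.of_apply, Matrix.submatrix_apply]
  simp [Fin.succAbove, unitaryFrame, frame]

theorem vol_unitaryFrame {a b : ℝ} (hb : b ≠ 0) (v : Cover) :
    vol a b v (unitaryFrame a b v) = 1 := by
  have hb' : (b : ℂ) ≠ 0 := by exact_mod_cast hb
  rw [vol_eq_det, det_unitaryFrame]
  push_cast
  field_simp

theorem hodge1_apply (a b : ℝ) (α : Form 1) (v : Cover) (u : Fin 3 → Cover) :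
    hodge1 a b α v u = ∑ i, α v (fun _ => unitaryFrame a b v i) *
      vol a b v (Matrix.vecCons (unitaryFrame a b v i) u) := by
  simp only [hodge1, star, Nat.factorial_one, Nat.cast_one, inv_one, one_smul]
  rw [ContinuousAlternatingMap.sum_apply, fin_fun_sum]
  refine Finset.sum_congr rfl fun i _ => ?_
  rw [Fintype.sum_unique, ContinuousAlternatingMap.smul_apply, smul_eq_mul]
  congr 1
  congr 1
  funext r
  rw [Subsingleton.elim r 0]
  rfl

theorem card_injective_fin_four :
    (Finset.univ.filter fun i : Fin 4 → Fin 4 => Function.Injective i).card = 24 := by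
  have h := Fintype.card_congr (Equiv.subtypeInjectiveEquivEmbedding (Fin 4) (Fin 4))
  rw [Fintype.card_embedding_eq, Fintype.card_subtype] at h
  rw [h]
  rfl

/-- In the sum only permutations of the frame survive. For each of them the sign occurs twice and
cancels, so `4!` equal terms remain. -/
theorem hodge4_apply {a b : ℝ} (hb : b ≠ 0) (β : Form 4) (v : Cover) (u : Fin 0 → Cover) :
    hodge4 a b β v u = β v (unitaryFrame a b v) := by
  classical
  set e := unitaryFrame a b v
  have hc : ∀ i : Fin 4 → Fin 4, contract (l := 0) 4 (e ∘ i) (vol a b v) u = vol a b v (e ∘ i) := by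
    intro i
    change vol a b v _ = _
    congr 1
    ext r
    fin_cases r <;> rfl
  have key : ∀ i : Fin 4 → Fin 4, β v (e ∘ i) * vol a b v (e ∘ i) =
      if Function.Injective i then β v e else 0 := by
    intro i
    split_ifs with hi
    · let σ : Equiv.Perm (Fin 4) := Equiv.ofBijective i (Finite.injective_iff_bijective.1 hi)
      have h1 : ∀ γ : Alt 4, γ (e ∘ i) = (Equiv.Perm.sign σ : ℤ) * γ e := by
        intro γ
        have := γ.toAlternatingMap.map_perm e σ
        change γ (e ∘ i) = _ at this
        rw [this, Units.smul_def, zsmul_eq_mul]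
        rfl
      have h2 : ((Equiv.Perm.sign σ : ℤ) : ℂ) * (Equiv.Perm.sign σ : ℤ) = 1 := by
        exact_mod_cast Int.units_coe_mul_self (Equiv.Perm.sign σ)
      rw [h1, h1, vol_unitaryFrame hb]
      linear_combination β v e * h2
    · simp only [Function.Injective, not_forall] at hi
      obtain ⟨r, s, hrs, hne⟩ := hi
      rw [(β v).map_eq_zero_of_eq (e ∘ i) (i := r) (j := s)
        (by simp only [Function.comp_apply, hrs]) hne, zero_mul]
  simp only [hodge4, star]
  rw [ContinuousAlternatingMap.smul_apply, ContinuousAlternatingMap.sum_apply]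
  simp only [ContinuousAlternatingMap.smul_apply, smul_eq_mul]
  have h3 : ∀ i : Fin 4 → Fin (0 + 4), β v (unitaryFrame a b v ∘ i) *
      contract (l := 0) 4 (unitaryFrame a b v ∘ i) (vol a b v) u =
      if Function.Injective i then β v e else 0 := fun i => by
    rw [← key i]
    exact congrArg _ (hc i)
  simp_rw [h3]
  have h4 : ∑ i : Fin 4 → Fin 4, (if Function.Injective i then β v e else 0) = 24 * β v e := by
    rw [← Finset.sum_filter, Finset.sum_const, card_injective_fin_four]
    simp
  refine (congrArg (((Nat.factorial 4 : ℕ) : ℂ)⁻¹ * ·) h4).trans ?_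
  simp [Nat.factorial]

/-- Every form of top degree has type `(2,2)`. -/
theorem isType_two_two {a b : ℝ} (hb : b ≠ 0) (v : Cover) (β : Alt 4) :
    IsType (J a b v) 2 2 β := by
  have hb' : (b : ℂ) ≠ 0 := by exact_mod_cast hb
  have h1 : β = (β unitVec / (-b)) • vol a b v := by
    ext w
    rw [ContinuousAlternatingMap.smul_apply, vol_eq_det, alt_four_apply, smul_eq_mul]
    field_simp
  rw [h1, vol]
  refine isType_smul (isType_smul ?_ _) _
  have h2 : ![phi1 v, conjForm (phi1 v), phi2 a b v, conjForm (phi2 a b v)] =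
      fun r => phis a b v ((![0, 2, 1, 3] : Fin 4 → Fin 4) r) := by
    funext r
    fin_cases r <;> rfl
  rw [h2]
  refine isType_wedge_phis hb v _ ?_
  simp [Fin.sum_univ_four]

theorem del_three_form {a b : ℝ} (hb : b ≠ 0) (β : Form 3) : del a b 1 2 β = extDeriv β := by
  funext v
  rw [del, typeProj_of_isType (J a b v) (p := 2) (q := 2) (p' := 2) (q' := 2) rfl rfl
    (isType_two_two hb v _), if_pos rfl]

/-- The components of the vector field dual to a one-form. -/
noncomputable def dualField (a b : ℝ) (α : Form 1) (i : Fin 4) (v : Cover) : ℂ :=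
  ∑ j, α v (fun _ => unitaryFrame a b v j) * unitaryFrame a b v j i

theorem det_vecCons_removeNth (i : Fin 4) (w : Cover) :
    (Matrix.of (Matrix.vecCons w (i.removeNth (unitVec : Fin 4 → Cover)))).det =
      (-1) ^ (i : ℕ) * w i := by
  have h1 := (Matrix.detRowAlternating (R := ℝ) (n := Fin 4)).neg_one_pow_smul_map_insertNth i w
    (i.removeNth (unitVec : Fin 4 → Cover))
  have h2 : (i.insertNth w (i.removeNth (unitVec : Fin 4 → Cover)) : Fin 4 → Cover) =
      (1 : Matrix (Fin 4) (Fin 4) ℝ).updateRow i w := by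
    have : (unitVec : Fin 4 → Cover) = (1 : Matrix (Fin 4) (Fin 4) ℝ) := by
      ext r s
      simp [Matrix.one_apply, Pi.single_apply, eq_comm]
    rw [Fin.insertNth_removeNth, this]
    rfl
  rw [h2] at h1
  have h3 : ((1 : Matrix (Fin 4) (Fin 4) ℝ).updateRow i w).det = w i := by
    rw [← Matrix.cramer_transpose_apply, Matrix.transpose_one, Matrix.cramer_one]
    rfl
  refine h1.symm.trans ((congrArg (fun x : ℝ => (-1 : ℤ) ^ (i : ℕ) • x) h3).trans ?_)
  rw [zsmul_eq_mul]
  push_cast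
  rfl

/-- The star of a one-form is the contraction of the volume form with the dual field, and the volume
form is `-b` times the coordinate determinant. -/
theorem hodge1_removeNth (a b : ℝ) (α : Form 1) (i : Fin 4) (v : Cover) :
    hodge1 a b α v (i.removeNth unitVec) = (-b) * (-1) ^ (i : ℕ) * dualField a b α i v := by
  rw [hodge1_apply, dualField, Finset.mul_sum]
  refine Finset.sum_congr rfl fun j _ => ?_
  rw [vol_eq_det]
  have h : (Matrix.of (Matrix.vecCons (unitaryFrame a b v j)
      (i.removeNth (unitVec : Fin 4 → Cover)))).det = (-1) ^ (i : ℕ) * unitaryFrame a b v j i := by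
    exact det_vecCons_removeNth i _
  rw [h]
  push_cast
  ring

theorem contDiff_dualField (a b : ℝ) {α : Form 1} (hα : ContDiff ℝ ∞ α) (i : Fin 4) :
    ContDiff ℝ ∞ (dualField a b α i) := by
  refine ContDiff.sum fun j _ => ContDiff.mul ?_ ?_
  · exact contDiff_apply_vec (w := fun v _ => unitaryFrame a b v j) hα
      fun _ => contDiff_unitaryFrame a b j
  · exact ofRealCLM.contDiff.comp ((contDiff_apply ℝ ℝ i).comp (contDiff_unitaryFrame a b j))

/-- On three-forms the `(2,2)`-component of `d` is all of `d`, so this is minus a divergence. Since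
the volume form has constant coefficients in the coordinates, the divergence is the plain sum of
partial derivatives. -/
theorem dbarStar01_apply {a b : ℝ} (hb : b ≠ 0) {α : Form 1} (hα : ContDiff ℝ ∞ α) (v : Cover)
    (u : Fin 0 → Cover) :
    dbarStar01 a b α v u = -∑ i, partialDeriv i (dualField a b α i) v := by
  have hb' : (b : ℂ) ≠ 0 := by exact_mod_cast hb
  have hd : DifferentiableAt ℝ (hodge1 a b α) v :=
    (contDiff_hodge1 a b hα).differentiable (by simp) v
  have h1 : extDeriv (hodge1 a b α) v unitVec =
      -b * ∑ i, partialDeriv i (dualField a b α i) v := by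
    rw [extDeriv_apply hd, Finset.mul_sum]
    refine Finset.sum_congr rfl fun i _ => ?_
    have h2 : (fun y => hodge1 a b α y (i.removeNth unitVec)) =
        fun y => (-b) * (-1) ^ (i : ℕ) * dualField a b α i y :=
      funext fun y => hodge1_removeNth a b α i y
    have h3 : DifferentiableAt ℝ (dualField a b α i) v :=
      (contDiff_dualField a b hα i).differentiable (by simp) v
    rw [h2, fderiv_const_mul h3]
    have h4 : ((-1 : ℂ) ^ (i : ℕ)) * (-1) ^ (i : ℕ) = 1 := by
      rw [← mul_pow]; norm_num
    simp only [partialDeriv, zsmul_eq_mul, _root_.smul_apply, smul_eq_mul]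
    push_cast
    linear_combination (-(b : ℂ) * fderiv ℝ (dualField a b α i) v (unitVec i)) * h4
  change -(hodge4 a b (del a b 1 2 (hodge1 a b α)) v u) = _
  rw [hodge4_apply hb, del_three_form hb, alt_four_apply, det_unitaryFrame, h1]
  push_cast
  field_simp

end KT

namespace KT

open Complex

/-! ### Complex directional derivatives -/

/-- The derivative along the complex vector field with constant components in the frame. -/
noncomputable def dirDeriv (c : Fin 4 → ℂ) (f : Cover → ℂ) (v : Cover) : ℂ :=
  ∑ j, c j * frameDeriv j f v

/-- The vector field dual to `φ₁`. -/
noncomputable def V1 : Fin 4 → ℂ := ![1 / 2, -I / 2, 0, 0]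

/-- The vector field dual to `φ̄₁`. -/
noncomputable def V1bar : Fin 4 → ℂ := ![1 / 2, I / 2, 0, 0]

/-- The vector field dual to `φ₂`. -/
noncomputable def V2 (a b : ℝ) : Fin 4 → ℂ := ![0, 0, 1 / 2, -(a - I) / (2 * b)]

/-- The vector field dual to `φ̄₂`. -/
noncomputable def V2bar (a b : ℝ) : Fin 4 → ℂ := ![0, 0, 1 / 2, -(a + I) / (2 * b)]

theorem contDiff_dirDeriv {f : Cover → ℂ} (hf : ContDiff ℝ ∞ f) (c : Fin 4 → ℂ) :
    ContDiff ℝ ∞ (dirDeriv c f) :=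
  ContDiff.sum fun j _ => contDiff_const.mul (contDiff_frameDeriv hf j)

theorem fderiv_apply_eq {a b : ℝ} (hb : b ≠ 0) (f : Cover → ℂ) (v u : Cover) :
    fderiv ℝ f v u = dirDeriv V1 f v * phi1 v u + dirDeriv (V2 a b) f v * phi2 a b v u +
      dirDeriv V1bar f v * conjForm (phi1 v) u +
      dirDeriv (V2bar a b) f v * conjForm (phi2 a b v) u := by
  have hb' : (b : ℂ) ≠ 0 := by exact_mod_cast hb
  have hu : u = u 0 • frame v 0 + u 1 • frame v 1 + u 2 • frame v 2 +
      (u 3 - v 1 * u 2) • frame v 3 := by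
    ext i
    fin_cases i <;> simp [frame]
    ring
  conv_lhs => rw [hu]
  simp only [map_add, map_smul, real_smul, dirDeriv, Fin.sum_univ_four, V1, V1bar, V2, V2bar,
    phi1_apply, conj_phi1_apply, phi2_apply, conj_phi2_apply, frameDeriv]
  simp
  field_simp
  ring_nf
  simp only [I_sq]
  ring

/-! ### Forms of type `(0,1)` and `(0,2)` -/

/-- The form `f φ̄₁ + g φ̄₂`. -/
noncomputable def form01 (a b : ℝ) (f g : Cover → ℂ) : Form 1 := fun v =>
  f v • wedge ![conjForm (phi1 v)] + g v • wedge ![conjForm (phi2 a b v)]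

/-- The form `h φ̄₁ ∧ φ̄₂`. -/
noncomputable def form02 (a b : ℝ) (h : Cover → ℂ) : Form 2 := fun v =>
  h v • wedge ![conjForm (phi1 v), conjForm (phi2 a b v)]

theorem form01_apply (a b : ℝ) (f g : Cover → ℂ) (v : Cover) (w : Fin 1 → Cover) :
    form01 a b f g v w = f v * (w 0 0 - I * w 0 1) +
      g v * ((1 + a * I) * w 0 2 + I * b * (w 0 3 - v 1 * w 0 2)) := by
  rw [form01, ContinuousAlternatingMap.add_apply, ContinuousAlternatingMap.smul_apply,
    ContinuousAlternatingMap.smul_apply, wedge_one_apply, wedge_one_apply, conj_phi1_apply,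
    conj_phi2_apply, smul_eq_mul, smul_eq_mul]

theorem form02_apply (a b : ℝ) (h : Cover → ℂ) (v : Cover) (w : Fin 2 → Cover) :
    form02 a b h v w = h v * ((w 0 0 - I * w 0 1) *
        ((1 + a * I) * w 1 2 + I * b * (w 1 3 - v 1 * w 1 2)) -
      ((1 + a * I) * w 0 2 + I * b * (w 0 3 - v 1 * w 0 2)) * (w 1 0 - I * w 1 1)) := by
  rw [form02, ContinuousAlternatingMap.smul_apply, wedge_two_apply]
  simp only [conj_phi1_apply, conj_phi2_apply, smul_eq_mul]

theorem contDiff_form01 (a b : ℝ) {f g : Cover → ℂ} (hf : ContDiff ℝ ∞ f) (hg : ContDiff ℝ ∞ g) :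
    ContDiff ℝ ∞ (form01 a b f g) := by
  refine contDiff_of_apply fun w => ?_
  simp_rw [form01_apply]
  have h1 : ContDiff ℝ ∞ fun v : Cover => (v 1 : ℂ) := ofRealCLM.contDiff.comp (contDiff_coord 1)
  exact (hf.mul contDiff_const).add (hg.mul (contDiff_const.add
    (contDiff_const.mul (contDiff_const.sub (h1.mul contDiff_const)))))

theorem contDiff_form02 (a b : ℝ) {h : Cover → ℂ} (hh : ContDiff ℝ ∞ h) :
    ContDiff ℝ ∞ (form02 a b h) := by
  refine contDiff_of_apply fun w => ?_
  simp_rw [form02_apply]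
  have h1 : ContDiff ℝ ∞ fun v : Cover => (v 1 : ℂ) := ofRealCLM.contDiff.comp (contDiff_coord 1)
  have h2 : ∀ x : Cover, ContDiff ℝ ∞ fun v : Cover =>
      ((1 + a * I) * x 2 + I * b * (x 3 - v 1 * x 2) : ℂ) := fun x =>
    contDiff_const.add (contDiff_const.mul (contDiff_const.sub (h1.mul contDiff_const)))
  exact hh.mul ((contDiff_const.mul (h2 _)).sub ((h2 _).mul contDiff_const))

theorem isType_form01 {a b : ℝ} (hb : b ≠ 0) (f g : Cover → ℂ) (v : Cover) :
    IsType (J a b v) 0 1 (form01 a b f g v) := by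
  refine isType_add (isType_smul ?_ _) (isType_smul ?_ _)
  · exact isType_wedge (fun _ => -1)
      (fun r t u => by fin_cases r; exact conjForm_rot (phi1_rot a b v t u)) (by simp)
  · exact isType_wedge (fun _ => -1)
      (fun r t u => by fin_cases r; exact conjForm_rot (phi2_rot hb v t u)) (by simp)

theorem typeProj_one_form {a b : ℝ} (hb : b ≠ 0) (v : Cover) {β : Alt 1} {p q r s : ℂ}
    (h : ∀ w : Fin 1 → Cover, β w = p * phi1 v (w 0) + q * phi2 a b v (w 0) +
      r * conjForm (phi1 v) (w 0) + s * conjForm (phi2 a b v) (w 0)) :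
    typeProj (J a b v) 0 1 β =
      r • wedge ![conjForm (phi1 v)] + s • wedge ![conjForm (phi2 a b v)] := by
  have hβ : β = (p • wedge ![phi1 v] + q • wedge ![phi2 a b v]) +
      (r • wedge ![conjForm (phi1 v)] + s • wedge ![conjForm (phi2 a b v)]) := by
    ext w
    rw [h]
    simp only [ContinuousAlternatingMap.add_apply, ContinuousAlternatingMap.smul_apply,
      wedge_one_apply, smul_eq_mul]
    ring
  have t1 : IsType (J a b v) 1 0 (p • wedge ![phi1 v] + q • wedge ![phi2 a b v]) := by
    refine isType_add (isType_smul ?_ _) (isType_smul ?_ _)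
    · exact isType_wedge (fun _ => 1)
        (fun r t u => by fin_cases r; exact phi1_rot a b v t u) (by simp)
    · exact isType_wedge (fun _ => 1)
        (fun r t u => by fin_cases r; exact phi2_rot hb v t u) (by simp)
  have t2 : IsType (J a b v) 0 1
      (r • wedge ![conjForm (phi1 v)] + s • wedge ![conjForm (phi2 a b v)]) :=
    isType_form01 hb (fun _ => r) (fun _ => s) v
  rw [hβ, typeProj_add, typeProj_of_isType (J a b v) (p := 0) (q := 1) (by norm_num) (by norm_num) t1,
    typeProj_of_isType (J a b v) (p := 0) (q := 1) (by norm_num) (by norm_num) t2]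
  simp

theorem dbar_function {a b : ℝ} (hb : b ≠ 0) {F : Form 0} {F₀ : Cover → ℂ}
    (hF : ∀ v u, F v u = F₀ v) (hd : ContDiff ℝ ∞ F) :
    dbar a b 0 0 F = form01 a b (dirDeriv V1bar F₀) (dirDeriv (V2bar a b) F₀) := by
  funext v
  rw [dbar, form01]
  refine typeProj_one_form hb v (p := dirDeriv V1 F₀ v) (q := dirDeriv (V2 a b) F₀ v) fun w => ?_
  rw [extDeriv_apply (hd.differentiable (by simp) v), ← fderiv_apply_eq hb]
  simp [hF]

theorem typeProj_two_form {a b : ℝ} (hb : b ≠ 0) (v : Cover) {β : Alt 2} (c : Fin 6 → ℂ)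
    (h : β = c 0 • wedge ![phi1 v, phi2 a b v] + (c 1 • wedge ![phi1 v, conjForm (phi1 v)] +
      c 2 • wedge ![phi1 v, conjForm (phi2 a b v)] + c 3 • wedge ![phi2 a b v, conjForm (phi1 v)] +
      c 4 • wedge ![phi2 a b v, conjForm (phi2 a b v)]) +
      c 5 • wedge ![conjForm (phi1 v), conjForm (phi2 a b v)]) :
    typeProj (J a b v) 0 2 β = c 5 • wedge ![conjForm (phi1 v), conjForm (phi2 a b v)] := by
  have t : ∀ (i j : Fin 4) {p q : ℕ}, (![1, 1, -1, -1] : Fin 4 → ℂ) i +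
      (![1, 1, -1, -1] : Fin 4 → ℂ) j = p - q →
      IsType (J a b v) p q (wedge ![phis a b v i, phis a b v j]) := by
    intro i j p q hpq
    have := isType_wedge_phis (a := a) hb v (![i, j] : Fin 2 → Fin 4) (p := p) (q := q)
      (by simpa [Fin.sum_univ_two] using hpq)
    convert this using 2
    funext r
    fin_cases r <;> rfl
  have t20 := isType_smul (t 0 1 (p := 2) (q := 0) (by norm_num)) (c 0)
  have t02 := isType_smul (t 2 3 (p := 0) (q := 2) (by simp; norm_num)) (c 5)
  have t11 := isType_add (isType_add (isType_add
    (isType_smul (t 0 2 (p := 1) (q := 1) (by simp)) (c 1))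
    (isType_smul (t 0 3 (p := 1) (q := 1) (by simp)) (c 2)))
    (isType_smul (t 1 2 (p := 1) (q := 1) (by simp)) (c 3)))
    (isType_smul (t 1 3 (p := 1) (q := 1) (by simp)) (c 4))
  have e20 := typeProj_of_isType (J a b v) (p := 0) (q := 2) (by norm_num) (by norm_num) t20
  have e11 := typeProj_of_isType (J a b v) (p := 0) (q := 2) (by norm_num) (by norm_num) t11
  have e02 := typeProj_of_isType (J a b v) (p := 0) (q := 2) (by norm_num) (by norm_num) t02
  simp only [phis, Matrix.cons_val] at e20 e11 e02
  rw [h, typeProj_add, typeProj_add, e20, e11, e02]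
  simp

/-- The coefficient of `∂̄ (f φ̄₁ + g φ̄₂)`. -/
noncomputable def dbarCoeff (a b : ℝ) (f g : Cover → ℂ) (v : Cover) : ℂ :=
  dirDeriv V1bar g v - dirDeriv (V2bar a b) f v + b / 4 * g v

theorem hasFDerivAt_conj_phi2 (a b : ℝ) (v x : Cover) :
    HasFDerivAt (fun y : Cover => (1 + a * I) * x 2 + I * b * (x 3 - y 1 * x 2) : Cover → ℂ)
      ((-(I * b * x 2)) • ofRealCLM.comp
        (ContinuousLinearMap.proj (R := ℝ) (φ := fun _ : Fin 4 => ℝ) 1)) v := by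
  have h1 := (ofRealCLM.comp (ContinuousLinearMap.proj (R := ℝ)
    (φ := fun _ : Fin 4 => ℝ) 1)).hasFDerivAt (x := v)
  have h2 := ((h1.mul_const (x 2 : ℂ)).const_sub (x 3 : ℂ)).const_mul (I * b)
  refine (h2.const_add ((1 + a * I) * x 2)).congr_fderiv ?_
  ext w
  simp
  ring

theorem extDeriv_form01 {a b : ℝ} {f g : Cover → ℂ} (hf : ContDiff ℝ ∞ f)
    (hg : ContDiff ℝ ∞ g) (v : Cover) (w : Fin 2 → Cover) :
    extDeriv (form01 a b f g) v w =
      fderiv ℝ f v (w 0) * conjForm (phi1 v) (w 1) - fderiv ℝ f v (w 1) * conjForm (phi1 v) (w 0) +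
      (fderiv ℝ g v (w 0) * conjForm (phi2 a b v) (w 1) -
        fderiv ℝ g v (w 1) * conjForm (phi2 a b v) (w 0)) -
      I * b * g v * (w 0 1 * w 1 2 - w 1 1 * w 0 2) := by
  have hdf : DifferentiableAt ℝ f v := hf.differentiable (by simp) v
  have hdg : DifferentiableAt ℝ g v := hg.differentiable (by simp) v
  have hd : DifferentiableAt ℝ (form01 a b f g) v :=
    (contDiff_form01 a b hf hg).differentiable (by simp) v
  have key : ∀ x u : Cover, fderiv ℝ (fun y => form01 a b f g y (fun _ => x)) v u =
      fderiv ℝ f v u * conjForm (phi1 v) x + fderiv ℝ g v u * conjForm (phi2 a b v) x -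
        I * b * g v * (u 1 * x 2) := by
    intro x u
    simp_rw [form01_apply]
    have h1 := (hdf.hasFDerivAt.mul_const ((x 0 : ℂ) - I * x 1)).add
      (hdg.hasFDerivAt.mul (hasFDerivAt_conj_phi2 a b v x))
    have h2 : fderiv ℝ (fun y => f y * ((x 0 : ℂ) - I * x 1) +
      g y * ((1 + a * I) * x 2 + I * b * (x 3 - y 1 * x 2))) v = _ := h1.fderiv
    rw [h2, conj_phi1_apply, conj_phi2_apply]
    simp
    ring
  rw [extDeriv_apply hd, Fin.sum_univ_two]
  have e0 : (Fin.removeNth 0 w) = fun _ => w 1 := by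
    funext r; rw [Subsingleton.elim r 0]; rfl
  have e1 : (Fin.removeNth 1 w) = fun _ => w 0 := by
    funext r; rw [Subsingleton.elim r 0]; rfl
  rw [e0, e1, key, key]
  simp
  ring

theorem dbar_form01 {a b : ℝ} (hb : b ≠ 0) {f g : Cover → ℂ} (hf : ContDiff ℝ ∞ f)
    (hg : ContDiff ℝ ∞ g) :
    dbar a b 0 1 (form01 a b f g) = form02 a b (dbarCoeff a b f g) := by
  funext v
  rw [dbar, form02]
  -- The terms `b / 4` come from `dφ̄₂ = -i b dx ∧ dy`, with `dx = (φ₁ - φ̄₁)/(2i)` and `dy = (φ₂ +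
  -- φ̄₂)/2`.
  refine typeProj_two_form hb v ![-(b / 4 * g v), dirDeriv V1 f v,
    dirDeriv V1 g v - b / 4 * g v, dirDeriv (V2 a b) f v - b / 4 * g v, dirDeriv (V2 a b) g v,
    dbarCoeff a b f g v] ?_
  ext w
  rw [extDeriv_form01 hf hg]
  simp only [ContinuousAlternatingMap.add_apply, ContinuousAlternatingMap.smul_apply,
    wedge_two_apply, smul_eq_mul, fderiv_apply_eq (a := a) hb, dbarCoeff]
  simp only [Matrix.cons_val]
  simp only [phi1_apply, conj_phi1_apply, phi2_apply, conj_phi2_apply]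
  ring

end KT

/-! ### Hodge star on two- and three-forms, and the Laplacian on pairs of functions -/

namespace KT

open Complex

/-- The volume form through the values of `φ₁, φ̄₁, φ₂, φ̄₂`. -/
theorem vol_apply_vec (a b : ℝ) (v x y z w : Cover) :
    vol a b v ![x, y, z, w] = (I / 2) ^ 2 * (
      (phi1 v x * conjForm (phi1 v) y - conjForm (phi1 v) x * phi1 v y) *
        (phi2 a b v z * conjForm (phi2 a b v) w - conjForm (phi2 a b v) z * phi2 a b v w) -
      (phi1 v x * phi2 a b v y - phi2 a b v x * phi1 v y) *
        (conjForm (phi1 v) z * conjForm (phi2 a b v) w -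
          conjForm (phi2 a b v) z * conjForm (phi1 v) w) +
      (phi1 v x * conjForm (phi2 a b v) y - conjForm (phi2 a b v) x * phi1 v y) *
        (conjForm (phi1 v) z * phi2 a b v w - phi2 a b v z * conjForm (phi1 v) w) +
      (conjForm (phi1 v) x * phi2 a b v y - phi2 a b v x * conjForm (phi1 v) y) *
        (phi1 v z * conjForm (phi2 a b v) w - conjForm (phi2 a b v) z * phi1 v w) -
      (conjForm (phi1 v) x * conjForm (phi2 a b v) y -
          conjForm (phi2 a b v) x * conjForm (phi1 v) y) *
        (phi1 v z * phi2 a b v w - phi2 a b v z * phi1 v w) +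
      (phi2 a b v x * conjForm (phi2 a b v) y - conjForm (phi2 a b v) x * phi2 a b v y) *
        (phi1 v z * conjForm (phi1 v) w - conjForm (phi1 v) z * phi1 v w)) := by
  rw [vol_apply]
  congr 1
  simp only [Matrix.det_succ_row_zero, Fin.sum_univ_succ, Matrix.of_apply, Matrix.submatrix_apply]
  simp [Fin.succAbove]
  ring

theorem contract_two_apply (μ : Alt 4) (w u : Fin 2 → Cover) :
    contract (l := 2) 2 w μ u = μ ![w 0, w 1, u 0, u 1] := by
  simp only [contract]
  rw [ContinuousAlternatingMap.curryLeft_apply_apply, ContinuousAlternatingMap.curryLeft_apply_apply]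
  exact congrArg μ (by funext r; fin_cases r <;> rfl)

theorem contract_three_apply (μ : Alt 4) (w : Fin 3 → Cover) (u : Fin 1 → Cover) :
    contract (l := 1) 3 w μ u = μ ![w 0, w 1, w 2, u 0] := by
  simp only [contract]
  rw [ContinuousAlternatingMap.curryLeft_apply_apply, ContinuousAlternatingMap.curryLeft_apply_apply,
    ContinuousAlternatingMap.curryLeft_apply_apply]
  exact congrArg μ (by funext r; fin_cases r <;> rfl)

theorem star_two_apply (μ : Alt 4) (e : Fin 4 → Cover) (α : Alt 2) (u : Fin 2 → Cover) :
    star (k := 2) (l := 2) μ e α u =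
      2⁻¹ * ∑ i, ∑ j, α ![e i, e j] * μ ![e i, e j, u 0, u 1] := by
  rw [star, ContinuousAlternatingMap.smul_apply, ContinuousAlternatingMap.sum_apply, fin_fun_sum]
  simp_rw [fin_fun_sum, Fintype.sum_unique, ContinuousAlternatingMap.smul_apply, smul_eq_mul]
  rw [Nat.factorial_two, Nat.cast_ofNat]
  congr 1
  refine Finset.sum_congr rfl fun i _ => Finset.sum_congr rfl fun j _ => ?_
  rw [contract_two_apply]
  have h : ∀ n : Fin 0 → Fin 4, e ∘ (Fin.cons i (Fin.cons j n) : Fin 2 → Fin 4) = ![e i, e j] := by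
    intro n
    funext r
    fin_cases r <;> rfl
  exact congrArg₂ (fun x y => α x * μ y) (h _) rfl

theorem star_three_apply (μ : Alt 4) (e : Fin 4 → Cover) (α : Alt 3) (u : Fin 1 → Cover) :
    star (k := 3) (l := 1) μ e α u =
      6⁻¹ * ∑ i, ∑ j, ∑ k, α ![e i, e j, e k] * μ ![e i, e j, e k, u 0] := by
  rw [star, ContinuousAlternatingMap.smul_apply, ContinuousAlternatingMap.sum_apply, fin_fun_sum]
  simp_rw [fin_fun_sum, Fintype.sum_unique, ContinuousAlternatingMap.smul_apply, smul_eq_mul]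
  rw [show Nat.factorial 3 = 6 from rfl, Nat.cast_ofNat]
  congr 1
  refine Finset.sum_congr rfl fun i _ => Finset.sum_congr rfl fun j _ =>
    Finset.sum_congr rfl fun k _ => ?_
  rw [contract_three_apply]
  have h : ∀ n : Fin 0 → Fin 4, e ∘ (Fin.cons i (Fin.cons j (Fin.cons k n)) : Fin 3 → Fin 4) =
      ![e i, e j, e k] := by
    intro n
    funext r
    fin_cases r <;> rfl
  exact congrArg₂ (fun x y => α x * μ y) (h _) rfl
/-- `φ̄₁ ∧ φ̄₂` is self-dual. -/
theorem hodge2_form02 {a b : ℝ} (hb : b ≠ 0) (h : Cover → ℂ) :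
    hodge2 a b (form02 a b h) = form02 a b h := by
  funext v
  ext u
  rw [hodge2, star_two_apply]
  simp only [form02, ContinuousAlternatingMap.smul_apply, wedge_two_apply, smul_eq_mul,
    vol_apply_vec, Matrix.cons_val, phi1_unitaryFrame, conj_phi1_unitaryFrame,
    phi2_unitaryFrame hb, conj_phi2_unitaryFrame hb]
  simp only [Fin.sum_univ_four, Matrix.cons_val]
  ring_nf
  simp only [I_sq, I_pow_four, show I ^ 6 = -1 by rw [pow_add I 4 2, I_sq, I_pow_four]; ring]
  ring

/-- In the star of a three-form the summand is a product of two alternating expressions, hence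
symmetric; the `6` orderings of each triple cancel the factor `1/3!`. -/
theorem sum_symmetric_three {F : Fin 4 → Fin 4 → Fin 4 → ℂ} (h1 : ∀ i j k, F i j k = F j i k)
    (h2 : ∀ i j k, F i j k = F i k j) (h0 : ∀ i k, F i i k = 0) :
    ∑ i, ∑ j, ∑ k, F i j k = 6 * (F 0 1 2 + F 0 1 3 + F 0 2 3 + F 1 2 3) := by
  have h0' : ∀ i k, F k i i = 0 := fun i k => by rw [h1, h2, h0]
  have h0'' : ∀ i k, F i k i = 0 := fun i k => by rw [h2, h0]
  simp only [Fin.sum_univ_four, h0, h0', h0'', h1 1 0, h1 2 0, h1 3 0, h1 2 1, h1 3 1,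
    h2 _ 1 0, h2 _ 2 0, h2 _ 3 0, h2 _ 2 1, h2 _ 3 1, h2 _ 3 2]
  ring

theorem alt_three_swap (β : Alt 3) (x y z : Cover) :
    β ![x, y, z] = -β ![y, x, z] ∧ β ![x, y, z] = -β ![x, z, y] := by
  constructor
  · refine Eq.trans ?_ (β.toAlternatingMap.map_swap ![y, x, z] (i := 0) (j := 1) (by decide))
    exact congrArg β (by funext r; fin_cases r <;> rfl)
  · refine Eq.trans ?_ (β.toAlternatingMap.map_swap ![x, z, y] (i := 1) (j := 2) (by decide))
    exact congrArg β (by funext r; fin_cases r <;> rfl)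

theorem alt_four_swap (μ : Alt 4) (x y z w : Cover) :
    μ ![x, y, z, w] = -μ ![y, x, z, w] ∧ μ ![x, y, z, w] = -μ ![x, z, y, w] := by
  constructor
  · refine Eq.trans ?_ (μ.toAlternatingMap.map_swap ![y, x, z, w] (i := 0) (j := 1) (by decide))
    exact congrArg μ (by funext r; fin_cases r <;> rfl)
  · refine Eq.trans ?_ (μ.toAlternatingMap.map_swap ![x, z, y, w] (i := 1) (j := 2) (by decide))
    exact congrArg μ (by funext r; fin_cases r <;> rfl)

theorem star_three_apply_ordered (μ : Alt 4) (e : Fin 4 → Cover) (β : Alt 3) (u : Fin 1 → Cover) :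
    star (k := 3) (l := 1) μ e β u =
      β ![e 0, e 1, e 2] * μ ![e 0, e 1, e 2, u 0] + β ![e 0, e 1, e 3] * μ ![e 0, e 1, e 3, u 0] +
      β ![e 0, e 2, e 3] * μ ![e 0, e 2, e 3, u 0] +
      β ![e 1, e 2, e 3] * μ ![e 1, e 2, e 3, u 0] := by
  rw [star_three_apply, sum_symmetric_three (F := fun i j k =>
    β ![e i, e j, e k] * μ ![e i, e j, e k, u 0])]
  · ring
  · intro i j k
    rw [(alt_three_swap β (e i) (e j) (e k)).1, (alt_four_swap μ (e i) (e j) (e k) (u 0)).1,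
      neg_mul_neg]
  · intro i j k
    rw [(alt_three_swap β (e i) (e j) (e k)).2, (alt_four_swap μ (e i) (e j) (e k) (u 0)).2,
      neg_mul_neg]
  · intro i k
    rw [self_eq_neg.1 (alt_three_swap β (e i) (e i) (e k)).1, zero_mul]

theorem hodge3_form12 {a b : ℝ} (hb : b ≠ 0) (β : Form 3) (v : Cover) (A B : ℂ)
    (hβ : β v = A • wedge ![phi1 v, conjForm (phi1 v), conjForm (phi2 a b v)] +
      B • wedge ![phi2 a b v, conjForm (phi1 v), conjForm (phi2 a b v)]) :
    hodge3 a b β v = (-2 * B) • wedge ![conjForm (phi1 v)] +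
      (2 * A) • wedge ![conjForm (phi2 a b v)] := by
  ext u
  rw [hodge3, star_three_apply_ordered, hβ]
  simp only [ContinuousAlternatingMap.add_apply, ContinuousAlternatingMap.smul_apply,
    wedge_three_apply, wedge_one_apply, smul_eq_mul,
    vol_apply_vec, Matrix.cons_val, phi1_unitaryFrame, conj_phi1_unitaryFrame,
    phi2_unitaryFrame hb, conj_phi2_unitaryFrame hb]
  ring_nf
  simp only [I_pow_four, show I ^ 6 = -1 by rw [pow_add I 4 2, I_sq, I_pow_four]; ring]
  ring

theorem typeProj_three_form {a b : ℝ} (hb : b ≠ 0) (v : Cover) {β : Alt 3} (c : Fin 3 → ℂ)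
    (h : β = c 0 • wedge ![phi1 v, conjForm (phi1 v), phi2 a b v] +
      (c 1 • wedge ![phi1 v, conjForm (phi1 v), conjForm (phi2 a b v)] +
      c 2 • wedge ![phi2 a b v, conjForm (phi1 v), conjForm (phi2 a b v)])) :
    typeProj (J a b v) 1 2 β = c 1 • wedge ![phi1 v, conjForm (phi1 v), conjForm (phi2 a b v)] +
      c 2 • wedge ![phi2 a b v, conjForm (phi1 v), conjForm (phi2 a b v)] := by
  have t : ∀ (i j k : Fin 4) {p q : ℕ}, (![1, 1, -1, -1] : Fin 4 → ℂ) i +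
      (![1, 1, -1, -1] : Fin 4 → ℂ) j + (![1, 1, -1, -1] : Fin 4 → ℂ) k = p - q →
      IsType (J a b v) p q (wedge ![phis a b v i, phis a b v j, phis a b v k]) := by
    intro i j k p q hpq
    have := isType_wedge_phis (a := a) hb v (![i, j, k] : Fin 3 → Fin 4) (p := p) (q := q)
      (by simpa [Fin.sum_univ_three] using hpq)
    convert this using 2
    funext r
    fin_cases r <;> rfl
  have t21 := isType_smul (t 0 2 1 (p := 2) (q := 1) (by simp; norm_num)) (c 0)
  have t12 := isType_add
    (isType_smul (t 0 2 3 (p := 1) (q := 2) (by simp; norm_num)) (c 1))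
    (isType_smul (t 1 2 3 (p := 1) (q := 2) (by simp; norm_num)) (c 2))
  have e21 := typeProj_of_isType (J a b v) (p := 1) (q := 2) (by norm_num) (by norm_num) t21
  have e12 := typeProj_of_isType (J a b v) (p := 1) (q := 2) (by norm_num) (by norm_num) t12
  simp only [phis, Matrix.cons_val] at e21 e12
  rw [h, typeProj_add, e21, e12]
  simp

theorem extDeriv_form02 {a b : ℝ} {h : Cover → ℂ} (hh : ContDiff ℝ ∞ h) (v : Cover)
    (w : Fin 3 → Cover) :
    extDeriv (form02 a b h) v w =
      (fderiv ℝ h v (w 0) * (conjForm (phi1 v) (w 1) * conjForm (phi2 a b v) (w 2) -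
        conjForm (phi2 a b v) (w 1) * conjForm (phi1 v) (w 2)) -
      fderiv ℝ h v (w 1) * (conjForm (phi1 v) (w 0) * conjForm (phi2 a b v) (w 2) -
        conjForm (phi2 a b v) (w 0) * conjForm (phi1 v) (w 2)) +
      fderiv ℝ h v (w 2) * (conjForm (phi1 v) (w 0) * conjForm (phi2 a b v) (w 1) -
        conjForm (phi2 a b v) (w 0) * conjForm (phi1 v) (w 1))) -
      I * b * h v * (w 0 1 * (conjForm (phi1 v) (w 1) * w 2 2 - w 1 2 * conjForm (phi1 v) (w 2)) -
        w 1 1 * (conjForm (phi1 v) (w 0) * w 2 2 - w 0 2 * conjForm (phi1 v) (w 2)) +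
        w 2 1 * (conjForm (phi1 v) (w 0) * w 1 2 - w 0 2 * conjForm (phi1 v) (w 1))) := by
  have hdh : DifferentiableAt ℝ h v := hh.differentiable (by simp) v
  have hd : DifferentiableAt ℝ (form02 a b h) v :=
    (contDiff_form02 a b hh).differentiable (by simp) v
  have key : ∀ x y u : Cover, fderiv ℝ (fun y' => form02 a b h y' ![x, y]) v u =
      fderiv ℝ h v u * (conjForm (phi1 v) x * conjForm (phi2 a b v) y -
        conjForm (phi2 a b v) x * conjForm (phi1 v) y) -
        I * b * h v * (u 1 * (conjForm (phi1 v) x * y 2 - x 2 * conjForm (phi1 v) y)) := by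
    intro x y u
    simp_rw [form02_apply]
    have h1 := hdh.hasFDerivAt.mul (((hasFDerivAt_conj_phi2 a b v y).const_mul
      ((x 0 : ℂ) - I * x 1)).sub ((hasFDerivAt_conj_phi2 a b v x).mul_const ((y 0 : ℂ) - I * y 1)))
    have h2 : fderiv ℝ (fun y' => h y' * (((x 0 : ℂ) - I * x 1) *
        ((1 + a * I) * y 2 + I * b * (y 3 - y' 1 * y 2)) -
      ((1 + a * I) * x 2 + I * b * (x 3 - y' 1 * x 2)) * (y 0 - I * y 1))) v = _ := h1.fderiv
    simp only [Matrix.cons_val]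
    rw [h2]
    simp only [conj_phi1_apply, conj_phi2_apply]
    simp
    ring
  rw [extDeriv_apply hd, Fin.sum_univ_three]
  have e0 : (Fin.removeNth 0 w) = ![w 1, w 2] := by
    funext r; fin_cases r <;> rfl
  have e1 : (Fin.removeNth 1 w) = ![w 0, w 2] := by
    funext r; fin_cases r <;> rfl
  have e2 : (Fin.removeNth 2 w) = ![w 0, w 1] := by
    funext r; fin_cases r <;> rfl
  rw [e0, e1, e2, key, key, key]
  simp
  ring

theorem del_form02 {a b : ℝ} (hb : b ≠ 0) {h : Cover → ℂ} (hh : ContDiff ℝ ∞ h) (v : Cover) :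
    del a b 0 2 (form02 a b h) v =
      (dirDeriv V1 h v - b / 4 * h v) •
        wedge ![phi1 v, conjForm (phi1 v), conjForm (phi2 a b v)] +
      dirDeriv (V2 a b) h v • wedge ![phi2 a b v, conjForm (phi1 v), conjForm (phi2 a b v)] := by
  rw [del]
  refine typeProj_three_form hb v
    ![-(b / 4 * h v), dirDeriv V1 h v - b / 4 * h v, dirDeriv (V2 a b) h v] ?_
  ext w
  rw [extDeriv_form02 hh]
  simp only [ContinuousAlternatingMap.add_apply, ContinuousAlternatingMap.smul_apply,
    wedge_three_apply, smul_eq_mul, fderiv_apply_eq (a := a) hb]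
  simp only [Matrix.cons_val]
  simp only [phi1_apply, conj_phi1_apply, phi2_apply, conj_phi2_apply]
  ring

theorem dbarStar02_form02 {a b : ℝ} (hb : b ≠ 0) {h : Cover → ℂ} (hh : ContDiff ℝ ∞ h) :
    dbarStar02 a b (form02 a b h) = form01 a b (fun v => 2 * dirDeriv (V2 a b) h v)
      (fun v => -2 * (dirDeriv V1 h v - b / 4 * h v)) := by
  funext v
  change -(hodge3 a b (del a b 0 2 (hodge2 a b (form02 a b h))) v) = _
  rw [hodge2_form02 hb, hodge3_form12 hb _ v _ _ (del_form02 hb hh v)]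
  ext u
  simp only [form01, ContinuousAlternatingMap.neg_apply, ContinuousAlternatingMap.add_apply,
    ContinuousAlternatingMap.smul_apply, smul_eq_mul]
  ring

/-- The function `∂̄* (f φ̄₁ + g φ̄₂)`. -/
noncomputable def dbarStarCoeff (a b : ℝ) (f g : Cover → ℂ) (v : Cover) : ℂ :=
  -2 * (dirDeriv V1 f v + dirDeriv (V2 a b) g v)

theorem form01_unitaryFrame {a b : ℝ} (hb : b ≠ 0) (f g : Cover → ℂ) (v : Cover) (j : Fin 4) :
    form01 a b f g v (fun _ => unitaryFrame a b v j) =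
      f v * (![1, -I, 0, 0] : Fin 4 → ℂ) j + g v * (![0, 0, 1, -I] : Fin 4 → ℂ) j := by
  rw [form01, ContinuousAlternatingMap.add_apply, ContinuousAlternatingMap.smul_apply,
    ContinuousAlternatingMap.smul_apply, wedge_one_apply, wedge_one_apply,
    conj_phi1_unitaryFrame, conj_phi2_unitaryFrame hb, smul_eq_mul, smul_eq_mul]

theorem dbarStar01_form01 {a b : ℝ} (hb : b ≠ 0) {f g : Cover → ℂ} (hf : ContDiff ℝ ∞ f)
    (hg : ContDiff ℝ ∞ g) (v : Cover) (u : Fin 0 → Cover) :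
    dbarStar01 a b (form01 a b f g) v u = dbarStarCoeff a b f g v := by
  have hb' : (b : ℂ) ≠ 0 := by exact_mod_cast hb
  rw [dbarStar01_apply hb (contDiff_form01 a b hf hg)]
  have hval := form01_unitaryFrame (a := a) hb f g
  have d0 : dualField a b (form01 a b f g) 0 = f := by
    funext y
    simp only [dualField, hval, Fin.sum_univ_four]
    simp [unitaryFrame, frame]
  have d1 : dualField a b (form01 a b f g) 1 = fun y => -I * f y := by
    funext y
    simp only [dualField, hval, Fin.sum_univ_four]
    simp [unitaryFrame, frame]
    ring
  have d2 : dualField a b (form01 a b f g) 2 = g := by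
    funext y
    simp only [dualField, hval, Fin.sum_univ_four]
    simp [unitaryFrame, frame]
  have d3 : dualField a b (form01 a b f g) 3 = fun y => (y 1 : ℂ) * g y + (-(a - I) / b) * g y := by
    funext y
    simp only [dualField, hval, Fin.sum_univ_four]
    simp [unitaryFrame, frame]
    field_simp
    ring
  have hdf : DifferentiableAt ℝ f v := hf.differentiable (by simp) v
  have hdg : DifferentiableAt ℝ g v := hg.differentiable (by simp) v
  have hp1 : partialDeriv 1 (fun y => -I * f y) v = -I * partialDeriv 1 f v := by
    simp only [partialDeriv]
    rw [fderiv_const_mul hdf]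
    simp
  -- The coefficient `y 1` is independent of `z`, so this term completes `∂g/∂y` to the frame
  -- derivative `∂/∂y + x ∂/∂z`.
  have hp3 : partialDeriv 3 (fun y => (y 1 : ℂ) * g y + (-(a - I) / b) * g y) v =
      (v 1 : ℂ) * partialDeriv 3 g v + (-(a - I) / b) * partialDeriv 3 g v := by
    have h1 := (ofRealCLM.comp (ContinuousLinearMap.proj (R := ℝ)
      (φ := fun _ : Fin 4 => ℝ) 1)).hasFDerivAt (x := v)
    have h2 := (h1.mul hdg.hasFDerivAt).add (hdg.hasFDerivAt.const_mul (-(a - I) / b))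
    have h3 : fderiv ℝ (fun y : Cover => (y 1 : ℂ) * g y + (-(a - I) / b) * g y) v = _ := h2.fderiv
    simp only [partialDeriv]
    rw [h3]
    simp
  rw [Fin.sum_univ_four, d0, d1, d2, d3, hp1, hp3]
  simp only [dbarStarCoeff, dirDeriv, V1, V2, Fin.sum_univ_four, Matrix.cons_val, frameDeriv_zero,
    frameDeriv_one, frameDeriv_two, frameDeriv_three]
  field_simp
  ring

theorem contDiff_dbarCoeff (a b : ℝ) {f g : Cover → ℂ} (hf : ContDiff ℝ ∞ f)
    (hg : ContDiff ℝ ∞ g) : ContDiff ℝ ∞ (dbarCoeff a b f g) :=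
  ((contDiff_dirDeriv hg _).sub (contDiff_dirDeriv hf _)).add (contDiff_const.mul hg)

theorem contDiff_dbarStarCoeff (a b : ℝ) {f g : Cover → ℂ} (hf : ContDiff ℝ ∞ f)
    (hg : ContDiff ℝ ∞ g) : ContDiff ℝ ∞ (dbarStarCoeff a b f g) :=
  contDiff_const.mul ((contDiff_dirDeriv hf _).add (contDiff_dirDeriv hg _))

theorem dbarLaplacian_form01 {a b : ℝ} (hb : b ≠ 0) {f g : Cover → ℂ} (hf : ContDiff ℝ ∞ f)
    (hg : ContDiff ℝ ∞ g) :
    dbarLaplacian a b (form01 a b f g) = form01 a b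
      (fun v => dirDeriv V1bar (dbarStarCoeff a b f g) v +
        2 * dirDeriv (V2 a b) (dbarCoeff a b f g) v)
      (fun v => dirDeriv (V2bar a b) (dbarStarCoeff a b f g) v -
        2 * (dirDeriv V1 (dbarCoeff a b f g) v - b / 4 * dbarCoeff a b f g v)) := by
  rw [dbarLaplacian, dbar_function hb (dbarStar01_form01 hb hf hg)
    (contDiff_dbarStar01 a b (contDiff_form01 a b hf hg)), dbar_form01 hb hf hg,
    dbarStar02_form02 hb (contDiff_dbarCoeff a b hf hg)]
  funext v
  ext u
  simp only [Pi.add_apply, form01, ContinuousAlternatingMap.add_apply,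
    ContinuousAlternatingMap.smul_apply, smul_eq_mul]
  ring

end KT

/-! ### Harmonic means closed and coclosed -/

namespace KT

open Complex

variable {f g : Cover → ℂ}

/-! ### Smooth `(0,1)`-forms as pairs of functions -/

theorem form01_eq_zero {a b : ℝ} (hb : b ≠ 0) (h : form01 a b f g = 0) : f = 0 ∧ g = 0 := by
  constructor <;> funext v
  · have := form01_unitaryFrame (a := a) hb f g v 0
    rw [h] at this
    simpa using this.symm
  · have := form01_unitaryFrame (a := a) hb f g v 2
    rw [h] at this
    simpa using this.symm

theorem fderiv_deck_unitaryFrame (a b : ℝ) (n : Fin 4 → ℤ) (v : Cover) (j : Fin 4) :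
    fderiv ℝ (deck n) v (unitaryFrame a b v j) = unitaryFrame a b (deck n v) j := by
  fin_cases j <;> simp [unitaryFrame, fderiv_deck_frame]

theorem isForm01_form01 {a b : ℝ} (hb : b ≠ 0) (hf : ContDiff ℝ ∞ f) (hi : Invariant f)
    (hg : ContDiff ℝ ∞ g) (hgi : Invariant g) : IsForm01 a b (form01 a b f g) where
  smooth := contDiff_form01 a b hf hg
  descends n v := by
    ext w
    rw [ContinuousAlternatingMap.compContinuousLinearMap_apply, form01_apply, form01_apply, hi, hgi]
    simp only [Function.comp_apply, fderiv_deck_apply]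
    simp [deck]
    left
    left
    ring
  type01 := isType_form01 hb f g

theorem IsForm01.exists_eq_form01 {a b : ℝ} (hb : b ≠ 0) {α : Form 1} (hα : IsForm01 a b α) :
    ∃ f g : Cover → ℂ, (ContDiff ℝ ∞ f ∧ Invariant f) ∧ (ContDiff ℝ ∞ g ∧ Invariant g) ∧
      α = form01 a b f g := by
  have hb' : (b : ℂ) ≠ 0 := by exact_mod_cast hb
  have hs : ∀ j, ContDiff ℝ ∞ fun v => α v (fun _ => unitaryFrame a b v j) := fun j =>
    contDiff_apply_vec (w := fun v _ => unitaryFrame a b v j) hα.smooth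
      fun _ => contDiff_unitaryFrame a b j
  have hinv : ∀ j, Invariant fun v => α v (fun _ => unitaryFrame a b v j) := by
    intro j n v
    have h := DFunLike.congr_fun (hα.descends n v) (fun _ => unitaryFrame a b v j)
    rw [ContinuousAlternatingMap.compContinuousLinearMap_apply] at h
    simp only [Function.comp_def, fderiv_deck_unitaryFrame] at h
    exact h
  -- A quarter turn is `J` itself, and it multiplies `(0,1)`-forms by `-i`. Thus the values on `e₀`
  -- and `e₂` determine those on `e₁ = J e₀` and `e₃ = J e₂`.
  have hJ : ∀ v u, α v (fun _ => J a b v u) = -I * α v (fun _ => u) := by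
    intro v u
    have h := DFunLike.congr_fun (hα.type01 v (Real.pi / 2)) (fun _ => u)
    rw [ContinuousAlternatingMap.compContinuousLinearMap_apply,
      ContinuousAlternatingMap.smul_apply] at h
    have e : exp (I * (((0 : ℕ) : ℂ) - (1 : ℕ)) * ((Real.pi / 2 : ℝ) : ℂ)) = -I := by
      rw [show I * (((0 : ℕ) : ℂ) - (1 : ℕ)) * ((Real.pi / 2 : ℝ) : ℂ) = -(Real.pi / 2 * I) by
        push_cast; ring, exp_neg, exp_pi_div_two_mul_I, inv_I]
    rw [e] at h
    simpa [rot, Function.comp_def] using h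
  refine ⟨fun v => α v (fun _ => unitaryFrame a b v 0), fun v => α v (fun _ => unitaryFrame a b v 2),
    ⟨hs 0, hinv 0⟩, ⟨hs 2, hinv 2⟩, ?_⟩
  funext v
  ext w
  obtain ⟨L, hL⟩ : ∃ L : Cover →L[ℝ] ℂ, ∀ u, α v (fun _ => u) = L u :=
    ⟨(ContinuousAlternatingMap.ofSubsingleton ℝ Cover ℂ (0 : Fin 1)).symm (α v), fun u => rfl⟩
  have h1 := hJ v (unitaryFrame a b v 0)
  have h3 := hJ v (unitaryFrame a b v 2)
  rw [(J_unitaryFrame hb v).1] at h1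
  rw [(J_unitaryFrame hb v).2] at h3
  have hw : w = fun _ => w 0 := by
    funext r
    rw [Subsingleton.elim r 0]
  have hu : w 0 = w 0 0 • unitaryFrame a b v 0 + w 0 1 • unitaryFrame a b v 1 +
      w 0 2 • unitaryFrame a b v 2 +
      (-b * (w 0 3 - (v 1 - a / b) * w 0 2)) • unitaryFrame a b v 3 := by
    ext i
    fin_cases i <;> simp [unitaryFrame, frame]
    field_simp
    ring
  rw [form01_apply]
  conv_lhs => rw [hw]
  simp only [hL] at h1 h3 ⊢
  conv_lhs => rw [hu]
  simp only [map_add, map_smul, h1, h3, real_smul]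
  push_cast
  field_simp
  ring

/-! ### Integration by parts for complex directional derivatives -/

theorem Invariant.dirDeriv (hf : Invariant f) (hs : ContDiff ℝ ∞ f) (c : Fin 4 → ℂ) :
    Invariant (dirDeriv c f) := fun n v =>
  Finset.sum_congr rfl fun j _ => congrArg (c j * ·) (hf.frameDeriv hs j n v)

theorem Invariant.conj (hf : Invariant f) : Invariant fun v => (starRingEnd ℂ) (f v) :=
  fun n v => congrArg _ (hf n v)

/-- The adjoint of a constant combination of the frame fields is minus its conjugate, since each
frame field integrates to zero. -/
theorem total_dirDeriv_mul_conj (hf : ContDiff ℝ ∞ f) (hi : Invariant f) (hg : ContDiff ℝ ∞ g)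
    (hgi : Invariant g) {c c' : Fin 4 → ℂ} (hc : ∀ j, (starRingEnd ℂ) (c' j) = c j) :
    total (fun v => dirDeriv c f v * (starRingEnd ℂ) (g v)) =
      -total (fun v => f v * (starRingEnd ℂ) (dirDeriv c' g v)) := by
  have key : ∀ j, total (fun v => c j * (frameDeriv j f v * (starRingEnd ℂ) (g v))) =
      -total (fun v => c j * (f v * (starRingEnd ℂ) (frameDeriv j g v))) := by
    intro j
    rw [total_const_mul, total_const_mul]
    have h := total_mul_frameDeriv hf hi (contDiff_conj hg) hgi.conj j
    rw [frameDeriv_conj hg] at h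
    rw [h]
    ring
  have s1 : ∀ j, ContDiff ℝ ∞ fun v => c j * (frameDeriv j f v * (starRingEnd ℂ) (g v)) := fun j =>
    contDiff_const.mul ((contDiff_frameDeriv hf j).mul (contDiff_conj hg))
  have s2 : ∀ j, ContDiff ℝ ∞ fun v => c j * (f v * (starRingEnd ℂ) (frameDeriv j g v)) := fun j =>
    contDiff_const.mul (hf.mul (contDiff_conj (contDiff_frameDeriv hg j)))
  have e1 : (fun v => dirDeriv c f v * (starRingEnd ℂ) (g v)) = fun v =>
      c 0 * (frameDeriv 0 f v * (starRingEnd ℂ) (g v)) +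
      (c 1 * (frameDeriv 1 f v * (starRingEnd ℂ) (g v)) +
      (c 2 * (frameDeriv 2 f v * (starRingEnd ℂ) (g v)) +
      c 3 * (frameDeriv 3 f v * (starRingEnd ℂ) (g v)))) := by
    funext v
    rw [KT.dirDeriv, Fin.sum_univ_four]
    ring
  have e2 : (fun v => f v * (starRingEnd ℂ) (dirDeriv c' g v)) = fun v =>
      c 0 * (f v * (starRingEnd ℂ) (frameDeriv 0 g v)) +
      (c 1 * (f v * (starRingEnd ℂ) (frameDeriv 1 g v)) +
      (c 2 * (f v * (starRingEnd ℂ) (frameDeriv 2 g v)) +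
      c 3 * (f v * (starRingEnd ℂ) (frameDeriv 3 g v)))) := by
    funext v
    rw [KT.dirDeriv, Fin.sum_univ_four]
    simp only [map_add, map_mul, hc]
    ring
  rw [e1, e2, total_add (s1 0) ((s1 1).add ((s1 2).add (s1 3))),
    total_add (s1 1) ((s1 2).add (s1 3)), total_add (s1 2) (s1 3),
    total_add (s2 0) ((s2 1).add ((s2 2).add (s2 3))),
    total_add (s2 1) ((s2 2).add (s2 3)), total_add (s2 2) (s2 3), key, key, key, key]
  ring

theorem conj_V1 (j : Fin 4) : (starRingEnd ℂ) (V1 j) = V1bar j := by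
  fin_cases j <;> simp [V1, V1bar, Complex.conj_ofNat]

theorem conj_V1bar (j : Fin 4) : (starRingEnd ℂ) (V1bar j) = V1 j := by
  rw [← conj_V1, conj_conj]

theorem conj_V2 (a b : ℝ) (j : Fin 4) : (starRingEnd ℂ) (V2 a b j) = V2bar a b j := by
  fin_cases j <;> simp [V2, V2bar, Complex.conj_ofNat]
  ring

theorem conj_V2bar (a b : ℝ) (j : Fin 4) : (starRingEnd ℂ) (V2bar a b j) = V2 a b j := by
  rw [← conj_V2, conj_conj]

theorem Invariant.dbarStarCoeff (a b : ℝ) (hf : ContDiff ℝ ∞ f) (hi : Invariant f)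
    (hg : ContDiff ℝ ∞ g) (hgi : Invariant g) : Invariant (dbarStarCoeff a b f g) := fun n v => by
  rw [KT.dbarStarCoeff, KT.dbarStarCoeff, hi.dirDeriv hf, hgi.dirDeriv hg]

theorem Invariant.dbarCoeff (a b : ℝ) (hf : ContDiff ℝ ∞ f) (hi : Invariant f)
    (hg : ContDiff ℝ ∞ g) (hgi : Invariant g) : Invariant (dbarCoeff a b f g) := fun n v => by
  rw [KT.dbarCoeff, KT.dbarCoeff, hi.dirDeriv hf, hgi.dirDeriv hg, hgi]

theorem total_zero : total (fun _ => 0) = 0 := by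
  simpa using total_const_mul (f := fun _ => 0) 0

/-- A harmonic form is closed and coclosed. -/
theorem dbarLaplacian_form01_eq_zero_iff {a b : ℝ} (hb : b ≠ 0) (hf : ContDiff ℝ ∞ f)
    (hi : Invariant f) (hg : ContDiff ℝ ∞ g) (hgi : Invariant g) :
    dbarLaplacian a b (form01 a b f g) = 0 ↔
      dbarStarCoeff a b f g = 0 ∧ dbarCoeff a b f g = 0 := by
  rw [dbarLaplacian_form01 hb hf hg]
  have sF := contDiff_dbarStarCoeff a b hf hg
  have sh := contDiff_dbarCoeff a b hf hg
  have iF := Invariant.dbarStarCoeff a b hf hi hg hgi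
  have ih := Invariant.dbarCoeff a b hf hi hg hgi
  constructor
  · intro hz
    obtain ⟨h1, h2⟩ := form01_eq_zero hb hz
    clear hz
    set F := dbarStarCoeff a b f g with hF
    set h := dbarCoeff a b f g with hh
    have cf := contDiff_conj hf
    have cg := contDiff_conj hg
    have t1 := total_dirDeriv_mul_conj sF iF hf hi conj_V1
    have t2 := total_dirDeriv_mul_conj sh ih hf hi (conj_V2bar a b)
    have t3 := total_dirDeriv_mul_conj sF iF hg hgi (conj_V2 a b)
    have t4 := total_dirDeriv_mul_conj sh ih hg hgi conj_V1bar
    -- `r1` and `r2` are the two components of the equation paired with `f` and `g`; `t1` to `t4`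
    -- move the derivatives onto `f` and `g`.
    have r1 : total (fun v => dirDeriv V1bar F v * (starRingEnd ℂ) (f v)) +
        2 * total (fun v => dirDeriv (V2 a b) h v * (starRingEnd ℂ) (f v)) = 0 := by
      rw [← total_const_mul, ← total_add ((contDiff_dirDeriv sF _).mul cf)
        (contDiff_const.mul ((contDiff_dirDeriv sh _).mul cf)), ← total_zero]
      congr 1
      funext v
      have := congrFun h1 v
      simp only [Pi.zero_apply] at this
      linear_combination (starRingEnd ℂ) (f v) * this
    have r2 : total (fun v => dirDeriv (V2bar a b) F v * (starRingEnd ℂ) (g v)) +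
        (-2 * total (fun v => dirDeriv V1 h v * (starRingEnd ℂ) (g v)) +
        b / 2 * total (fun v => h v * (starRingEnd ℂ) (g v))) = 0 := by
      have s4 : ContDiff ℝ ∞ fun v => -2 * (dirDeriv V1 h v * (starRingEnd ℂ) (g v)) :=
        contDiff_const.mul ((contDiff_dirDeriv sh _).mul cg)
      have s5 : ContDiff ℝ ∞ fun v => (b / 2 : ℂ) * (h v * (starRingEnd ℂ) (g v)) :=
        contDiff_const.mul (sh.mul cg)
      rw [← total_const_mul, ← total_const_mul, ← total_add s4 s5,
        ← total_add ((contDiff_dirDeriv sF _).mul cg) (s4.add s5), ← total_zero]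
      congr 1
      funext v
      have := congrFun h2 v
      simp only [Pi.zero_apply] at this
      linear_combination (starRingEnd ℂ) (g v) * this
    have q1 : total (fun v => F v * (starRingEnd ℂ) (F v)) =
        -2 * (total (fun v => F v * (starRingEnd ℂ) (dirDeriv V1 f v)) +
          total (fun v => F v * (starRingEnd ℂ) (dirDeriv (V2 a b) g v))) := by
      rw [← total_add (sF.mul (contDiff_conj (contDiff_dirDeriv hf _)))
        (sF.mul (contDiff_conj (contDiff_dirDeriv hg _))), ← total_const_mul]
      congr 1
      funext v
      conv_lhs => enter [2]; rw [hF, dbarStarCoeff]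
      simp only [map_add, map_mul, map_neg, map_ofNat]
      ring
    have q2 : total (fun v => h v * (starRingEnd ℂ) (h v)) =
        total (fun v => h v * (starRingEnd ℂ) (dirDeriv V1bar g v)) +
        (-1 * total (fun v => h v * (starRingEnd ℂ) (dirDeriv (V2bar a b) f v)) +
          b / 4 * total (fun v => h v * (starRingEnd ℂ) (g v))) := by
      have s4 : ContDiff ℝ ∞ fun v => -1 * (h v * (starRingEnd ℂ) (dirDeriv (V2bar a b) f v)) :=
        contDiff_const.mul (sh.mul (contDiff_conj (contDiff_dirDeriv hf _)))
      have s5 : ContDiff ℝ ∞ fun v => (b / 4 : ℂ) * (h v * (starRingEnd ℂ) (g v)) :=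
        contDiff_const.mul (sh.mul cg)
      rw [← total_const_mul, ← total_const_mul, ← total_add s4 s5,
        ← total_add (sh.mul (contDiff_conj (contDiff_dirDeriv hg _))) (s4.add s5)]
      congr 1
      funext v
      conv_lhs => enter [2]; rw [hh, dbarCoeff]
      simp only [map_add, map_mul, map_sub, map_div₀, map_ofNat, conj_ofReal]
      ring
    -- The pairing adds up to `½ ∫|F|² + 2 ∫|h|²`: the factor `-2` in `dbarStarCoeff` accounts for
    -- `½`, and the factor `2` in `∂̄*` on `(0,2)`-forms for `2`.
    refine eq_zero_of_total_mul_conj sF iF sh ih (c := 1 / 2) (d := 2) (by norm_num) (by norm_num) ?_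
    rw [q1, q2]
    push_cast
    linear_combination r1 + r2 - t1 - t3 - 2 * t2 + 2 * t4
  · rintro ⟨h1, h2⟩
    have d0 : ∀ (c : Fin 4 → ℂ) (v : Cover), dirDeriv c 0 v = 0 := by
      intro c v
      simp [KT.dirDeriv, frameDeriv]
    rw [h1, h2]
    funext v
    ext w
    rw [form01_apply]
    simp only [d0, Pi.zero_apply]
    simp
end KT

/-! ### Vanishing of the modes off the circle -/

namespace KT

open Complex

variable {f g : Cover → ℂ}

/-! ### The equations for the Fourier modes -/

/-- The equations for a closed and coclosed form, solved for the derivatives in `x`. -/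
theorem frameDeriv_one_of_closed {a b : ℝ} (hb : b ≠ 0) (hF : dbarStarCoeff a b f g = 0)
    (hh : dbarCoeff a b f g = 0) :
    (frameDeriv 1 f = fun v => -I * frameDeriv 0 f v +
      (-I * frameDeriv 2 g v + I * (a - I) / b * frameDeriv 3 g v)) ∧
    (frameDeriv 1 g = fun v => I * frameDeriv 0 g v + (-I * frameDeriv 2 f v +
      (I * (a + I) / b * frameDeriv 3 f v + I * b / 2 * g v))) := by
  have hb' : (b : ℂ) ≠ 0 := by exact_mod_cast hb
  have hI : I * I = -1 := I_mul_I
  constructor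
  · funext v
    have h := congrFun hF v
    simp only [dbarStarCoeff, dirDeriv, V1, V2, Fin.sum_univ_four, Matrix.cons_val,
      Pi.zero_apply] at h
    linear_combination (-I) * h + frameDeriv 1 f v * hI
  · funext v
    have h := congrFun hh v
    simp only [dbarCoeff, dirDeriv, V1bar, V2bar, Fin.sum_univ_four, Matrix.cons_val,
      Pi.zero_apply] at h
    linear_combination (-2 * I) * h + frameDeriv 1 g v * hI

theorem mode_frameDeriv_one {a b : ℝ} (hb : b ≠ 0) (hf : ContDiff ℝ ∞ f) (hi : Invariant f)
    (hg : ContDiff ℝ ∞ g) (hgi : Invariant g) (hF : dbarStarCoeff a b f g = 0)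
    (hh : dbarCoeff a b f g = 0) (k m n : ℤ) (v : Cover) :
    mode k m n (frameDeriv 1 f) v = 2 * Real.pi * (k * mode k m n f v +
      (m + n * v 1 - n * (a - I) / b) * mode k m n g v) ∧
    mode k m n (frameDeriv 1 g) v = 2 * Real.pi * (-k * mode k m n g v +
      (m + n * v 1 - n * (a + I) / b) * mode k m n f v) + I * b / 2 * mode k m n g v := by
  obtain ⟨h1, h2⟩ := frameDeriv_one_of_closed hb hF hh
  have s : ∀ (c : ℂ) {u : Cover → ℂ} (j : Fin 4), ContDiff ℝ ∞ u →
      ContDiff ℝ ∞ fun v => c * frameDeriv j u v := fun c u j hu =>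
    contDiff_const.mul (contDiff_frameDeriv hu j)
  have d0 : ∀ {u : Cover → ℂ}, ContDiff ℝ ∞ u → Invariant u →
      mode k m n (frameDeriv 0 u) = fun v => 2 * Real.pi * I * k * mode k m n u v := fun hu hui => by
    rw [frameDeriv_zero, mode_partialDeriv_zero hu hui]
  have d3 : ∀ {u : Cover → ℂ}, ContDiff ℝ ∞ u → Invariant u →
      mode k m n (frameDeriv 3 u) = fun v => 2 * Real.pi * I * n * mode k m n u v := fun hu hui => by
    rw [frameDeriv_three, mode_partialDeriv_three hu hui]
  constructor
  · rw [h1, mode_add (s _ 0 hf) ((s _ 2 hg).add (s _ 3 hg)), mode_add (s _ 2 hg) (s _ 3 hg),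
      mode_const_mul, mode_const_mul, mode_const_mul, d0 hf hi, d3 hg hgi,
      mode_frameDeriv_two hg hgi]
    ring_nf
    simp only [I_sq, show I ^ 3 = -I by rw [pow_succ, I_sq]; ring]
    ring
  · have sg : ContDiff ℝ ∞ fun v => I * b / 2 * g v := contDiff_const.mul hg
    rw [h2, mode_add (s _ 0 hg) ((s _ 2 hf).add ((s _ 3 hf).add sg)),
      mode_add (s _ 2 hf) ((s _ 3 hf).add sg), mode_add (s _ 3 hf) sg,
      mode_const_mul, mode_const_mul, mode_const_mul, mode_const_mul, d0 hg hgi, d3 hf hi,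
      mode_frameDeriv_two hf hi]
    ring_nf
    simp only [I_sq, show I ^ 3 = -I by rw [pow_succ, I_sq]; ring]
    ring

/-- The characteristic exponents avoid the spectrum of the harmonic oscillator, since `π` is not a
quadratic irrationality. -/
theorem oscillator_nonresonance {b : ℝ} {p : ℤ} {q : ℕ} (hp : p ≠ 0) (hq : 0 < q)
    (hb : b / (8 * Real.pi) = (p : ℝ) / q) (k : ℤ) {n : ℤ} (j : ℕ) :
    (((2 * Real.pi * k : ℝ) : ℂ) - I * ((2 * Real.pi * n / b : ℝ) + (b / 4 : ℝ))) *
      ((2 * Real.pi * k : ℝ) + I * ((2 * Real.pi * n / b : ℝ) - (b / 4 : ℝ))) ≠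
      -2 * (|2 * Real.pi * n| : ℝ) * j := by
  intro h
  have hπ := Real.pi_pos
  have hp' : (p : ℝ) ≠ 0 := by exact_mod_cast hp
  have hq' : (q : ℝ) ≠ 0 := by exact_mod_cast hq.ne'
  have hbe : b = 8 * Real.pi * p / q := by
    rw [div_eq_iff (by positivity)] at hb
    rw [hb]
    ring
  have hb0 : b ≠ 0 := by
    rw [hbe]
    exact div_ne_zero (mul_ne_zero (by positivity) hp') hq'
  have him := congrArg im h
  have hre := congrArg re h
  simp at him hre
  -- The imaginary part of the product is `-π b k`, and the right-hand side is real.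
  have hk : (k : ℝ) = 0 := by
    have h1 : Real.pi * b * k = 0 := by linear_combination (-1) * him
    rcases mul_eq_zero.1 h1 with h2 | h2
    · exact absurd h2 (mul_ne_zero hπ.ne' hb0)
    · exact h2
  rw [hk, abs_of_pos hπ] at hre
  -- With `k = 0` the resonance is `4π²n²/b² - b²/16 = -4π|n|j`. Substituting `b = 8πp/q` and
  -- multiplying by `16p²q²` gives these coefficients; the powers of `π` cancel in the first term,
  -- and the leading coefficient is nonzero because `p` is.
  refine LindemannWeierstrass.pi_not_quadratic (A := -64 * p ^ 4)
    (B := 64 * |n| * j * p ^ 2 * q ^ 2) (C := n ^ 2 * q ^ 4)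
    (mul_ne_zero (by norm_num) (pow_ne_zero _ hp)) ?_
  rw [hbe] at hre
  push_cast
  field_simp at hre
  norm_num at hre
  linear_combination (-1 / 64) * hre

theorem mode_eq_zero_of_closed {a b : ℝ} {p : ℤ} {q : ℕ} (hp : p ≠ 0) (hq : 0 < q) (hb0 : b ≠ 0)
    (hb : b / (8 * Real.pi) = (p : ℝ) / q) (hf : ContDiff ℝ ∞ f) (hi : Invariant f)
    (hg : ContDiff ℝ ∞ g) (hgi : Invariant g) (hF : dbarStarCoeff a b f g = 0)
    (hh : dbarCoeff a b f g = 0) (k m : ℤ) {n : ℤ} (hn : n ≠ 0) :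
    mode k m n f = 0 ∧ mode k m n g = 0 := by
  have hn' : (n : ℂ) ≠ 0 := by exact_mod_cast hn
  have hb' : (b : ℂ) ≠ 0 := by exact_mod_cast hb0
  have key : ∀ v : Cover, (fun x => mode k m n f (Function.update v 1 x)) = 0 ∧
      (fun x => mode k m n g (Function.update v 1 x)) = 0 := by
    intro v
    -- The coefficient `2π(m + n x - n(a ∓ i)/b)` equals `τ(x - x₀) ± iP`, so `a` and `m` only move
    -- the centre of the oscillator; the zero-order term `ib/2` is `2iQ`.
    refine first_order_system_eq_zero (τ := 2 * Real.pi * n) (κ := 2 * Real.pi * k)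
      (P := 2 * Real.pi * n / b) (Q := b / 4) (x₀ := a / b - m / n)
      (mul_ne_zero (by positivity) (by exact_mod_cast hn))
      (oscillator_nonresonance hp hq hb k) (fun x => ?_) (fun x => ?_)
      (rapidDecay_mode hf hi k m hn v) (rapidDecay_mode hg hgi k m hn v)
    · refine (hasDerivAt_mode_update hf k m n v x).congr_deriv ?_
      rw [(mode_frameDeriv_one hb0 hf hi hg hgi hF hh k m n _).1, Function.update_self]
      push_cast
      field_simp
      ring
    · refine (hasDerivAt_mode_update hg k m n v x).congr_deriv ?_
      rw [(mode_frameDeriv_one hb0 hf hi hg hgi hF hh k m n _).2, Function.update_self]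
      push_cast
      field_simp
      ring
  constructor <;> funext v
  · simpa using congrFun (key v).1 (v 1)
  · simpa using congrFun (key v).2 (v 1)

/-! ### Modes that do not depend on the central variable -/

/-- The component with frequencies `k`, `l`, `m` in `t`, `x`, `y` of the mean over the central
circle. -/
noncomputable def coef (k m l : ℤ) (f : Cover → ℂ) : Cover → ℂ := proj 1 l (mode k m 0 f)

theorem partialDeriv_coef (hf : ContDiff ℝ ∞ f) (hi : Invariant f) (k m l : ℤ) (i : Fin 4)
    (v : Cover) : partialDeriv i (coef k m l f) v =
      (![2 * Real.pi * I * k, 2 * Real.pi * I * l, 2 * Real.pi * I * m, 0] : Fin 4 → ℂ) i *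
        coef k m l f v := by
  have hm := contDiff_mode hf k m 0
  fin_cases i
  · simp only [coef, Fin.zero_eta, Matrix.cons_val]
    rw [partialDeriv_proj hm, partialDeriv_mode hf, mode_partialDeriv_zero hf hi, proj_const_mul]
  · simp only [coef, Fin.mk_one, Matrix.cons_val]
    rw [partialDeriv_proj_self hm (periodicIn_one_mode hi k m)]
  · simp only [coef, Fin.reduceFinMk, Matrix.cons_val]
    rw [partialDeriv_proj hm, partialDeriv_mode hf, mode_partialDeriv_two hf hi, proj_const_mul]
  · simp only [coef, Fin.reduceFinMk, Matrix.cons_val]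
    rw [partialDeriv_proj hm, partialDeriv_mode hf, mode_partialDeriv_three hf hi, proj_const_mul]
    simp

/-- All partial derivatives of the coefficient function are constant multiples of it, so its value
at the origin decides whether it vanishes. -/
theorem coef_eq_zero (hf : ContDiff ℝ ∞ f) (hi : Invariant f) {k m l : ℤ}
    (h : coef k m l f 0 = 0) : coef k m l f = 0 :=
  eq_zero_of_partialDeriv (contDiff_proj (contDiff_mode hf k m 0) 1 l) _
    (partialDeriv_coef hf hi k m l) h

theorem coef_equations {a b : ℝ} (hb : b ≠ 0) (hf : ContDiff ℝ ∞ f) (hi : Invariant f)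
    (hg : ContDiff ℝ ∞ g) (hgi : Invariant g) (hF : dbarStarCoeff a b f g = 0)
    (hh : dbarCoeff a b f g = 0) (k m l : ℤ) (v : Cover) :
    (k - I * l) * coef k m l f v = -m * coef k m l g v ∧
    (k + I * (l - b / (4 * Real.pi))) * coef k m l g v = m * coef k m l f v := by
  have hπ : (Real.pi : ℂ) ≠ 0 := by exact_mod_cast Real.pi_ne_zero
  have hmf := contDiff_mode hf k m 0
  have hmg := contDiff_mode hg k m 0
  have e1 : mode k m 0 (frameDeriv 1 f) = fun v => 2 * Real.pi * k * mode k m 0 f v +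
      2 * Real.pi * m * mode k m 0 g v := funext fun v => by
    rw [(mode_frameDeriv_one hb hf hi hg hgi hF hh k m 0 v).1]
    push_cast
    ring
  have e2 : mode k m 0 (frameDeriv 1 g) = fun v => (-(2 * Real.pi * k) + I * b / 2) *
      mode k m 0 g v + 2 * Real.pi * m * mode k m 0 f v := funext fun v => by
    rw [(mode_frameDeriv_one hb hf hi hg hgi hF hh k m 0 v).2]
    push_cast
    ring
  have c1 : proj 1 l (mode k m 0 (frameDeriv 1 f)) v = 2 * Real.pi * I * l * coef k m l f v := by
    rw [frameDeriv_one, ← partialDeriv_mode hf, proj_partialDeriv_self hmf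
      (periodicIn_one_mode hi k m)]
    rfl
  have c2 : proj 1 l (mode k m 0 (frameDeriv 1 g)) v = 2 * Real.pi * I * l * coef k m l g v := by
    rw [frameDeriv_one, ← partialDeriv_mode hg, proj_partialDeriv_self hmg
      (periodicIn_one_mode hgi k m)]
    rfl
  rw [e1, proj_add (contDiff_const.mul hmf).continuous (contDiff_const.mul hmg).continuous,
    proj_const_mul, proj_const_mul] at c1
  rw [e2, proj_add (contDiff_const.mul hmg).continuous (contDiff_const.mul hmf).continuous,
    proj_const_mul, proj_const_mul] at c2
  change _ * coef k m l f v + _ * coef k m l g v = _ at c1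
  change _ * coef k m l g v + _ * coef k m l f v = _ at c2
  constructor
  · apply mul_left_cancel₀ (mul_ne_zero two_ne_zero hπ)
    linear_combination c1
  · apply mul_left_cancel₀ (mul_ne_zero two_ne_zero hπ)
    field_simp
    linear_combination (-2) * c2

theorem coef_eq_zero_of_closed {a b : ℝ} (hb : b ≠ 0) (hf : ContDiff ℝ ∞ f) (hi : Invariant f)
    (hg : ContDiff ℝ ∞ g) (hgi : Invariant g) (hF : dbarStarCoeff a b f g = 0)
    (hh : dbarCoeff a b f g = 0) {k m l : ℤ}
    (hkml : k ≠ 0 ∨ (m, l) ∉ circlePoints (b / (8 * Real.pi))) (v : Cover) :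
    coef k m l f v = 0 ∧ coef k m l g v = 0 := by
  have hπ := Real.pi_ne_zero
  obtain ⟨h1, h2⟩ := coef_equations hb hf hi hg hgi hF hh k m l v
  -- The determinant of the `2 × 2` system. With `d = b/(8π)`, its imaginary part is `-2dk` and, for
  -- `k = 0`, its real part is `(l - d)² + m² - d²`.
  set D : ℂ := (k - I * l) * (k + I * (l - b / (4 * Real.pi))) + m ^ 2 with hD
  have hDf : D * coef k m l f v = 0 := by
    rw [hD]
    linear_combination (k + I * (l - b / (4 * Real.pi))) * h1 - m * h2
  have hDg : D * coef k m l g v = 0 := by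
    rw [hD]
    linear_combination (k - I * l) * h2 + m * h1
  have hD0 : D ≠ 0 := by
    intro h0
    have hr : D = ((k ^ 2 + l * (l - b / (4 * Real.pi)) + m ^ 2 : ℝ) : ℂ) +
        ((-(k * (b / (4 * Real.pi))) : ℝ) : ℂ) * I := by
      rw [hD]
      push_cast
      linear_combination (-(l : ℂ) * (l - b / (4 * Real.pi))) * I_sq
    rw [hr] at h0
    have him := congrArg im h0
    have hre := congrArg re h0
    simp only [add_im, ofReal_im, mul_im, ofReal_re, I_im, I_re, zero_im, add_re, mul_re,
      zero_re, mul_one, mul_zero, add_zero, zero_add, sub_zero] at him hre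
    have hk : (k : ℝ) = 0 := by
      rcases mul_eq_zero.1 (neg_eq_zero.1 him) with h | h
      · exact h
      · exact absurd h (div_ne_zero hb (mul_ne_zero (by norm_num) hπ))
    rcases hkml with h | h
    · exact h (by exact_mod_cast hk)
    · apply h
      change ((l : ℝ) - b / (8 * Real.pi)) ^ 2 + (m : ℝ) ^ 2 = (b / (8 * Real.pi)) ^ 2
      rw [hk] at hre
      linear_combination hre
  exact ⟨(mul_eq_zero.1 hDf).resolve_left hD0, (mul_eq_zero.1 hDg).resolve_left hD0⟩

/-- A harmonic form is determined by one coefficient for each lattice point of the circle. -/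
theorem eq_zero_of_closed {a b : ℝ} {p : ℤ} {q : ℕ} (hp : p ≠ 0) (hq : 0 < q) (hb0 : b ≠ 0)
    (hb : b / (8 * Real.pi) = (p : ℝ) / q) (hf : ContDiff ℝ ∞ f) (hi : Invariant f)
    (hg : ContDiff ℝ ∞ g) (hgi : Invariant g) (hF : dbarStarCoeff a b f g = 0)
    (hh : dbarCoeff a b f g = 0)
    (hc : ∀ x ∈ circlePoints (b / (8 * Real.pi)),
      (if x.2 = 0 then coef 0 x.1 x.2 f 0 else coef 0 x.1 x.2 g 0) = 0) : f = 0 ∧ g = 0 := by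
  have key : ∀ k m l : ℤ, coef k m l f = 0 ∧ coef k m l g = 0 := by
    intro k m l
    suffices h : coef k m l f 0 = 0 ∧ coef k m l g 0 = 0 from
      ⟨coef_eq_zero hf hi h.1, coef_eq_zero hg hgi h.2⟩
    by_cases hkml : k ≠ 0 ∨ (m, l) ∉ circlePoints (b / (8 * Real.pi))
    · exact coef_eq_zero_of_closed hb0 hf hi hg hgi hF hh hkml 0
    · push Not at hkml
      obtain ⟨rfl, hx⟩ := hkml
      obtain ⟨h1, h2⟩ := coef_equations hb0 hf hi hg hgi hF hh 0 m l 0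
      have h3 := hc _ hx
      -- On the circle one equation still determines the other coefficient: for `l = 0` the second
      -- one gives `g` from `f`, as `b ≠ 0`; for `l ≠ 0` the first one gives `f` from `g`.
      by_cases hl : l = 0
      · subst hl
        simp only [if_true] at h3
        refine ⟨h3, ?_⟩
        rw [h3, mul_zero] at h2
        refine (mul_eq_zero.1 h2).resolve_left ?_
        have : (b : ℂ) / (4 * Real.pi) ≠ 0 := by
          refine div_ne_zero (by exact_mod_cast hb0) (mul_ne_zero (by norm_num) ?_)
          exact_mod_cast Real.pi_ne_zero
        simpa using this
      · simp only [hl, if_false] at h3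
        refine ⟨?_, h3⟩
        rw [h3, mul_zero] at h1
        refine (mul_eq_zero.1 h1).resolve_left ?_
        simpa using hl
  have hmode : ∀ k m n, mode k m n f = 0 ∧ mode k m n g = 0 := by
    intro k m n
    by_cases hn : n = 0
    · subst hn
      exact ⟨eq_zero_of_proj_eq_zero (contDiff_mode hf k m 0).continuous
          (periodicIn_one_mode hi k m) fun l => (key k m l).1,
        eq_zero_of_proj_eq_zero (contDiff_mode hg k m 0).continuous
          (periodicIn_one_mode hgi k m) fun l => (key k m l).2⟩
    · exact mode_eq_zero_of_closed hp hq hb0 hb hf hi hg hgi hF hh k m hn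
  exact ⟨eq_zero_of_mode_eq_zero hf hi fun k m n => (hmode k m n).1,
    eq_zero_of_mode_eq_zero hg hgi fun k m n => (hmode k m n).2⟩

end KT

/-! ### Plane waves and the dimension of the harmonic space -/

namespace KT

open Complex

/-! ### Explicit harmonic forms and the dimension -/

theorem chr_intCast (k n : ℤ) : chr k n = 1 := by
  rw [chr, exp_eq_one_iff]
  exact ⟨k * n, by push_cast; ring⟩

theorem integral_chr {k : ℤ} (hk : k ≠ 0) : ∫ s in (0 : ℝ)..1, chr k s = 0 := by
  have hk' : (2 * Real.pi * I * k : ℂ) ≠ 0 := by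
    refine mul_ne_zero two_pi_I_ne_zero (by exact_mod_cast hk)
  have h := intervalIntegral.integral_eq_sub_of_hasDerivAt (a := 0) (b := 1)
    (fun x _ => hasDerivAt_chr k x)
    ((continuous_const.mul (continuous_chr k)).intervalIntegrable _ _)
  rw [chr_one, chr_zero_right, sub_self, intervalIntegral.integral_const_mul] at h
  exact (mul_eq_zero.1 h).resolve_left hk'

theorem proj_of_character {f : Cover → ℂ} {i : Fin 4} {k : ℤ}
    (h : ∀ v (s : ℝ), f (v + s • unitVec i) = chr k s * f v) (k' : ℤ) :
    proj i k' f = if k' = k then f else 0 := by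
  have e : ∀ v, proj i k' f v = (∫ s in (0 : ℝ)..1, chr (k - k') s) * f v := by
    intro v
    rw [proj, ← intervalIntegral.integral_mul_const]
    congr 1
    funext s
    rw [h, ← mul_assoc]
    congr 1
    rw [chr, chr, chr, ← exp_add]
    congr 1
    push_cast
    ring
  funext v
  rw [e]
  split_ifs with hk
  · simp [hk, chr_zero_left]
  · rw [integral_chr (by omega), zero_mul]
    rfl

/-- The function `exp (2 π i (l x + m y))` on `KT⁴`. -/
noncomputable def planeWave (m l : ℤ) (v : Cover) : ℂ := chr l (v 1) * chr m (v 2)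

theorem contDiff_planeWave (m l : ℤ) : ContDiff ℝ ∞ (planeWave m l) := by
  have h : ∀ (k : ℤ) (i : Fin 4), ContDiff ℝ ∞ fun v : Cover => chr k (v i) := fun k i =>
    (contDiff_const.mul (ofRealCLM.contDiff.comp (contDiff_coord i))).cexp
  exact (h l 1).mul (h m 2)

theorem invariant_planeWave (m l : ℤ) : Invariant (planeWave m l) := fun n v => by
  simp [planeWave, deck, chr_add, chr_intCast]

theorem planeWave_zero (m l : ℤ) : planeWave m l 0 = 1 := by
  simp [planeWave, chr_zero_right]

theorem planeWave_add_smul (m l : ℤ) (i : Fin 4) (v : Cover) (s : ℝ) :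
    planeWave m l (v + s • unitVec i) =
      chr ((![0, l, m, 0] : Fin 4 → ℤ) i) s * planeWave m l v := by
  fin_cases i <;> simp [planeWave, chr_add, chr_zero_left] <;> ring

theorem coef_const_mul (c : ℂ) (k m l : ℤ) (f : Cover → ℂ) :
    coef k m l (fun v => c * f v) = fun v => c * coef k m l f v := by
  rw [coef, mode_const_mul, proj_const_mul]
  rfl

theorem coef_add {f g : Cover → ℂ} (hf : ContDiff ℝ ∞ f) (hg : ContDiff ℝ ∞ g) (k m l : ℤ) :
    coef k m l (fun v => f v + g v) = fun v => coef k m l f v + coef k m l g v := by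
  rw [coef, mode_add hf hg, proj_add (contDiff_mode hf _ _ _).continuous
    (contDiff_mode hg _ _ _).continuous]
  rfl

theorem coef_planeWave (m l m' l' : ℤ) :
    coef 0 m' l' (planeWave m l) 0 = if m' = m ∧ l' = l then 1 else 0 := by
  have h := fun i k' => proj_of_character (planeWave_add_smul m l i) k'
  have hz : ∀ (i : Fin 4) (k : ℤ), proj i k 0 = 0 := fun i k => proj_zero i k
  rw [coef, mode, h 3]
  simp only [Matrix.cons_val, if_true]
  rw [h 2]
  simp only [Matrix.cons_val]
  by_cases hm : m' = m
  · simp only [hm, if_true, true_and]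
    rw [h 0]
    simp only [Matrix.cons_val, if_true]
    rw [h 1]
    simp only [Matrix.cons_val]
    by_cases hl : l' = l
    · simp [hl, planeWave_zero]
    · simp [hl]
  · simp [hm, hz]

theorem partialDeriv_planeWave (m l : ℤ) (i : Fin 4) (v : Cover) :
    partialDeriv i (planeWave m l) v =
      2 * Real.pi * I * ((![0, l, m, 0] : Fin 4 → ℤ) i) * planeWave m l v := by
  have h1 := hasDerivAt_line (contDiff_planeWave m l) v (unitVec i) 0
  simp only [planeWave_add_smul, zero_smul, add_zero] at h1
  have h2 := (hasDerivAt_chr ((![0, l, m, 0] : Fin 4 → ℤ) i) 0).mul_const (planeWave m l v)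
  rw [chr_zero_right, mul_one] at h2
  exact h1.unique h2

theorem dirDeriv_const_mul {f : Cover → ℂ} (hf : ContDiff ℝ ∞ f) (c : ℂ) (u : Fin 4 → ℂ)
    (v : Cover) : dirDeriv u (fun v => c * f v) v = c * dirDeriv u f v := by
  simp only [dirDeriv, frameDeriv_const_mul hf, Finset.mul_sum]
  exact Finset.sum_congr rfl fun j _ => by ring

theorem dirDeriv_planeWave (m l : ℤ) (u : Fin 4 → ℂ) (v : Cover) :
    dirDeriv u (planeWave m l) v = 2 * Real.pi * I * (l * u 1 + m * u 2) * planeWave m l v := by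
  rw [dirDeriv, Fin.sum_univ_four, frameDeriv_zero, frameDeriv_one, frameDeriv_two,
    frameDeriv_three]
  simp only [partialDeriv_planeWave, Matrix.cons_val]
  push_cast
  ring

/-- The coefficients of the harmonic form for a lattice point of the circle. -/
noncomputable def waveCoeff (x : ℤ × ℤ) : ℂ × ℂ :=
  if x.2 = 0 then (1, 0) else (-I * x.1 / x.2, 1)

/-- The harmonic form for a lattice point of the circle. -/
noncomputable def waveForm (a b : ℝ) (x : ℤ × ℤ) : Form 1 :=
  form01 a b (fun v => (waveCoeff x).1 * planeWave x.1 x.2 v)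
    (fun v => (waveCoeff x).2 * planeWave x.1 x.2 v)

theorem waveForm_mem {a b : ℝ} (hb : b ≠ 0) {x : ℤ × ℤ}
    (hx : x ∈ circlePoints (b / (8 * Real.pi))) : waveForm a b x ∈ harmonic01 a b := by
  have hπ : (Real.pi : ℂ) ≠ 0 := by exact_mod_cast Real.pi_ne_zero
  obtain ⟨m, l⟩ := x
  have hw := contDiff_planeWave m l
  have hs : ∀ c : ℂ, ContDiff ℝ ∞ fun v => c * planeWave m l v := fun c => contDiff_const.mul hw
  have hi : ∀ c : ℂ, Invariant fun v => c * planeWave m l v := fun c n v =>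
    congrArg (c * ·) (invariant_planeWave m l n v)
  refine ⟨isForm01_form01 hb (hs _) (hi _) (hs _) (hi _), ?_⟩
  rw [waveForm, dbarLaplacian_form01_eq_zero_iff hb (hs _) (hi _) (hs _) (hi _)]
  have hcR : (l : ℝ) ^ 2 + (m : ℝ) ^ 2 = 2 * (b / (8 * Real.pi)) * l := by
    have : ((l : ℝ) - b / (8 * Real.pi)) ^ 2 + (m : ℝ) ^ 2 = (b / (8 * Real.pi)) ^ 2 := hx
    linear_combination this
  have hc : (l : ℂ) ^ 2 + (m : ℂ) ^ 2 = 2 * (b / (8 * Real.pi)) * l := by exact_mod_cast hcR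
  have hc' : ((l : ℂ) ^ 2 + (m : ℂ) ^ 2) * (4 * Real.pi) = b * l := by
    rw [hc]
    field_simp
    ring
  constructor
  · funext v
    simp only [dbarStarCoeff, dirDeriv_const_mul hw, dirDeriv_planeWave, V1, V2, Matrix.cons_val,
      waveCoeff, Pi.zero_apply]
    split_ifs with hl
    · simp [hl]
    · have hl' : (l : ℂ) ≠ 0 := by exact_mod_cast hl
      field_simp
      ring_nf
      rw [show I ^ 3 = -I by rw [pow_succ, I_sq]; ring]
      ring
  · funext v
    simp only [dbarCoeff, dirDeriv_const_mul hw, dirDeriv_planeWave, V1bar, V2bar, Matrix.cons_val,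
      waveCoeff, Pi.zero_apply]
    split_ifs with hl
    · subst hl
      -- The only point of the circle with `l = 0` is the origin, where the form is the constant
      -- form `φ̄₁`.
      have hm : (m : ℂ) = 0 := by simpa using hc
      simp [hm]
    · have hl' : (l : ℂ) ≠ 0 := by exact_mod_cast hl
      field_simp
      ring_nf
      simp only [I_sq]
      linear_combination (-planeWave m l v) * hc'

/-- The evaluation of the coefficients of a harmonic form at the lattice points of the circle. -/
noncomputable def coefMap (a b : ℝ) :
    harmonic01 a b →ₗ[ℂ] (circlePoints (b / (8 * Real.pi)) → ℂ) where
  toFun α x := coef 0 x.1.1 x.1.2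
    (fun v => (α : Form 1) v (fun _ => unitaryFrame a b v (if x.1.2 = 0 then 0 else 2))) 0
  map_add' α β := by
    have hs : ∀ (α : harmonic01 a b) j,
        ContDiff ℝ ∞ fun v => (α : Form 1) v (fun _ => unitaryFrame a b v j) := fun α j =>
      contDiff_apply_vec (w := fun v _ => unitaryFrame a b v j) α.2.1.smooth
        fun _ => contDiff_unitaryFrame a b j
    funext x
    exact congrFun (coef_add (hs α _) (hs β _) _ _ _) 0
  map_smul' c α := by
    funext x
    exact congrFun (coef_const_mul c _ _ _ _) 0

theorem coefMap_apply {a b : ℝ} (hb : b ≠ 0) (α : harmonic01 a b) {f g : Cover → ℂ}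
    (h : (α : Form 1) = form01 a b f g) (x : circlePoints (b / (8 * Real.pi))) :
    coefMap a b α x = if x.1.2 = 0 then coef 0 x.1.1 x.1.2 f 0 else coef 0 x.1.1 x.1.2 g 0 := by
  change coef 0 x.1.1 x.1.2 (fun v => (α : Form 1) v
    (fun _ => unitaryFrame a b v (if x.1.2 = 0 then 0 else 2))) 0 = _
  simp only [h, form01_unitaryFrame hb]
  split_ifs <;> simp

theorem coefMap_injective {a b : ℝ} {p : ℤ} {q : ℕ} (hp : p ≠ 0) (hq : 0 < q) (hb0 : b ≠ 0)
    (hb : b / (8 * Real.pi) = (p : ℝ) / q) : Function.Injective (coefMap a b) := by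
  rw [injective_iff_map_eq_zero]
  intro α hα
  obtain ⟨f, g, ⟨hf, hi⟩, ⟨hg, hgi⟩, h⟩ := α.2.1.exists_eq_form01 hb0
  have h0 := α.2.2
  rw [h, dbarLaplacian_form01_eq_zero_iff hb0 hf hi hg hgi] at h0
  obtain ⟨rfl, rfl⟩ := eq_zero_of_closed hp hq hb0 hb hf hi hg hgi h0.1 h0.2 fun x hx => by
    rw [← coefMap_apply hb0 α h ⟨x, hx⟩, hα]
    rfl
  apply Subtype.ext
  rw [h]
  funext v
  ext w
  rw [form01_apply]
  simp

theorem coefMap_waveForm {a b : ℝ} (hb : b ≠ 0) (x y : circlePoints (b / (8 * Real.pi))) :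
    coefMap a b ⟨waveForm a b x, waveForm_mem hb x.2⟩ y = if y = x then 1 else 0 := by
  rw [coefMap_apply hb _ rfl]
  simp only [coef_const_mul, coef_planeWave]
  by_cases h : y = x
  · subst h
    by_cases hl : y.1.2 = 0 <;> simp [waveCoeff, hl]
  · have h' : ¬(y.1.1 = x.1.1 ∧ y.1.2 = x.1.2) := fun e =>
      h (Subtype.ext (Prod.ext e.1 e.2))
    simp [h, h']

/-- The plane wave forms are dual to the coefficients that `coefMap` reads, so a preimage is the
linear combination with the prescribed values; finiteness of the circle makes the sum legitimate. -/
theorem coefMap_surjective {a b : ℝ} (hb : b ≠ 0)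
    (hfin : (circlePoints (b / (8 * Real.pi))).Finite) : Function.Surjective (coefMap a b) := by
  have := hfin.fintype
  intro y
  refine ⟨∑ x, y x • ⟨waveForm a b x, waveForm_mem hb x.2⟩, ?_⟩
  funext z
  simp only [map_sum, map_smul, Finset.sum_apply, Pi.smul_apply, coefMap_waveForm hb, smul_eq_mul]
  simp

end KT

/-! ### Assembly of dimension and count -/

theorem theorem4p1 (a b : ℝ) (p : ℤ) (q : ℕ) (hp : p ≠ 0) (hq : 0 < q)
    (hpq : Int.gcd p q = 1) (hb : b / (8 * Real.pi) = (p : ℝ) / (q : ℝ)) :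
    Module.Finite ℂ (KT.harmonic01 a b) ∧
    (KT.circlePoints (b / (8 * Real.pi))).Finite ∧
    KT.h01 a b = (KT.circlePoints (b / (8 * Real.pi))).ncard ∧
    (q = 1 → KT.h01 a b = 4 * KT.oneModFourProd (p.natAbs ^ 2)) ∧
    (q = 2 → KT.h01 a b = 2 * KT.oneModFourProd (p.natAbs ^ 2)) ∧
    (q = 3 ∨ q = 4 ∨ q = 5 → KT.h01 a b = KT.oneModFourProd (p.natAbs ^ 2)) := by
  have hb0 : b ≠ 0 := by
    rintro rfl
    rw [zero_div, eq_comm, div_eq_zero_iff] at hb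
    rcases hb with h | h
    · exact hp (by exact_mod_cast h)
    · exact hq.ne' (by exact_mod_cast h)
  have hfin : (KT.circlePoints (b / (8 * Real.pi))).Finite := by
    rw [hb]
    exact KT.finite_circlePoints p hq
  have := hfin.fintype
  let e := LinearEquiv.ofBijective (KT.coefMap a b)
    ⟨KT.coefMap_injective hp hq hb0 hb, KT.coefMap_surjective hb0 hfin⟩
  have hdim : KT.h01 a b = (KT.circlePoints (b / (8 * Real.pi))).ncard := by
    rw [KT.h01, e.finrank_eq, Module.finrank_fintype_fun_eq_card, ← Nat.card_eq_fintype_card,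
      Nat.card_coe_set_eq]
  have hcount : KT.h01 a b = (KT.congruentPoints p q).ncard := by
    rw [hdim, hb, KT.ncard_circlePoints p hq]
  have hnorm := KT.ncard_ofNorm_sq (Int.natAbs_ne_zero.2 hp)
  have hdvd : ∀ r : ℕ, r ∣ q → r ≠ 1 → ¬(r : ℤ) ∣ p := by
    intro r hrq hr hrp
    apply hr
    have h : (r : ℤ) ∣ (Int.gcd p q : ℤ) := Int.dvd_coe_gcd hrp (by exact_mod_cast hrq)
    rw [hpq] at h
    exact Nat.dvd_one.1 (by exact_mod_cast h)
  refine ⟨Module.Finite.equiv e.symm, hfin, hdim, ?_, ?_, ?_⟩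
  · rintro rfl
    rw [hcount, KT.congruentPoints_one, hnorm]
  · rintro rfl
    have h := KT.ncard_congruentPoints_two (hdvd 2 dvd_rfl (by norm_num))
    rw [hcount]
    omega
  · rintro (rfl | rfl | rfl)
    · have h := KT.ncard_congruentPoints_three (hdvd 3 dvd_rfl (by norm_num))
      rw [hcount]
      omega
    -- For `q = 4` coprimality is used through the divisor `2`: the count needs `p` odd.
    · have h := KT.ncard_congruentPoints_four (hdvd 2 (by norm_num) (by norm_num))
      rw [hcount]
      omega
    · have h := KT.ncard_congruentPoints_five (hdvd 5 dvd_rfl (by norm_num))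
      rw [hcount]
      omega
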